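/- \textbf{Conventions.} Graphs are finite, undirected and unweighted; parallel edges and self-loops are allowed, and a self-loop contributes $1$ to the degree of its vertex. For $G=(V,E)$ let $\deg(v)$ be the number of edges incident to $v$, $\mathrm{vol}(S)=\sum_{v\in S}\deg(v)$, and let $E(S,T)$ be the set of edges with one end in $S$ and the other in $T$. The conductance of $G$ is $$\Phi_G=\min_{S}\frac{|E(S,V-S)|}{\min(\mathrm{vol}(S),\mathrm{vol}(V-S))},$$ the minimum over all $S\subset V$ such that both $S$ and $V-S$ have positive volume; $\Phi_G=1$ if there is no such $S$ (for instance if $G$ is a singleton). $G$ is a $\phi$-expander if $\Phi_G\ge\phi$. For $S\subseteq V$, $G\{S\}$ is the induced subgraph $G[S]$ with a self-loop added at $v\in S$ for each edge of $G$ between $v$ and $V-S$, so that every vertex of $S$ has the same degree in $G\{S\}$ as in $G$. \textbf{Theorem (Expander Pruning).} There are a deterministic online algorithm on a word RAM with words of $O(\log(n+m+p+q))$ bits, and an absolute constant $C$, with the following property. Let $\phi=p/q>0$ be a rational number ($p,q$ positive integers) and let $G=(V,E)$ be a $\phi$-expander with $n$ vertices, numbered $0,\dots,n-1$, and $m$ edges,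 numbered $0,\dots,m-1$. The algorithm has read access to $n,m,p,q$ and to the adjacency lists of $G$ (for each vertex $v$ its degree and, in arbitrary order, the edges incident to $v$ with their other ends), and starts with zero-initialised working memory and without preprocessing. Given any sequence of $k\le\phi m/10$ deletions of distinct edges of $G$, revealed one at a time (an edge together with its two ends; each deletion is handled before the next one is revealed), the algorithm maintains in its memory a pruned set $P\subseteq V$ as follows. Let $G_i$ and $P_i$ be the graph $G$ and the set $P$ after the $i$-th deletion. Then \begin{enumerate} \item $P_0=\emptyset$, and $P_i\subseteq P_{i+1}$ for all $0\le i<k$; \item $\mathrm{vol}(P_i)\le 8i/\phi$ and $|E(P_i,V-P_i)|\le 4i$ for all $0\le i\le k$, where $\mathrm{vol}$ and $E$ refer to the initial graph $G$; \item $G_i\{V-P_i\}$ is a $\phi/6$-expander for all $0\le i\le k$. \end{enumerate} The total number of steps for updating $P_0,\dots,P_k$ is at most $C\,k\log m/\phi^2$. -/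

import Mathlib

open scoped Graph

/-! ### Volume, cuts, conductance

Graphs are finite undirected multigraphs (`Graph` of Mathlib), parallel edges and self-loops being
allowed. A self-loop contributes `1` to the degree of its vertex. -/

/-- The degree of `v`: the number of edges incident to `v`. -/
noncomputable def Graph.degreeAt {V E : Type*} (G : Graph V E) (v : V) : ℕ :=
  Set.ncard {e | G.Inc e v}

/-- The volume of a set of vertices: the sum of the degrees. -/
noncomputable def Graph.vol {V E : Type*} (G : Graph V E) (S : Set V) : ℕ :=
  ∑ᶠ v ∈ S, G.degreeAt v

/-- The number of edges with one end in `S` and the other end in `T`. -/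
noncomputable def Graph.numEdgesBetween {V E : Type*} (G : Graph V E) (S T : Set V) : ℕ :=
  Set.ncard {e | ∃ x ∈ S, ∃ y ∈ T, G.IsLink e x y}

/-- The conductance of the cut `(S, V - S)`. -/
noncomputable def Graph.cutConductance {V E : Type*} (G : Graph V E) (S : Set V) : ℝ :=
  (G.numEdgesBetween S (V(G) \ S) : ℝ) / (min (G.vol S) (G.vol (V(G) \ S)) : ℕ)

/-- The cuts whose conductance is defined: both sides have positive volume. -/
def Graph.properCuts {V E : Type*} (G : Graph V E) : Set (Set V) :=
  {S | S ⊆ V(G) ∧ 0 < G.vol S ∧ 0 < G.vol (V(G) \ S)}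

open Classical in
/-- The conductance of a graph: the least conductance of a cut, and `1` if there is no cut to
consider, as for a singleton. -/
noncomputable def Graph.conductance {V E : Type*} (G : Graph V E) : ℝ :=
  if G.properCuts.Nonempty then sInf (G.cutConductance '' G.properCuts) else 1

/-- `G` is a `φ`-expander. -/
def Graph.IsExpander {V E : Type*} (G : Graph V E) (φ : ℝ) : Prop :=
  φ ≤ G.conductance

/-- The graph `G{S}`: the subgraph induced by `S`, in which every edge of `G` between a vertex
`v ∈ S` and a vertex outside `S` is replaced by a self-loop at `v`. -/
def Graph.induceWithLoops {V E : Type*} (G : Graph V E) (S : Set V) : Graph V E where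
  vertexSet := V(G) ∩ S
  IsLink e x y :=
    (G.IsLink e x y ∧ x ∈ S ∧ y ∈ S) ∨ (x = y ∧ x ∈ S ∧ ∃ z, z ∉ S ∧ G.IsLink e x z)
  isLink_symm := by
    intro e _
    refine ⟨?_⟩
    rintro x y (⟨h, hx, hy⟩ | ⟨rfl, hx, hz⟩)
    · exact Or.inl ⟨h.symm, hy, hx⟩
    · exact Or.inr ⟨rfl, hx, hz⟩
  eq_or_eq_of_isLink_of_isLink := by
    rintro e x y v w (⟨h, hx, hy⟩ | ⟨rfl, hx, z, hz, h⟩) (⟨h', hv, hw⟩ | ⟨rfl, hv, z', hz', h'⟩)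
    · exact h.left_eq_or_eq h'
    · rcases h'.right_eq_or_eq h with r | r <;> subst r <;> contradiction
    · rcases h.right_eq_or_eq h' with r | r <;> subst r <;> contradiction
    · rcases h.left_eq_or_eq h' with r | r
      · exact Or.inl r
      · subst r; contradiction
  left_mem_of_isLink := by
    rintro e x y (⟨h, hx, hy⟩ | ⟨rfl, hx, z, hz, h⟩)
    · exact ⟨h.left_mem, hx⟩
    · exact ⟨h.left_mem, hx⟩

namespace WordRAM

/-! ### A word RAM with adjacency-list access to a graph

Programs use registers and finitely many zero-initialised arrays of words, all indexed by natural
numbers. All values that occur (constants, addresses, intermediate results) have to be at most `W`.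
The input is read-only. -/

/-- The input: `numVertices`, `numEdges`, the numerator and the denominator of `φ`, and, for each
vertex, the list of its incident edges, as pairs `(other end, edge)`. -/
structure Input where
  numVertices : ℕ
  numEdges : ℕ
  phiNum : ℕ
  phiDen : ℕ
  adj : ℕ → List (ℕ × ℕ)

/-- The input describes the graph `G`, with vertices `0, …, n - 1` and edges `0, …, m - 1`; each
adjacency list is in an arbitrary order. -/
structure Input.Represents (I : Input) (G : Graph ℕ ℕ) : Prop where
  vertexSet_eq : V(G) = Set.Iio I.numVertices
  edgeSet_eq : E(G) = Set.Iio I.numEdges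
  nodup : ∀ v, (I.adj v).Nodup
  mem_adj : ∀ v u e, (u, e) ∈ I.adj v ↔ G.IsLink e v u

/-- Memory: registers `reg r`, and cells `cell a i` (position `i` of array `a`). -/
structure State where
  reg : ℕ → ℕ
  cell : ℕ → ℕ → ℕ

/-- The memory before the start. -/
def State.blank : State := ⟨fun _ => 0, fun _ _ => 0⟩

def State.setReg (s : State) (r x : ℕ) : State :=
  ⟨Function.update s.reg r x, s.cell⟩

def State.setCell (s : State) (a i x : ℕ) : State :=
  ⟨s.reg, Function.update s.cell a (Function.update (s.cell a) i x)⟩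

/-- Arithmetic and comparison of words (comparisons return `1` or `0`). -/
inductive BinOp where
  | add | sub | mul | div | mod | lt | eq

def BinOp.eval : BinOp → ℕ → ℕ → ℕ
  | .add, x, y => x + y
  | .sub, x, y => x - y
  | .mul, x, y => x * y
  | .div, x, y => x / y
  | .mod, x, y => x % y
  | .lt, x, y => if x < y then 1 else 0
  | .eq, x, y => if x = y then 1 else 0

/-- Expressions. `degree v` is the length of the adjacency list of `v`; `neighbor v j` and
`edge v j` are the two components of its `j`-th entry. -/
inductive Expr where
  | lit (x : ℕ)
  | reg (r : ℕ)
  | cell (a : ℕ) (i : Expr)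
  | op (o : BinOp) (x y : Expr)
  | numVertices
  | numEdges
  | phiNum
  | phiDen
  | degree (v : Expr)
  | neighbor (v j : Expr)
  | edge (v j : Expr)

/-- The value of an expression. -/
def Expr.eval (I : Input) (s : State) : Expr → ℕ
  | .lit x => x
  | .reg r => s.reg r
  | .cell a i => s.cell a (i.eval I s)
  | .op o x y => o.eval (x.eval I s) (y.eval I s)
  | .numVertices => I.numVertices
  | .numEdges => I.numEdges
  | .phiNum => I.phiNum
  | .phiDen => I.phiDen
  | .degree v => (I.adj (v.eval I s)).length
  | .neighbor v j => ((I.adj (v.eval I s)).getD (j.eval I s) (0, 0)).1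
  | .edge v j => ((I.adj (v.eval I s)).getD (j.eval I s) (0, 0)).2

/-- The number of elementary operations that evaluate an expression. -/
def Expr.size : Expr → ℕ
  | .cell _ i => i.size + 1
  | .op _ x y => x.size + y.size + 1
  | .degree v => v.size + 1
  | .neighbor v j => v.size + j.size + 1
  | .edge v j => v.size + j.size + 1
  | _ => 1

/-- The value of the expression and of each of its subexpressions is at most `W`. -/
def Expr.Fits (I : Input) (W : ℕ) (s : State) : Expr → Prop
  | .lit x => x ≤ W
  | .reg r => s.reg r ≤ W
  | .cell a i => i.Fits I W s ∧ s.cell a (i.eval I s) ≤ W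
  | .op o x y => x.Fits I W s ∧ y.Fits I W s ∧ o.eval (x.eval I s) (y.eval I s) ≤ W
  | .numVertices => I.numVertices ≤ W
  | .numEdges => I.numEdges ≤ W
  | .phiNum => I.phiNum ≤ W
  | .phiDen => I.phiDen ≤ W
  | .degree v => v.Fits I W s ∧ (Expr.degree v).eval I s ≤ W
  | .neighbor v j => v.Fits I W s ∧ j.Fits I W s ∧ (Expr.neighbor v j).eval I s ≤ W
  | .edge v j => v.Fits I W s ∧ j.Fits I W s ∧ (Expr.edge v j).eval I s ≤ W

/-- Programs. -/
inductive Program where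
  | skip
  | setReg (r : ℕ) (x : Expr)
  | setCell (a : ℕ) (i x : Expr)
  | seq (p q : Program)
  | branch (b : Expr) (p q : Program)
  | loop (b : Expr) (p : Program)

/-- `Exec I W p s s' t`: on input `I`, with words bounded by `W`, the program `p` started in memory
`s` halts in memory `s'` after exactly `t` steps. A test succeeds if its value is not `0`. -/
inductive Exec (I : Input) (W : ℕ) : Program → State → State → ℕ → Prop where
  | skip (s : State) : Exec I W .skip s s 1
  | setReg (r : ℕ) (x : Expr) (s : State) (hx : x.Fits I W s) :
      Exec I W (.setReg r x) s (s.setReg r (x.eval I s)) (x.size + 1)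
  | setCell (a : ℕ) (i x : Expr) (s : State) (hi : i.Fits I W s) (hx : x.Fits I W s) :
      Exec I W (.setCell a i x) s (s.setCell a (i.eval I s) (x.eval I s)) (i.size + x.size + 1)
  | seq {p q : Program} {s s' s'' : State} {t t' : ℕ} (hp : Exec I W p s s' t)
      (hq : Exec I W q s' s'' t') : Exec I W (.seq p q) s s'' (t + t')
  | branch_true {b : Expr} {p q : Program} {s s' : State} {t : ℕ} (hb : b.Fits I W s)
      (h : b.eval I s ≠ 0) (hp : Exec I W p s s' t) :
      Exec I W (.branch b p q) s s' (b.size + 1 + t)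
  | branch_false {b : Expr} {p q : Program} {s s' : State} {t : ℕ} (hb : b.Fits I W s)
      (h : b.eval I s = 0) (hq : Exec I W q s s' t) :
      Exec I W (.branch b p q) s s' (b.size + 1 + t)
  | loop_true {b : Expr} {p : Program} {s s' s'' : State} {t t' : ℕ} (hb : b.Fits I W s)
      (h : b.eval I s ≠ 0) (hp : Exec I W p s s' t) (hl : Exec I W (.loop b p) s' s'' t') :
      Exec I W (.loop b p) s s'' (b.size + 1 + t + t')
  | loop_false {b : Expr} {p : Program} {s : State} (hb : b.Fits I W s) (h : b.eval I s = 0) :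
      Exec I W (.loop b p) s s (b.size + 1)

/-- The machine is deterministic. -/
theorem Exec.deterministic {I : Input} {W : ℕ} {p : Program} {s s₁ s₂ : State} {t₁ t₂ : ℕ}
    (h₁ : Exec I W p s s₁ t₁) (h₂ : Exec I W p s s₂ t₂) : s₁ = s₂ ∧ t₁ = t₂ := by
  induction h₁ generalizing s₂ t₂ with
  | skip => cases h₂; exact ⟨rfl, rfl⟩
  | setReg => cases h₂; exact ⟨rfl, rfl⟩
  | setCell => cases h₂; exact ⟨rfl, rfl⟩
  | seq _ _ ih ih' =>
    cases h₂ with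
    | seq k k' =>
      obtain ⟨rfl, rfl⟩ := ih k
      obtain ⟨rfl, rfl⟩ := ih' k'
      exact ⟨rfl, rfl⟩
  | branch_true _ h _ ih =>
    cases h₂ with
    | branch_true _ _ k => obtain ⟨rfl, rfl⟩ := ih k; exact ⟨rfl, rfl⟩
    | branch_false _ k _ => exact absurd k h
  | branch_false _ h _ ih =>
    cases h₂ with
    | branch_false _ _ k => obtain ⟨rfl, rfl⟩ := ih k; exact ⟨rfl, rfl⟩
    | branch_true _ k _ => exact absurd h k
  | loop_true _ h _ _ ih ih' =>
    cases h₂ with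
    | loop_true _ _ k k' =>
      obtain ⟨rfl, rfl⟩ := ih k
      obtain ⟨rfl, rfl⟩ := ih' k'
      exact ⟨rfl, rfl⟩
    | loop_false _ k => exact absurd k h
  | loop_false _ h =>
    cases h₂ with
    | loop_false => exact ⟨rfl, rfl⟩
    | loop_true _ k _ _ => exact absurd h k

/-- A request to delete the edge `edge`, with ends `left` and `right`. -/
structure Deletion where
  edge : ℕ
  left : ℕ
  right : ℕ

/-- A request is announced in the registers `0`, `1`, `2`. -/
def State.receive (s : State) (d : Deletion) : State :=
  ((s.setReg 0 d.edge).setReg 1 d.left).setReg 2 d.right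

/-- The online run of `p` on the requests `d 0, …, d (k - 1)`, from blank memory: `s i` is the memory
after the `i`-th request has been handled, and `t i` is the number of steps spent on request `d i`.
Request `d i` is revealed only after the memory `s i` is final. -/
structure OnlineRun (I : Input) (W : ℕ) (p : Program) (k : ℕ) (d : ℕ → Deletion)
    (s : ℕ → State) (t : ℕ → ℕ) : Prop where
  start : s 0 = State.blank
  step : ∀ i < k, Exec I W p ((s i).receive (d i)) (s (i + 1)) (t i)

/-- The vertex set that is maintained in the memory: the vertices marked in array `0`. -/
def State.markedSet (s : State) (G : Graph ℕ ℕ) : Set ℕ :=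
  {v | v ∈ V(G) ∧ s.cell 0 v ≠ 0}

/-- `d 0, …, d (k - 1)` is a sequence of deletions of distinct edges of `G`. -/
structure IsDeletionSequence (G : Graph ℕ ℕ) (k : ℕ) (d : ℕ → Deletion) : Prop where
  isLink : ∀ i < k, G.IsLink (d i).edge (d i).left (d i).right
  distinct : ∀ i < k, ∀ j < k, (d i).edge = (d j).edge → i = j

/-- The graph after the first `i` deletions. -/
def graphAfter (G : Graph ℕ ℕ) (d : ℕ → Deletion) (i : ℕ) : Graph ℕ ℕ :=
  G.deleteEdges {e | ∃ j < i, (d j).edge = e}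

end WordRAM

/-! Pruning is a flow problem. Let U = ⌊2/φ⌋ + 1, so that 2/φ < U, and U ≤ 3/φ because φ ≤ 1. An
edge is dead if it was deleted or if one of its ends was pruned (and the removal at that end is
done). A dead edge is regarded as sending U units into each end that is not pruned, a live edge may
carry at most U net units, and a vertex may absorb as many units as its degree. Suppose that all
units have been absorbed, and let S be a set of unpruned vertices. Arcs inside S contribute
nonnegatively to the total inflow of S, so U · (dead boundary) ≤ vol(S) + U · (live boundary) by
`Core.cut`. If S is the smaller side, expansion of the initial graph gives φ vol(S) ≤ dead + live.
Together, at least φ vol(S)/4 boundary edges are live (`Ready.mul_vol_le`), which is more than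
needed.

Units are routed one at a time by push-relabel with levels at most H; a vertex of positive level is
saturated. If a unit is stuck at level H, the residual graph is searched from there in breadth-first
order. A residual arc descends at most one level, so the r-th layer has level at least H - r. The
volume is at most 2m and cannot grow by the factor 1 + 1/(8U) in H successive layers
(`lt_maxLevel`). Hence, before level 0 is reached, some ball of volume w is followed by a layer of
volume at most w/(8U). The ball is saturated, and it is pruned. The arcs leaving it that are not yet
full lead into that layer, so filling them takes at most 2U · w/(8U) = w/4 new units
(`Searching.debt_le`, `Searching.cut`).

A request injects 2U units. Pruning volume w injects at most w/4 units, while the pruned vertices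
keep the w units that they have absorbed. Thus c requests leave 3 vol(P) + 4 · (units absorbed
outside P) ≤ 8Uc (`Ready.prVol_add_le`). This bounds vol(P); it also bounds the boundary of P, which
is entirely dead, by `Core.cut` applied to the complement.

The running time is bounded by a potential that every transition lowers by at least 1
(`Invariant.potential_step`) and every request raises by O(UH) = O(U² log m) (`Ready.remove`).
Correctness is proved for the abstract transitions `Step` (`Invariant.step`), and the program
executes each of them in boundedly many operations (`runs_bodyProgram`). -/

namespace WordRAM

/-! ### Total correctness of programs -/

/-- Started in `s`, the program `p` halts, and its final memory and running time satisfy `Q`. -/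
def Runs (I : Input) (W : ℕ) (p : Program) (s : State) (Q : State → ℕ → Prop) : Prop :=
  ∃ s' t, Exec I W p s s' t ∧ Q s' t

section Runs

variable {I : Input} {W : ℕ} {s : State} {Q Q' : State → ℕ → Prop} {p q : Program}

theorem Runs.mono (h : Runs I W p s Q) (hQ : ∀ s' t, Q s' t → Q' s' t) : Runs I W p s Q' := by
  obtain ⟨s', t, h, hq⟩ := h
  exact ⟨s', t, h, hQ _ _ hq⟩

theorem runs_skip (h : Q s 1) : Runs I W .skip s Q := ⟨s, 1, .skip s, h⟩

theorem runs_setReg {r : ℕ} {x : Expr} (hx : x.Fits I W s)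
    (h : Q (s.setReg r (x.eval I s)) (x.size + 1)) : Runs I W (.setReg r x) s Q :=
  ⟨_, _, .setReg r x s hx, h⟩

theorem runs_setCell {a : ℕ} {i x : Expr} (hi : i.Fits I W s) (hx : x.Fits I W s)
    (h : Q (s.setCell a (i.eval I s) (x.eval I s)) (i.size + x.size + 1)) :
    Runs I W (.setCell a i x) s Q :=
  ⟨_, _, .setCell a i x s hi hx, h⟩

theorem runs_seq (h : Runs I W p s fun s' t => Runs I W q s' fun s'' t' => Q s'' (t + t')) :
    Runs I W (.seq p q) s Q := by
  obtain ⟨s', t, hp, s'', t', hq, h⟩ := h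
  exact ⟨s'', t + t', .seq hp hq, h⟩

theorem runs_branch {b : Expr} (hb : b.Fits I W s)
    (h₁ : b.eval I s ≠ 0 → Runs I W p s fun s' t => Q s' (b.size + 1 + t))
    (h₂ : b.eval I s = 0 → Runs I W q s fun s' t => Q s' (b.size + 1 + t)) :
    Runs I W (.branch b p q) s Q := by
  by_cases h : b.eval I s = 0
  · obtain ⟨s', t, hq, hQ⟩ := h₂ h
    exact ⟨s', _, .branch_false hb h hq, hQ⟩
  · obtain ⟨s', t, hp, hQ⟩ := h₁ h
    exact ⟨s', _, .branch_true hb h hp, hQ⟩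

/-- A loop halts if each iteration takes at most `K` steps and decreases the potential `f`. -/
theorem runs_loop {b : Expr} (K : ℕ) (Inv : State → Prop) (f : State → ℕ)
    (hb : ∀ s, Inv s → b.Fits I W s)
    (hp : ∀ s, Inv s → b.eval I s ≠ 0 →
      Runs I W p s fun s' t => t ≤ K ∧ Inv s' ∧ f s' + 1 ≤ f s)
    (hs : Inv s) :
    Runs I W (.loop b p) s fun s' t => Inv s' ∧ b.eval I s' = 0 ∧
      t + (K + b.size + 1) * f s' ≤ (K + b.size + 1) * f s + (b.size + 1) := by
  induction hn : f s using Nat.strong_induction_on generalizing s with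
  | _ n ih =>
    by_cases h : b.eval I s = 0
    · refine ⟨s, _, .loop_false (hb s hs) h, hs, h, ?_⟩
      rw [hn]; omega
    · obtain ⟨s₁, t₁, h₁, ht, hs₁, hf⟩ := hp s hs h
      obtain ⟨s₂, t₂, h₂, hs₂, h₂', ht₂⟩ := ih (f s₁) (by omega) hs₁ rfl
      refine ⟨s₂, _, .loop_true (hb s hs) h h₁ h₂, hs₂, h₂', ?_⟩
      have := Nat.mul_le_mul_left (K + b.size + 1) hf
      rw [hn] at this
      nlinarith

end Runs

namespace Pruning

/-! ### The configurations of the pruning algorithm -/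

/-- The data kept in memory: pruned vertices, dead edges, absorbed units, levels, current arcs,
flow, the search queue with the positions of the vertices in it, a stack of vertices with numbers of
units waiting there, and the control registers. -/
structure Conf where
  pr : ℕ → ℕ
  dead : ℕ → ℕ
  ab : ℕ → ℕ
  lev : ℕ → ℕ
  cur : ℕ → ℕ
  fl : ℕ → ℕ
  Q : ℕ → ℕ
  pos : ℕ → ℕ
  sv : ℕ → ℕ
  sc : ℕ → ℕ
  mode : ℕ
  sp : ℕ
  tok : ℕ
  idx : ℕ
  arc : ℕ
  lo : ℕ
  len : ℕ
  vS : ℕ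
  vQ : ℕ

def Conf.ofState (s : State) : Conf where
  pr := s.cell 0
  dead := s.cell 1
  ab := s.cell 2
  lev := s.cell 3
  cur := s.cell 4
  fl := s.cell 5
  Q := s.cell 6
  pos := s.cell 7
  sv := s.cell 8
  sc := s.cell 9
  mode := s.reg 5
  sp := s.reg 6
  tok := s.reg 7
  idx := s.reg 8
  arc := s.reg 9
  lo := s.reg 10
  len := s.reg 11
  vS := s.reg 12
  vQ := s.reg 13

/-- The position where the flow from `v` to `u` along the edge `e` is stored. -/
def slot (v u e : ℕ) : ℕ := 2 * e + if v < u then 1 else 0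

/-- The edge `e` can carry one more unit from `v` to `u`. -/
def Res (U : ℕ) (fl dead : ℕ → ℕ) (v u e : ℕ) : Prop :=
  dead e = 0 ∧ (0 < fl (slot u v e) ∨ fl (slot v u e) < U)

/-- The `j`-th entry of the adjacency list of `v` is `(u, e)`. -/
def ArcAt (adj : ℕ → List (ℕ × ℕ)) (v j u e : ℕ) : Prop :=
  j < (adj v).length ∧ ((adj v).getD j (0, 0)).1 = u ∧ ((adj v).getD j (0, 0)).2 = e

open Function in
/-- The transitions of the pruning algorithm. In mode `0` the next waiting unit is taken from the
stack; in mode `1` it walks; in mode `2` the residual graph is searched from its position and the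
scanned vertices are pruned; in mode `3` the edges of the pruned vertices are removed. -/
inductive Step (adj : ℕ → List (ℕ × ℕ)) (U H : ℕ) (σ : Conf) : Conf → Prop
  | pop (hm : σ.mode = 0) (hsp : 0 < σ.sp)
      (h : σ.sc (σ.sp - 1) = 0 ∨ σ.pr (σ.sv (σ.sp - 1)) ≠ 0) :
      Step adj U H σ { σ with sp := σ.sp - 1 }
  | take (hm : σ.mode = 0) (hsp : 0 < σ.sp) (h : σ.sc (σ.sp - 1) ≠ 0)
      (h' : σ.pr (σ.sv (σ.sp - 1)) = 0) :
      Step adj U H σ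
        { σ with
          tok := σ.sv (σ.sp - 1), sc := update σ.sc (σ.sp - 1) (σ.sc (σ.sp - 1) - 1), mode := 1 }
  | absorb (hm : σ.mode = 1) (h : σ.ab σ.tok < (adj σ.tok).length) :
      Step adj U H σ { σ with ab := update σ.ab σ.tok (σ.ab σ.tok + 1), mode := 0 }
  | cancel {u e : ℕ} (hm : σ.mode = 1) (h : (adj σ.tok).length ≤ σ.ab σ.tok)
      (ha : ArcAt adj σ.tok (σ.cur σ.tok) u e) (hl : σ.lev u + 1 = σ.lev σ.tok)
      (hd : σ.dead e = 0) (hf : 0 < σ.fl (slot u σ.tok e)) :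
      Step adj U H σ
        { σ with fl := update σ.fl (slot u σ.tok e) (σ.fl (slot u σ.tok e) - 1), tok := u }
  | forward {u e : ℕ} (hm : σ.mode = 1) (h : (adj σ.tok).length ≤ σ.ab σ.tok)
      (ha : ArcAt adj σ.tok (σ.cur σ.tok) u e) (hl : σ.lev u + 1 = σ.lev σ.tok)
      (hd : σ.dead e = 0) (hf : σ.fl (slot u σ.tok e) = 0) (hf' : σ.fl (slot σ.tok u e) < U) :
      Step adj U H σ
        { σ with fl := update σ.fl (slot σ.tok u e) (σ.fl (slot σ.tok u e) + 1), tok := u }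
  | advance {u e : ℕ} (hm : σ.mode = 1) (h : (adj σ.tok).length ≤ σ.ab σ.tok)
      (ha : ArcAt adj σ.tok (σ.cur σ.tok) u e)
      (hn : ¬ (σ.lev u + 1 = σ.lev σ.tok ∧ Res U σ.fl σ.dead σ.tok u e)) :
      Step adj U H σ { σ with cur := update σ.cur σ.tok (σ.cur σ.tok + 1) }
  | relabel (hm : σ.mode = 1) (h : (adj σ.tok).length ≤ σ.ab σ.tok)
      (hc : (adj σ.tok).length ≤ σ.cur σ.tok) (hl : σ.lev σ.tok < H) :
      Step adj U H σ
        { σ with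
          lev := update σ.lev σ.tok (σ.lev σ.tok + 1), cur := update σ.cur σ.tok 0 }
  | search (hm : σ.mode = 1) (h : (adj σ.tok).length ≤ σ.ab σ.tok)
      (hc : (adj σ.tok).length ≤ σ.cur σ.tok) (hl : H ≤ σ.lev σ.tok) :
      Step adj U H σ
        { σ with
          Q := update σ.Q 0 σ.tok, pos := update σ.pos σ.tok 0, idx := 0, arc := 0, lo := 1,
          len := 1, vS := (adj σ.tok).length, vQ := (adj σ.tok).length, mode := 2 }
  | enqueue {u e : ℕ} (hm : σ.mode = 2) (hi : σ.idx < σ.lo) (ha : ArcAt adj (σ.Q σ.idx) σ.arc u e)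
      (hr : Res U σ.fl σ.dead (σ.Q σ.idx) u e)
      (hq : ¬ (σ.pos u < σ.len ∧ σ.Q (σ.pos u) = u)) :
      Step adj U H σ
        { σ with
          Q := update σ.Q σ.len u, pos := update σ.pos u σ.len, len := σ.len + 1,
          vQ := σ.vQ + (adj u).length, arc := σ.arc + 1 }
  | pass {u e : ℕ} (hm : σ.mode = 2) (hi : σ.idx < σ.lo) (ha : ArcAt adj (σ.Q σ.idx) σ.arc u e)
      (hn : Res U σ.fl σ.dead (σ.Q σ.idx) u e → σ.pos u < σ.len ∧ σ.Q (σ.pos u) = u) :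
      Step adj U H σ { σ with arc := σ.arc + 1 }
  | finish (hm : σ.mode = 2) (hi : σ.idx < σ.lo) (ha : (adj (σ.Q σ.idx)).length ≤ σ.arc) :
      Step adj U H σ
        { σ with pr := update σ.pr (σ.Q σ.idx) 1, idx := σ.idx + 1, arc := 0 }
  | extend (hm : σ.mode = 2) (hi : σ.lo ≤ σ.idx) (h : σ.vS * (8 * U + 1) < 8 * U * σ.vQ) :
      Step adj U H σ { σ with lo := σ.len, vS := σ.vQ }
  | cut (hm : σ.mode = 2) (hi : σ.lo ≤ σ.idx) (h : 8 * U * σ.vQ ≤ σ.vS * (8 * U + 1)) :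
      Step adj U H σ { σ with idx := 0, arc := 0, mode := 3 }
  | kill_send {u e : ℕ} (hm : σ.mode = 3) (hi : σ.idx < σ.lo)
      (ha : ArcAt adj (σ.Q σ.idx) σ.arc u e) (hd : σ.dead e = 0) (hu : σ.pr u = 0) :
      Step adj U H σ
        { σ with
          dead := update σ.dead e 1, sv := update σ.sv σ.sp u,
          sc := update σ.sc σ.sp (U + σ.fl (slot u (σ.Q σ.idx) e) - σ.fl (slot (σ.Q σ.idx) u e)),
          sp := σ.sp + 1, arc := σ.arc + 1 }
  | kill_inner {u e : ℕ} (hm : σ.mode = 3) (hi : σ.idx < σ.lo)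
      (ha : ArcAt adj (σ.Q σ.idx) σ.arc u e) (hd : σ.dead e = 0) (hu : σ.pr u ≠ 0) :
      Step adj U H σ { σ with dead := update σ.dead e 1, arc := σ.arc + 1 }
  | kill_pass {u e : ℕ} (hm : σ.mode = 3) (hi : σ.idx < σ.lo)
      (ha : ArcAt adj (σ.Q σ.idx) σ.arc u e) (hd : σ.dead e ≠ 0) :
      Step adj U H σ { σ with arc := σ.arc + 1 }
  | kill_next (hm : σ.mode = 3) (hi : σ.idx < σ.lo) (ha : (adj (σ.Q σ.idx)).length ≤ σ.arc) :
      Step adj U H σ { σ with idx := σ.idx + 1, arc := 0 }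
  | kill_done (hm : σ.mode = 3) (hi : σ.lo ≤ σ.idx) : Step adj U H σ { σ with mode := 0 }

/-! ### The program -/

section Program

/-- Sequential composition of a list of programs. -/
def block : List Program → Program
  | [] => .skip
  | [p] => p
  | p :: q :: l => .seq p (block (q :: l))

def slotE (v u e : Expr) : Expr := .op .add (.op .mul (.lit 2) e) (.op .lt v u)

/-- A positive value means that the edge `e` can carry one more unit from `v` to `u`. -/
def resE (v u e : Expr) : Expr :=
  .op .mul (.op .eq (.cell 1 e) (.lit 0))
    (.op .add (.op .lt (.lit 0) (.cell 5 (slotE u v e)))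
      (.op .lt (.cell 5 (slotE v u e)) (.reg 3)))

/-- The number of units that must be added at `u` if the edge `e` to `v` is removed. -/
def refundE (u v e : Expr) : Expr :=
  .op .sub (.op .add (.reg 3) (.cell 5 (slotE u v e))) (.cell 5 (slotE v u e))

/-- The sum in the test acts as a disjunction: an entry is dropped if it holds no units or if its
vertex has been pruned meanwhile. In the second case its units are lost, which only helps the mass
bound. -/
def popProgram : Program :=
  .seq (.setReg 17 (.op .sub (.reg 6) (.lit 1)))
    (.branch (.op .add (.op .eq (.cell 9 (.reg 17)) (.lit 0)) (.cell 0 (.cell 8 (.reg 17))))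
      (.setReg 6 (.reg 17))
      (block [.setReg 7 (.cell 8 (.reg 17)),
        .setCell 9 (.reg 17) (.op .sub (.cell 9 (.reg 17)) (.lit 1)), .setReg 5 (.lit 1)]))

/-- The product in the test acts as a conjunction: one level down, and residual. Opposite flow is
cancelled before new flow is sent. After a push the current arc stays where it is, since it may
still be admissible. -/
def moveProgram : Program :=
  block [.setReg 15 (.neighbor (.reg 7) (.cell 4 (.reg 7))),
    .setReg 16 (.edge (.reg 7) (.cell 4 (.reg 7))),
    .branch (.op .mul (.op .eq (.op .add (.cell 3 (.reg 15)) (.lit 1)) (.cell 3 (.reg 7)))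
        (resE (.reg 7) (.reg 15) (.reg 16)))
      (.seq
        (.branch (.cell 5 (slotE (.reg 15) (.reg 7) (.reg 16)))
          (.setCell 5 (slotE (.reg 15) (.reg 7) (.reg 16))
            (.op .sub (.cell 5 (slotE (.reg 15) (.reg 7) (.reg 16))) (.lit 1)))
          (.setCell 5 (slotE (.reg 7) (.reg 15) (.reg 16))
            (.op .add (.cell 5 (slotE (.reg 7) (.reg 15) (.reg 16))) (.lit 1))))
        (.setReg 7 (.reg 15)))
      (.setCell 4 (.reg 7) (.op .add (.cell 4 (.reg 7)) (.lit 1)))]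

/-- A unit that cannot be absorbed scans the current arc; when the arcs are exhausted the level
rises by exactly one, and only at the largest level does a search start. -/
def walkProgram : Program :=
  .branch (.op .lt (.cell 2 (.reg 7)) (.degree (.reg 7)))
    (.seq (.setCell 2 (.reg 7) (.op .add (.cell 2 (.reg 7)) (.lit 1))) (.setReg 5 (.lit 0)))
    (.branch (.op .lt (.cell 4 (.reg 7)) (.degree (.reg 7)))
      moveProgram
      (.branch (.op .lt (.cell 3 (.reg 7)) (.reg 4))
        (.seq (.setCell 3 (.reg 7) (.op .add (.cell 3 (.reg 7)) (.lit 1)))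
          (.setCell 4 (.reg 7) (.lit 0)))
        (block [.setCell 6 (.lit 0) (.reg 7), .setCell 7 (.reg 7) (.lit 0), .setReg 8 (.lit 0),
          .setReg 9 (.lit 0), .setReg 10 (.lit 1), .setReg 11 (.lit 1),
          .setReg 12 (.degree (.reg 7)), .setReg 13 (.degree (.reg 7)), .setReg 5 (.lit 2)])))

/-- Membership in the queue is tested by `pos u < len` and `Q (pos u) = u`. This is correct whatever
old searches left in the arrays, so nothing is ever cleared. The growth test is the comparison of vQ
with (1 + 1/(8U)) vS, cleared of denominators. -/
def searchProgram : Program :=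
  .branch (.op .lt (.reg 8) (.reg 10))
    (.seq (.setReg 14 (.cell 6 (.reg 8)))
      (.branch (.op .lt (.reg 9) (.degree (.reg 14)))
        (block [.setReg 15 (.neighbor (.reg 14) (.reg 9)),
          .setReg 16 (.edge (.reg 14) (.reg 9)),
          .branch (.op .mul (resE (.reg 14) (.reg 15) (.reg 16))
              (.op .eq (.op .mul (.op .lt (.cell 7 (.reg 15)) (.reg 11))
                (.op .eq (.cell 6 (.cell 7 (.reg 15))) (.reg 15))) (.lit 0)))
            (block [.setCell 6 (.reg 11) (.reg 15), .setCell 7 (.reg 15) (.reg 11),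
              .setReg 11 (.op .add (.reg 11) (.lit 1)),
              .setReg 13 (.op .add (.reg 13) (.degree (.reg 15)))])
            .skip,
          .setReg 9 (.op .add (.reg 9) (.lit 1))])
        (block [.setCell 0 (.reg 14) (.lit 1), .setReg 8 (.op .add (.reg 8) (.lit 1)),
          .setReg 9 (.lit 0)])))
    (.branch (.op .lt (.op .mul (.reg 12) (.op .add (.op .mul (.lit 8) (.reg 3)) (.lit 1)))
        (.op .mul (.op .mul (.lit 8) (.reg 3)) (.reg 13)))
      (.seq (.setReg 10 (.reg 11)) (.setReg 12 (.reg 13)))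
      (block [.setReg 8 (.lit 0), .setReg 9 (.lit 0), .setReg 5 (.lit 3)]))

/-- An edge is processed at the first of its arcs that is met. The entry pushed for the other end
may hold zero units; it is discarded later. -/
def killProgram : Program :=
  .branch (.op .lt (.reg 8) (.reg 10))
    (.seq (.setReg 14 (.cell 6 (.reg 8)))
      (.branch (.op .lt (.reg 9) (.degree (.reg 14)))
        (block [.setReg 15 (.neighbor (.reg 14) (.reg 9)),
          .setReg 16 (.edge (.reg 14) (.reg 9)),
          .branch (.cell 1 (.reg 16))
            .skip
            (.seq (.setCell 1 (.reg 16) (.lit 1))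
              (.branch (.cell 0 (.reg 15))
                .skip
                (block [.setCell 8 (.reg 6) (.reg 15),
                  .setCell 9 (.reg 6) (refundE (.reg 15) (.reg 14) (.reg 16)),
                  .setReg 6 (.op .add (.reg 6) (.lit 1))]))),
          .setReg 9 (.op .add (.reg 9) (.lit 1))])
        (.seq (.setReg 8 (.op .add (.reg 8) (.lit 1))) (.setReg 9 (.lit 0)))))
    (.setReg 5 (.lit 0))

/-- One transition. -/
def bodyProgram : Program :=
  .branch (.op .eq (.reg 5) (.lit 0)) popProgram
    (.branch (.op .eq (.reg 5) (.lit 1)) walkProgram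
      (.branch (.op .eq (.reg 5) (.lit 2)) searchProgram killProgram))

/-- Zero exactly when the mode is `0` and the stack is empty. -/
def busyE : Expr := .op .add (.reg 5) (.reg 6)

/-- Computation of the edge capacity and of the largest level. -/
def setupProgram : Program :=
  block [.setReg 3 (.op .add (.op .div (.op .mul (.lit 2) .phiDen) .phiNum) (.lit 1)),
    .setReg 4 (.lit 0), .setReg 17 (.lit 1),
    .loop (.op .lt (.reg 17) (.op .add (.op .mul (.lit 2) .numEdges) (.lit 1)))
      (.seq (.setReg 17 (.op .mul (.reg 17) (.lit 2)))
        (.setReg 4 (.op .add (.reg 4) (.op .mul (.lit 8) (.reg 3)))))]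

/-- Removal of the announced edge. -/
def removeProgram : Program :=
  block [.setCell 8 (.lit 0) (.reg 1), .setCell 9 (.lit 0) (refundE (.reg 1) (.reg 2) (.reg 0)),
    .setCell 8 (.lit 1) (.reg 2), .setCell 9 (.lit 1) (refundE (.reg 2) (.reg 1) (.reg 0)),
    .setReg 6 (.lit 2), .setCell 1 (.reg 0) (.lit 1)]

/-- The handling of one request. -/
def program : Program :=
  .seq setupProgram (.seq removeProgram (.loop busyE bodyProgram))

end Program

/-! ### The program carries out the transitions -/

/-- All data of a configuration are at most `B`. -/
structure Conf.Bounded (B : ℕ) (σ : Conf) : Prop where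
  pr : ∀ i, σ.pr i ≤ B
  dead : ∀ i, σ.dead i ≤ B
  ab : ∀ i, σ.ab i ≤ B
  lev : ∀ i, σ.lev i ≤ B
  cur : ∀ i, σ.cur i ≤ B
  fl : ∀ i, σ.fl i ≤ B
  Q : ∀ i, σ.Q i ≤ B
  pos : ∀ i, σ.pos i ≤ B
  sv : ∀ i, σ.sv i ≤ B
  sc : ∀ i, σ.sc i ≤ B
  mode : σ.mode ≤ 3
  sp : σ.sp ≤ B
  tok : σ.tok ≤ B
  idx : σ.idx ≤ B
  arc : σ.arc ≤ B
  lo : σ.lo ≤ B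
  len : σ.len ≤ B
  vS : σ.vS ≤ B
  vQ : σ.vQ ≤ B

/-- The adjacency lists have lengths and entries at most `B`. -/
structure BoundedAdj (B : ℕ) (adj : ℕ → List (ℕ × ℕ)) : Prop where
  length_le : ∀ v, (adj v).length ≤ B
  fst_le : ∀ v j, ((adj v).getD j (0, 0)).1 ≤ B
  snd_le : ∀ v j, ((adj v).getD j (0, 0)).2 ≤ B

theorem slot_le {B e : ℕ} (h : e ≤ B) (v u : ℕ) : slot v u e ≤ 2 * B + 1 := by
  unfold slot; split <;> omega

section BinOp

variable {x y W : ℕ}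

theorem eval_add : BinOp.add.eval x y = x + y := rfl
theorem eval_sub : BinOp.sub.eval x y = x - y := rfl
theorem eval_mul : BinOp.mul.eval x y = x * y := rfl
theorem eval_div : BinOp.div.eval x y = x / y := rfl

theorem eval_lt_le (h : 1 ≤ W) : BinOp.lt.eval x y ≤ W := by
  simp only [BinOp.eval]; split <;> omega

theorem eval_eq_le (h : 1 ≤ W) : BinOp.eq.eval x y ≤ W := by
  simp only [BinOp.eval]; split <;> omega

theorem eval_lt_eq_zero : BinOp.lt.eval x y = 0 ↔ y ≤ x := by simp [BinOp.eval]

theorem eval_eq_eq_zero : BinOp.eq.eval x y = 0 ↔ x ≠ y := by simp [BinOp.eval]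

end BinOp

section Exec

variable {I : Input} {W B U H : ℕ} {s : State}

@[simp] theorem eval_slotE (v u e : Expr) :
    (slotE v u e).eval I s = slot (v.eval I s) (u.eval I s) (e.eval I s) := by
  simp [slotE, Expr.eval, BinOp.eval, slot]

theorem fits_slotE {v u e : Expr} (hv : v.Fits I W s) (hu : u.Fits I W s) (he : e.Fits I W s)
    (heB : e.eval I s ≤ B) (hW : 2 * B + 2 ≤ W) : (slotE v u e).Fits I W s := by
  have h1 : (if v.eval I s < u.eval I s then 1 else 0) ≤ 1 := by split <;> omega
  simp only [slotE, Expr.Fits, Expr.eval, BinOp.eval]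
  refine ⟨⟨by omega, he, by omega⟩, ⟨hv, hu, by omega⟩, by omega⟩

theorem eval_resE_eq_zero {v u e : Expr} (hU : s.reg 3 = U) :
    (resE v u e).eval I s = 0 ↔
      ¬ Res U (s.cell 5) (s.cell 1) (v.eval I s) (u.eval I s) (e.eval I s) := by
  simp only [resE, Expr.eval, eval_slotE, hU, Res, eval_mul, eval_add, mul_eq_zero, Nat.add_eq_zero_iff,
    eval_lt_eq_zero, eval_eq_eq_zero, not_and_or, not_or, not_lt]

theorem fits_resE {v u e : Expr} (hv : v.Fits I W s) (hu : u.Fits I W s) (he : e.Fits I W s)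
    (heB : e.eval I s ≤ B) (hW : 2 * B + 2 ≤ W) (hU : s.reg 3 ≤ B) (h1 : ∀ i, s.cell 1 i ≤ B)
    (h5 : ∀ i, s.cell 5 i ≤ B) : (resE v u e).Fits I W s ∧ (resE v u e).eval I s ≤ 2 := by
  have a1 := h1 (e.eval I s)
  have a2 := h5 (slot (u.eval I s) (v.eval I s) (e.eval I s))
  have a3 := h5 (slot (v.eval I s) (u.eval I s) (e.eval I s))
  have f1 := fits_slotE hu hv he heB hW
  have f2 := fits_slotE hv hu he heB hW
  have key : (resE v u e).eval I s ≤ 2 := by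
    simp only [resE, Expr.eval, eval_mul, eval_add]
    exact (Nat.mul_le_mul (eval_eq_le le_rfl) (Nat.add_le_add (eval_lt_le le_rfl)
      (eval_lt_le le_rfl))).trans (by norm_num)
  refine ⟨⟨⟨⟨he, ?_⟩, ?_, eval_eq_le (by omega)⟩, ⟨⟨?_, ⟨f1, ?_⟩, eval_lt_le (by omega)⟩,
    ⟨⟨f2, ?_⟩, ?_, eval_lt_le (by omega)⟩, ?_⟩, key.trans (by omega)⟩, key⟩
  · omega
  · simp only [Expr.Fits]; omega
  · simp only [Expr.Fits]; omega
  · simp only [eval_slotE]; omega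
  · simp only [eval_slotE]; omega
  · simp only [Expr.Fits]; omega
  · exact (Nat.add_le_add (eval_lt_le le_rfl) (eval_lt_le le_rfl)).trans (by omega)

theorem fits_refundE {v u e : Expr} (hv : v.Fits I W s) (hu : u.Fits I W s) (he : e.Fits I W s)
    (heB : e.eval I s ≤ B) (hW : 2 * B + 2 ≤ W) (hU : s.reg 3 ≤ B)
    (h5 : ∀ i, s.cell 5 i ≤ B) : (refundE v u e).Fits I W s := by
  have a2 := h5 (slot (u.eval I s) (v.eval I s) (e.eval I s))
  have a3 := h5 (slot (v.eval I s) (u.eval I s) (e.eval I s))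
  have f1 := fits_slotE hu hv he heB hW
  have f2 := fits_slotE hv hu he heB hW
  simp only [refundE, Expr.Fits, Expr.eval, BinOp.eval, eval_slotE]
  exact ⟨⟨by omega, ⟨f2, by omega⟩, by omega⟩, ⟨f1, by omega⟩, by omega⟩

/-- The outcome of one transition of the program: it is one of the transitions of the pruning
algorithm, and the parameters are kept. -/
def GoodStep (I : Input) (U H K : ℕ) (s s' : State) (t : ℕ) : Prop :=
  t ≤ K ∧ Step I.adj U H (Conf.ofState s) (Conf.ofState s') ∧ s'.reg 3 = U ∧ s'.reg 4 = H

/-- Symbolic execution, as in the lemmas below for the other modes: each path through the program is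
matched with one constructor of `Step`. Bounded data keep all intermediate values within a word;
here and in the walk the largest ones are the slot addresses and sums of two data. -/
theorem runs_popProgram (hU : s.reg 3 = U) (hH : s.reg 4 = H) (hW : 2 * B + 2 ≤ W)
    (hB : (Conf.ofState s).Bounded B) (hm : s.reg 5 = 0) (hsp : s.reg 6 ≠ 0) :
    Runs I W popProgram s (GoodStep I U H 50 s) := by
  obtain ⟨h0, h1, h2, h3, h4, h5, h6, h7, h8, h9, -, b6, b7, b8, b9, b10, b11, b12, b13⟩ := hB
  simp only [Conf.ofState] at *
  have a1 := h9 (s.reg 6 - 1)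
  have a2 := h0 (s.cell 8 (s.reg 6 - 1))
  have a3 := h8 (s.reg 6 - 1)
  refine runs_seq (runs_setReg ?_ (runs_branch ?_ (fun h => ?_) (fun h => ?_)))
  · simp only [Expr.Fits, Expr.eval, BinOp.eval]; omega
  · have := eval_eq_le (x := s.cell 9 (s.reg 6 - 1)) (y := 0) le_rfl
    simp [Expr.Fits, Expr.eval, eval_add, eval_sub, State.setReg]
    omega
  · refine runs_setReg ?_ ⟨by simp [Expr.size], ?_, by simpa [State.setReg], by simpa [State.setReg]⟩
    · simp [Expr.Fits, Expr.eval, eval_sub, State.setReg]; omega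
    have := Step.pop (adj := I.adj) (U := U) (H := H) (σ := Conf.ofState s) hm
      (Nat.pos_of_ne_zero hsp) (by
        simp only [Expr.eval, BinOp.eval, State.setReg] at h
        simp only [Conf.ofState]
        by_contra! hc
        simp [hc.1, hc.2] at h)
    simpa [Conf.ofState, State.setReg, Expr.eval, BinOp.eval] using this
  · refine runs_seq (runs_setReg ?_ (runs_seq (runs_setCell ?_ ?_ (runs_setReg ?_ ⟨by simp [Expr.size],
      ?_, by simpa [State.setReg], by simpa [State.setReg]⟩))))
    any_goals simp [Expr.Fits, Expr.eval, BinOp.eval, State.setReg]; omega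
    have := Step.take (adj := I.adj) (U := U) (H := H) (σ := Conf.ofState s) hm
      (Nat.pos_of_ne_zero hsp) (by
        rintro hc
        simp only [Conf.ofState] at hc
        simp [Expr.eval, BinOp.eval, State.setReg, hc] at h) (by
        simp [Expr.eval, BinOp.eval, State.setReg] at h
        exact h.2)
    simpa [Conf.ofState, State.setReg, State.setCell, Expr.eval, BinOp.eval] using this

theorem runs_moveProgram (hU : s.reg 3 = U) (hH : s.reg 4 = H) (hW : 2 * B + 2 ≤ W)
    (hB : (Conf.ofState s).Bounded B) (hA : BoundedAdj B I.adj) (hUB : U ≤ B) (hm : s.reg 5 = 1)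
    (hab : (I.adj (s.reg 7)).length ≤ s.cell 2 (s.reg 7))
    (hcur : s.cell 4 (s.reg 7) < (I.adj (s.reg 7)).length) :
    Runs I W moveProgram s (GoodStep I U H 80 s) := by
  obtain ⟨h0, h1, h2, h3, h4, h5, h6, h7, h8, h9, -, b6, b7, b8, b9, b10, b11, b12, b13⟩ := hB
  obtain ⟨d1, d2, d3⟩ := hA
  simp only [Conf.ofState] at *
  have a1 := h4 (s.reg 7)
  have a2 := d2 (s.reg 7) (s.cell 4 (s.reg 7))
  have a3 := d3 (s.reg 7) (s.cell 4 (s.reg 7))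
  refine runs_seq (runs_setReg ?_ (runs_seq (runs_setReg ?_ ?_)))
  · simp only [Expr.Fits, Expr.eval]; omega
  · simp [Expr.Fits, Expr.eval, State.setReg]; simp at a3; omega
  -- The two components of the adjacency entry are abstracted, so that the state after loading them
  -- has a readable form.
  obtain ⟨u, hu⟩ : ∃ u, ((I.adj (s.reg 7)).getD (s.cell 4 (s.reg 7)) (0, 0)).1 = u := ⟨_, rfl⟩
  obtain ⟨e, he⟩ : ∃ e, ((I.adj (s.reg 7)).getD (s.cell 4 (s.reg 7)) (0, 0)).2 = e := ⟨_, rfl⟩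
  have ha : ArcAt I.adj (s.reg 7) (s.cell 4 (s.reg 7)) u e := ⟨hcur, hu, he⟩
  rw [hu] at a2
  rw [he] at a3
  simp only [Expr.eval, State.setReg, ne_eq, Nat.reduceEqDiff, not_false_eq_true, Function.update_of_ne, hu, he]
  set s₁ : State := ⟨Function.update (Function.update s.reg 15 u) 16 e, s.cell⟩ with hs₁
  have e7 : s₁.reg 7 = s.reg 7 := by simp [hs₁]
  have e15 : s₁.reg 15 = u := by simp [hs₁]
  have e16 : s₁.reg 16 = e := by simp [hs₁]
  have e3 : s₁.reg 3 = U := by simp [hs₁, hU]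
  have ec : s₁.cell = s.cell := rfl
  have f7 : (Expr.reg 7).Fits I W s₁ := by simp only [Expr.Fits, e7]; omega
  have f15 : (Expr.reg 15).Fits I W s₁ := by simp only [Expr.Fits, e15]; omega
  have f16 : (Expr.reg 16).Fits I W s₁ := by simp only [Expr.Fits, e16]; omega
  have f16' : (Expr.reg 16).eval I s₁ ≤ B := by simpa only [Expr.eval, e16]
  have hres := fits_resE f7 f15 f16 f16' hW (by omega) h1 h5
  have hres' := eval_resE_eq_zero (I := I) (s := s₁) (v := .reg 7) (u := .reg 15) (e := .reg 16) e3
  have b3 := h3 (s.reg 7)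
  have b3' := h3 u
  have sl1 := slot_le a3 u (s.reg 7)
  have sl2 := slot_le a3 (s.reg 7) u
  have c1 := h5 (slot u (s.reg 7) e)
  have c2 := h5 (slot (s.reg 7) u e)
  refine runs_branch ?_ (fun h => ?_) (fun h => ?_)
  · have := Nat.mul_le_mul (eval_eq_le (x := s.cell 3 u + 1) (y := s.cell 3 (s.reg 7)) le_rfl) hres.2
    simp only [Expr.Fits, Expr.eval, eval_add, eval_mul, e7, e15, ec, hres.1]
    exact ⟨⟨⟨⟨by omega, by omega⟩, by omega, by omega⟩, ⟨by omega, by omega⟩,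
      eval_eq_le (by omega)⟩, trivial, by omega⟩
  · have h' : s.cell 3 u + 1 = s.cell 3 (s.reg 7) ∧ Res U (s.cell 5) (s.cell 1) (s.reg 7) u e := by
      simp only [Expr.eval, eval_mul, eval_add, ne_eq, mul_eq_zero, not_or, hres', eval_eq_eq_zero,
        not_not, e7, e15, e16, ec] at h
      exact h
    refine runs_seq (runs_branch ?_ (fun hf => ?_) (fun hf => ?_))
    · exact ⟨fits_slotE f15 f7 f16 f16' hW, by simp only [eval_slotE, Expr.eval, e15, e7, e16, ec]; omega⟩
    · simp only [Expr.eval, eval_slotE, e7, e15, e16, ec] at hf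
      refine runs_setCell (fits_slotE f15 f7 f16 f16' hW) ?_ (runs_setReg ?_
        ⟨by simp [Expr.size, resE, slotE], ?_, by simpa [State.setReg, State.setCell, hs₁],
        by simpa [State.setReg, State.setCell, hs₁]⟩)
      · have := fits_slotE f15 f7 f16 f16' hW
        simp only [Expr.Fits, Expr.eval, eval_slotE, e7, e15, e16, ec, this, BinOp.eval]
        exact ⟨⟨trivial, by omega⟩, by omega, by omega⟩
      · simp only [Expr.Fits, State.setCell, e15]; omega
      have := Step.cancel (adj := I.adj) (U := U) (H := H) (σ := Conf.ofState s) hm hab ha h'.1 h'.2.1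
        (Nat.pos_of_ne_zero hf)
      simpa [Conf.ofState, State.setReg, State.setCell, Expr.eval, BinOp.eval, e15, e7, e16, hs₁]
        using this
    · simp only [Expr.eval, eval_slotE, e7, e15, e16, ec] at hf
      refine runs_setCell (fits_slotE f7 f15 f16 f16' hW) ?_ (runs_setReg ?_
        ⟨by simp [Expr.size, resE, slotE], ?_, by simpa [State.setReg, State.setCell, hs₁],
        by simpa [State.setReg, State.setCell, hs₁]⟩)
      · have := fits_slotE f7 f15 f16 f16' hW
        simp only [Expr.Fits, Expr.eval, eval_slotE, e7, e15, e16, ec, this, BinOp.eval]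
        refine ⟨⟨trivial, ?_⟩, ?_, ?_⟩ <;> omega
      · simp only [Expr.Fits, State.setCell, e15]; omega
      have := Step.forward (adj := I.adj) (U := U) (H := H) (σ := Conf.ofState s) hm hab ha h'.1
        h'.2.1 hf (h'.2.2.resolve_left (by omega))
      simpa [Conf.ofState, State.setReg, State.setCell, Expr.eval, BinOp.eval, e15, e7, e16, hs₁]
        using this
  · refine runs_setCell f7 ?_ ⟨by simp [Expr.size, resE, slotE], ?_,
      by simpa [State.setReg, State.setCell, hs₁], by simpa [State.setReg, State.setCell, hs₁]⟩
    · simp only [Expr.Fits, Expr.eval, BinOp.eval, e7, ec]; omega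
    have := Step.advance (adj := I.adj) (U := U) (H := H) (σ := Conf.ofState s) hm hab ha (by
      simp only [Expr.eval, eval_mul, eval_add, mul_eq_zero, hres', eval_eq_eq_zero, e7, e15, e16,
        ec] at h
      exact not_and_or.2 h)
    simpa [Conf.ofState, State.setReg, State.setCell, Expr.eval, BinOp.eval, e15, e7, e16, hs₁]
        using this

theorem runs_walkProgram (hU : s.reg 3 = U) (hH : s.reg 4 = H) (hW : 2 * B + 3 ≤ W)
    (hB : (Conf.ofState s).Bounded B) (hA : BoundedAdj B I.adj) (hUB : U ≤ B) (hHB : H ≤ B)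
    (hm : s.reg 5 = 1) :
    Runs I W walkProgram s (GoodStep I U H 100 s) := by
  have hmove := runs_moveProgram (I := I) (W := W) hU hH (by omega) hB hA hUB hm
  obtain ⟨h0, h1, h2, h3, h4, h5, h6, h7, h8, h9, -, b6, b7, b8, b9, b10, b11, b12, b13⟩ := hB
  obtain ⟨d1, d2, d3⟩ := hA
  simp only [Conf.ofState] at *
  have a1 := h2 (s.reg 7)
  have a2 := d1 (s.reg 7)
  have a3 := h4 (s.reg 7)
  have a4 := h3 (s.reg 7)
  refine runs_branch ?_ (fun h => ?_) (fun h => ?_)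
  · simp only [Expr.Fits, Expr.eval]
    exact ⟨by omega, by omega, eval_lt_le (by omega)⟩
  · refine runs_seq (runs_setCell ?_ ?_ (runs_setReg ?_ ⟨by simp [Expr.size], ?_,
      by simpa [State.setReg, State.setCell], by simpa [State.setReg, State.setCell]⟩))
    any_goals simp [Expr.Fits, Expr.eval, BinOp.eval, State.setReg]; omega
    · simp [Expr.Fits]
    have := Step.absorb (adj := I.adj) (U := U) (H := H) (σ := Conf.ofState s) hm (by
      by_contra hc
      simp only [Conf.ofState] at hc
      simp [Expr.eval, BinOp.eval, hc] at h)
    simpa [Conf.ofState, State.setReg, State.setCell, Expr.eval, BinOp.eval] using this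
  have hab : (I.adj (s.reg 7)).length ≤ s.cell 2 (s.reg 7) := by
    by_contra! hc
    simp [Expr.eval, BinOp.eval, hc] at h
  refine runs_branch ?_ (fun h => ?_) (fun h => ?_)
  · simp only [Expr.Fits, Expr.eval]
    exact ⟨by omega, by omega, eval_lt_le (by omega)⟩
  · have hcur : s.cell 4 (s.reg 7) < (I.adj (s.reg 7)).length := by
      by_contra! hc
      simp [Expr.eval, BinOp.eval, hc.not_gt] at h
    refine (hmove hab hcur).mono fun s' t ht => ⟨?_, ht.2⟩
    have := ht.1
    simp only [Expr.size]; omega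
  have hcur : (I.adj (s.reg 7)).length ≤ s.cell 4 (s.reg 7) := by
    by_contra! hc
    simp [Expr.eval, BinOp.eval, hc] at h
  refine runs_branch ?_ (fun h => ?_) (fun h => ?_)
  · simp only [Expr.Fits, Expr.eval]
    exact ⟨by omega, by omega, eval_lt_le (by omega)⟩
  · refine runs_seq (runs_setCell ?_ ?_ (runs_setCell ?_ ?_ ⟨by simp [Expr.size], ?_,
      by simpa [State.setReg, State.setCell], by simpa [State.setReg, State.setCell]⟩))
    any_goals simp [Expr.Fits, Expr.eval, BinOp.eval, State.setCell]; omega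
    · simp [Expr.Fits]
    have := Step.relabel (adj := I.adj) (U := U) (H := H) (σ := Conf.ofState s) hm hab hcur (by
      by_contra hc
      simp only [Conf.ofState] at hc
      simp [Expr.eval, BinOp.eval, hH, hc] at h)
    simpa [Conf.ofState, State.setReg, State.setCell, Expr.eval, BinOp.eval] using this
  · refine runs_seq (runs_setCell ?_ ?_ (runs_seq (runs_setCell ?_ ?_ (runs_seq (runs_setReg ?_
      (runs_seq (runs_setReg ?_ (runs_seq (runs_setReg ?_ (runs_seq (runs_setReg ?_
      (runs_seq (runs_setReg ?_ (runs_seq (runs_setReg ?_ (runs_setReg ?_ ⟨by simp [Expr.size], ?_,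
      by simpa [State.setReg, State.setCell],
      by simpa [State.setReg, State.setCell]⟩))))))))))))))))
    any_goals simp [Expr.Fits, Expr.eval, State.setReg, State.setCell]; omega
    any_goals simp [Expr.Fits]
    have := Step.search (adj := I.adj) (U := U) (H := H) (σ := Conf.ofState s) hm hab hcur (by
      by_contra! hc
      simp only [Conf.ofState] at hc
      simp [Expr.eval, BinOp.eval, hH, hc] at h)
    simpa [Conf.ofState, State.setReg, State.setCell, Expr.eval, BinOp.eval] using this

end Exec

/-! ### Execution of the search and of the removal of edges. -/

section Exec

variable {I : Input} {W B U H : ℕ} {s : State}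

/-- The quadratic word bound is due to the products in the growth test. -/
theorem runs_searchProgram (hU : s.reg 3 = U) (hH : s.reg 4 = H) (hW : B * (8 * B + 1) + 2 * B + 8 ≤ W)
    (hB : (Conf.ofState s).Bounded B) (hA : BoundedAdj B I.adj) (hUB : U ≤ B) (hm : s.reg 5 = 2) :
    Runs I W searchProgram s (GoodStep I U H 120 s) := by
  obtain ⟨h0, h1, h2, h3, h4, h5, h6, h7, h8, h9, -, b6, b7, b8, b9, b10, b11, b12, b13⟩ := hB
  obtain ⟨d1, d2, d3⟩ := hA
  simp only [Conf.ofState] at *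
  have hBW : 2 * B + 8 ≤ W := by omega
  have q1 := h6 (s.reg 8)
  refine runs_branch ?_ (fun h => ?_) (fun h => ?_)
  · simp only [Expr.Fits, Expr.eval]
    exact ⟨by omega, by omega, eval_lt_le (by omega)⟩
  · have hi : s.reg 8 < s.reg 10 := by
      by_contra! hc
      simp [Expr.eval, BinOp.eval, hc.not_gt] at h
    refine runs_seq (runs_setReg ?_ ?_)
    · simp only [Expr.Fits, Expr.eval]; omega
    have a0 := d1 (s.cell 6 (s.reg 8))
    refine runs_branch ?_ (fun h => ?_) (fun h => ?_)
    · simp [Expr.Fits, Expr.eval, State.setReg]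
      exact ⟨by omega, by omega, eval_lt_le (by omega)⟩
    · have hcur : s.reg 9 < (I.adj (s.cell 6 (s.reg 8))).length := by
        by_contra! hc
        simp [Expr.eval, BinOp.eval, State.setReg, hc.not_gt] at h
      have a2 := d2 (s.cell 6 (s.reg 8)) (s.reg 9)
      have a3 := d3 (s.cell 6 (s.reg 8)) (s.reg 9)
      obtain ⟨u, hu⟩ : ∃ u, ((I.adj (s.cell 6 (s.reg 8))).getD (s.reg 9) (0, 0)).1 = u := ⟨_, rfl⟩
      obtain ⟨e, he⟩ : ∃ e, ((I.adj (s.cell 6 (s.reg 8))).getD (s.reg 9) (0, 0)).2 = e := ⟨_, rfl⟩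
      have ha : ArcAt I.adj (s.cell 6 (s.reg 8)) (s.reg 9) u e := ⟨hcur, hu, he⟩
      rw [hu] at a2
      rw [he] at a3
      refine runs_seq (runs_setReg ?_ (runs_seq (runs_setReg ?_ (runs_seq ?_))))
      · simp [Expr.Fits, Expr.eval, State.setReg]
        simp at hu
        omega
      · simp [Expr.Fits, Expr.eval, State.setReg]
        simp at he
        omega
      simp only [Expr.eval, State.setReg, ne_eq, Nat.reduceEqDiff, not_false_eq_true,
        Function.update_of_ne, Function.update_self, hu, he]
      obtain ⟨v, hv⟩ : ∃ v, s.cell 6 (s.reg 8) = v := ⟨_, rfl⟩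
      rw [hv] at ha q1 a0 hcur ⊢
      set s₁ : State :=
        ⟨Function.update (Function.update (Function.update s.reg 14 v) 15 u) 16 e, s.cell⟩ with hs₁
      have e14 : s₁.reg 14 = v := by simp [hs₁]
      have e15 : s₁.reg 15 = u := by simp [hs₁]
      have e16 : s₁.reg 16 = e := by simp [hs₁]
      have e11 : s₁.reg 11 = s.reg 11 := by simp [hs₁]
      have e3 : s₁.reg 3 = U := by simp [hs₁, hU]
      have ec : s₁.cell = s.cell := rfl
      have f14 : (Expr.reg 14).Fits I W s₁ := by simp only [Expr.Fits, e14]; omega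
      have f15 : (Expr.reg 15).Fits I W s₁ := by simp only [Expr.Fits, e15]; omega
      have f16 : (Expr.reg 16).Fits I W s₁ := by simp only [Expr.Fits, e16]; omega
      have f16' : (Expr.reg 16).eval I s₁ ≤ B := by simpa only [Expr.eval, e16]
      have hres := fits_resE (v := .reg 14) f14 f15 f16 f16' (by omega) (by omega) h1 h5
      have hres' := eval_resE_eq_zero (I := I) (s := s₁) (v := .reg 14) (u := .reg 15)
        (e := .reg 16) e3
      have c1 := h7 u
      have c2 := h6 (s.cell 7 u)
      have c3 := d1 u
      refine runs_branch ?_ (fun h => ?_) (fun h => ?_)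
      · have m1 := Nat.mul_le_mul (eval_lt_le (x := s.cell 7 u) (y := s.reg 11) le_rfl)
          (eval_eq_le (x := s.cell 6 (s.cell 7 u)) (y := u) le_rfl)
        have m2 := Nat.mul_le_mul hres.2 (eval_eq_le (x := BinOp.lt.eval (s.cell 7 u) (s.reg 11) *
          BinOp.eq.eval (s.cell 6 (s.cell 7 u)) u) (y := 0) le_rfl)
        simp only [Expr.Fits, Expr.eval, eval_mul, e11, e15, ec, hres.1, true_and]
        exact ⟨⟨⟨⟨⟨by omega, by omega⟩, by omega, eval_lt_le (by omega)⟩, ⟨⟨⟨by omega, by omega⟩,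
          by omega⟩, by omega, eval_eq_le (by omega)⟩, by omega⟩, by omega, eval_eq_le (by omega)⟩,
          by omega⟩
      · simp only [Expr.eval, eval_mul, ne_eq, mul_eq_zero, not_or, hres', eval_eq_eq_zero,
          eval_lt_eq_zero, not_not, not_le, e11, e14, e15, e16, ec] at h
        refine runs_seq (runs_setCell ?_ ?_ (runs_seq (runs_setCell ?_ ?_ (runs_seq (runs_setReg ?_
          (runs_setReg ?_ (runs_setReg ?_ ⟨by simp [Expr.size, resE, slotE], ?_,
          by simp [State.setReg, State.setCell, hs₁, hU],
          by simp [State.setReg, State.setCell, hs₁, hH]⟩)))))))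
        any_goals simp [Expr.Fits, Expr.eval, BinOp.eval, State.setReg, State.setCell, hs₁]
        any_goals omega
        have := Step.enqueue (adj := I.adj) (U := U) (H := H) (σ := Conf.ofState s) hm hi
          (by simpa only [Conf.ofState, hv] using ha) (by simpa only [Conf.ofState, hv] using h.1)
          (by
            simp only [Conf.ofState]
            rintro ⟨x1, x2⟩
            have := h.2
            omega)
        simpa [Conf.ofState, State.setReg, State.setCell, Expr.eval, BinOp.eval, hs₁] using this
      · simp only [Expr.eval, eval_mul, ne_eq, mul_eq_zero, hres', eval_eq_eq_zero, not_or,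
          eval_lt_eq_zero, not_not, not_le, e11, e14, e15, e16, ec] at h
        refine runs_skip (runs_setReg ?_ ⟨by simp [Expr.size, resE, slotE], ?_,
          by simp [State.setReg, hs₁, hU], by simp [State.setReg, hs₁, hH]⟩)
        · simp [Expr.Fits, Expr.eval, BinOp.eval, hs₁]
          omega
        have := Step.pass (adj := I.adj) (U := U) (H := H) (σ := Conf.ofState s) hm hi
          (by simpa only [Conf.ofState, hv] using ha) (by
            simp only [Conf.ofState, hv]
            intro hr
            exact h.resolve_left (not_not.2 hr))
        simpa [Conf.ofState, State.setReg, State.setCell, Expr.eval, BinOp.eval, hs₁] using this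
    · have hcur : (I.adj (s.cell 6 (s.reg 8))).length ≤ s.reg 9 := by
        by_contra! hc
        simp [Expr.eval, BinOp.eval, State.setReg, hc] at h
      refine runs_seq (runs_setCell ?_ ?_ (runs_seq (runs_setReg ?_ (runs_setReg ?_
        ⟨by simp [Expr.size], ?_, by simpa [State.setReg, State.setCell],
        by simpa [State.setReg, State.setCell]⟩))))
      any_goals simp [Expr.Fits, Expr.eval, BinOp.eval, State.setReg, State.setCell]
      any_goals omega
      have := Step.finish (adj := I.adj) (U := U) (H := H) (σ := Conf.ofState s) hm hi hcur
      simpa [Conf.ofState, State.setReg, State.setCell, Expr.eval, BinOp.eval] using this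
  · have hi : s.reg 10 ≤ s.reg 8 := by
      by_contra! hc
      simp [Expr.eval, BinOp.eval, hc] at h
    have m1 := Nat.mul_le_mul b12 (show 8 * U + 1 ≤ 8 * B + 1 by omega)
    have m2 := Nat.mul_le_mul (show 8 * U ≤ 8 * B by omega) b13
    have m3 : 8 * B * B ≤ B * (8 * B + 1) := by nlinarith
    have m4 : 8 * B ≤ B * (8 * B + 1) := by nlinarith [Nat.le_mul_self B]
    refine runs_branch ?_ (fun h => ?_) (fun h => ?_)
    · simp only [Expr.Fits, Expr.eval, eval_mul, eval_add, hU]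
      exact ⟨⟨by omega, ⟨⟨by omega, by omega, by omega⟩, by omega, by omega⟩, by omega⟩,
        ⟨⟨by omega, by omega, by omega⟩, by omega, by omega⟩, eval_lt_le (by omega)⟩
    · simp only [Expr.eval, eval_mul, eval_add, ne_eq, eval_lt_eq_zero, not_le, hU] at h
      refine runs_seq (runs_setReg ?_ (runs_setReg ?_
        ⟨by simp [Expr.size], ?_, by simpa [State.setReg], by simpa [State.setReg]⟩))
      any_goals simp [Expr.Fits, State.setReg]
      any_goals omega
      have := Step.extend (adj := I.adj) (U := U) (H := H) (σ := Conf.ofState s) hm hi h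
      simpa [Conf.ofState, State.setReg, State.setCell, Expr.eval, BinOp.eval] using this
    · simp only [Expr.eval, eval_mul, eval_add, eval_lt_eq_zero, hU] at h
      refine runs_seq (runs_setReg ?_ (runs_seq (runs_setReg ?_ (runs_setReg ?_
        ⟨by simp [Expr.size], ?_, by simpa [State.setReg], by simpa [State.setReg]⟩))))
      any_goals simp [Expr.Fits]
      any_goals omega
      have := Step.cut (adj := I.adj) (U := U) (H := H) (σ := Conf.ofState s) hm hi h
      simpa [Conf.ofState, State.setReg, State.setCell, Expr.eval, BinOp.eval] using this

theorem runs_killProgram (hU : s.reg 3 = U) (hH : s.reg 4 = H) (hW : 2 * B + 8 ≤ W)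
    (hB : (Conf.ofState s).Bounded B) (hA : BoundedAdj B I.adj) (hUB : U ≤ B) (hm : s.reg 5 = 3) :
    Runs I W killProgram s (GoodStep I U H 120 s) := by
  obtain ⟨h0, h1, h2, h3, h4, h5, h6, h7, h8, h9, -, b6, b7, b8, b9, b10, b11, b12, b13⟩ := hB
  obtain ⟨d1, d2, d3⟩ := hA
  simp only [Conf.ofState] at *
  have q1 := h6 (s.reg 8)
  refine runs_branch ?_ (fun h => ?_) (fun h => ?_)
  · simp only [Expr.Fits, Expr.eval]
    exact ⟨by omega, by omega, eval_lt_le (by omega)⟩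
  · have hi : s.reg 8 < s.reg 10 := by
      by_contra! hc
      simp [Expr.eval, BinOp.eval, hc.not_gt] at h
    refine runs_seq (runs_setReg ?_ ?_)
    · simp only [Expr.Fits, Expr.eval]; omega
    have a0 := d1 (s.cell 6 (s.reg 8))
    refine runs_branch ?_ (fun h => ?_) (fun h => ?_)
    · simp [Expr.Fits, Expr.eval, State.setReg]
      exact ⟨by omega, by omega, eval_lt_le (by omega)⟩
    · have hcur : s.reg 9 < (I.adj (s.cell 6 (s.reg 8))).length := by
        by_contra! hc
        simp [Expr.eval, BinOp.eval, State.setReg, hc.not_gt] at h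
      have a2 := d2 (s.cell 6 (s.reg 8)) (s.reg 9)
      have a3 := d3 (s.cell 6 (s.reg 8)) (s.reg 9)
      obtain ⟨u, hu⟩ : ∃ u, ((I.adj (s.cell 6 (s.reg 8))).getD (s.reg 9) (0, 0)).1 = u := ⟨_, rfl⟩
      obtain ⟨e, he⟩ : ∃ e, ((I.adj (s.cell 6 (s.reg 8))).getD (s.reg 9) (0, 0)).2 = e := ⟨_, rfl⟩
      have ha : ArcAt I.adj (s.cell 6 (s.reg 8)) (s.reg 9) u e := ⟨hcur, hu, he⟩
      rw [hu] at a2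
      rw [he] at a3
      refine runs_seq (runs_setReg ?_ (runs_seq (runs_setReg ?_ (runs_seq ?_))))
      · simp [Expr.Fits, Expr.eval, State.setReg]
        simp at hu
        omega
      · simp [Expr.Fits, Expr.eval, State.setReg]
        simp at he
        omega
      simp only [Expr.eval, State.setReg, ne_eq, Nat.reduceEqDiff, not_false_eq_true,
        Function.update_of_ne, Function.update_self, hu, he]
      obtain ⟨v, hv⟩ : ∃ v, s.cell 6 (s.reg 8) = v := ⟨_, rfl⟩
      have ha' : ArcAt (Input.adj I) ((Conf.ofState s).Q (Conf.ofState s).idx) (Conf.ofState s).arc u e :=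
        ha
      rw [hv] at ha q1 a0 hcur ⊢
      set s₁ : State :=
        ⟨Function.update (Function.update (Function.update s.reg 14 v) 15 u) 16 e, s.cell⟩ with hs₁
      have e14 : s₁.reg 14 = v := by simp [hs₁]
      have e15 : s₁.reg 15 = u := by simp [hs₁]
      have e16 : s₁.reg 16 = e := by simp [hs₁]
      have f14 : (Expr.reg 14).Fits I W s₁ := by simp only [Expr.Fits, e14]; omega
      have f15 : (Expr.reg 15).Fits I W s₁ := by simp only [Expr.Fits, e15]; omega
      have f16 : (Expr.reg 16).Fits I W s₁ := by simp only [Expr.Fits, e16]; omega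
      have c1 := h1 e
      have c2 := h0 u
      refine runs_branch ?_ (fun h => ?_) (fun h => ?_)
      · simp only [Expr.Fits, Expr.eval, hs₁]
        simp
        omega
      · simp only [Expr.eval, e16, ne_eq] at h
        refine runs_skip (runs_setReg ?_ ⟨by simp [Expr.size], ?_,
          by simp [State.setReg, hs₁, hU], by simp [State.setReg, hs₁, hH]⟩)
        · simp [Expr.Fits, Expr.eval, BinOp.eval, hs₁]
          omega
        have := Step.kill_pass (adj := I.adj) (U := U) (H := H) (σ := Conf.ofState s) hm hi ha' h
        simpa [Conf.ofState, State.setReg, State.setCell, Expr.eval, BinOp.eval, hs₁] using this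
      · simp only [Expr.eval, e16] at h
        refine runs_seq (runs_setCell f16 ?_ ?_)
        · simp only [Expr.Fits]; omega
        refine runs_branch ?_ (fun h' => ?_) (fun h' => ?_)
        · simp [Expr.Fits, State.setCell, Expr.eval, hs₁]
          omega
        · simp [Expr.eval, State.setCell, hs₁] at h'
          refine runs_skip (runs_setReg ?_ ⟨by simp [Expr.size], ?_,
            by simp [State.setReg, State.setCell, hs₁, hU],
            by simp [State.setReg, State.setCell, hs₁, hH]⟩)
          · simp [Expr.Fits, Expr.eval, BinOp.eval, hs₁, State.setCell]
            omega
          have := Step.kill_inner (adj := I.adj) (U := U) (H := H) (σ := Conf.ofState s) hm hi ha' h h'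
          simpa [Conf.ofState, State.setReg, State.setCell, Expr.eval, BinOp.eval, hs₁] using this
        · simp [Expr.eval, State.setCell, hs₁] at h'
          refine runs_seq (runs_setCell ?_ ?_ (runs_seq (runs_setCell ?_ ?_ (runs_setReg ?_
            (runs_setReg ?_ ⟨by simp [Expr.size, refundE, slotE], ?_,
            by simp [State.setReg, State.setCell, hs₁, hU],
            by simp [State.setReg, State.setCell, hs₁, hH]⟩)))))
          any_goals
            simp [Expr.Fits, Expr.eval, BinOp.eval, State.setReg, State.setCell, hs₁]
            omega
          · refine fits_refundE (B := B) ?_ ?_ ?_ ?_ (by omega) ?_ ?_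
            any_goals
              simp [Expr.Fits, Expr.eval, State.setCell, hs₁]
              try omega
          have := Step.kill_send (adj := I.adj) (U := U) (H := H) (σ := Conf.ofState s) hm hi ha' h h'
          simpa [Conf.ofState, State.setReg, State.setCell, Expr.eval, BinOp.eval, refundE, hs₁, hv,
            hU] using this
    · have hcur : (I.adj (s.cell 6 (s.reg 8))).length ≤ s.reg 9 := by
        by_contra! hc
        simp [Expr.eval, BinOp.eval, State.setReg, hc] at h
      refine runs_seq (runs_setReg ?_ (runs_setReg ?_
        ⟨by simp [Expr.size], ?_, by simpa [State.setReg, State.setCell],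
        by simpa [State.setReg, State.setCell]⟩))
      any_goals simp [Expr.Fits, Expr.eval, BinOp.eval, State.setReg]
      any_goals omega
      have := Step.kill_next (adj := I.adj) (U := U) (H := H) (σ := Conf.ofState s) hm hi hcur
      simpa [Conf.ofState, State.setReg, State.setCell, Expr.eval, BinOp.eval] using this
  · have hi : s.reg 10 ≤ s.reg 8 := by
      by_contra! hc
      simp [Expr.eval, BinOp.eval, hc] at h
    refine runs_setReg ?_ ⟨by simp [Expr.size], ?_, by simpa [State.setReg], by simpa [State.setReg]⟩
    · simp [Expr.Fits]
    have := Step.kill_done (adj := I.adj) (U := U) (H := H) (σ := Conf.ofState s) hm hi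
    simpa [Conf.ofState, State.setReg, State.setCell, Expr.eval, BinOp.eval] using this

theorem runs_bodyProgram (hU : s.reg 3 = U) (hH : s.reg 4 = H) (hW : B * (8 * B + 1) + 2 * B + 8 ≤ W)
    (hB : (Conf.ofState s).Bounded B) (hA : BoundedAdj B I.adj) (hUB : U ≤ B) (hHB : H ≤ B)
    (hb : s.reg 5 + s.reg 6 ≠ 0) : Runs I W bodyProgram s (GoodStep I U H 200 s) := by
  have hBW : 2 * B + 8 ≤ W := by omega
  have hm := hB.mode
  simp only [Conf.ofState] at hm
  have fits : ∀ x ≤ 3, (Expr.op .eq (.reg 5) (.lit x)).Fits I W s := fun x hx =>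
    ⟨by simp only [Expr.Fits]; omega, by simp only [Expr.Fits]; omega, eval_eq_le (by omega)⟩
  have late : ∀ {K p}, K ≤ 120 → Runs I W p s (GoodStep I U H K s) → ∀ c ≤ 80,
      Runs I W p s fun s' t => GoodStep I U H 200 s s' (c + t) :=
    fun hK h c hc => h.mono fun s' t ht => ⟨by have := ht.1; omega, ht.2⟩
  refine runs_branch (fits 0 (by omega)) (fun h => ?_) (fun h => ?_)
  · simp only [Expr.eval, ne_eq, eval_eq_eq_zero, not_not] at h
    exact late (by norm_num) (runs_popProgram hU hH (by omega) hB h (by omega)) _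
      (by simp [Expr.size])
  simp only [Expr.eval, eval_eq_eq_zero] at h
  refine runs_branch (fits 1 (by omega)) (fun h => ?_) (fun h => ?_)
  · simp only [Expr.eval, ne_eq, eval_eq_eq_zero, not_not] at h
    refine (runs_walkProgram hU hH (by omega) hB hA hUB hHB h).mono fun s' t ht => ⟨?_, ht.2⟩
    have := ht.1
    simp only [Expr.size]; omega
  simp only [Expr.eval, eval_eq_eq_zero] at h
  refine runs_branch (fits 2 (by omega)) (fun h => ?_) (fun h => ?_)
  · simp only [Expr.eval, ne_eq, eval_eq_eq_zero, not_not] at h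
    refine (runs_searchProgram hU hH hW hB hA hUB h).mono fun s' t ht => ⟨?_, ht.2⟩
    have := ht.1
    simp only [Expr.size]; omega
  · simp only [Expr.eval, eval_eq_eq_zero] at h
    refine (runs_killProgram hU hH (by omega) hB hA hUB (by omega)).mono fun s' t ht => ⟨?_, ht.2⟩
    have := ht.1
    simp only [Expr.size]; omega

end Exec

/-! ### The invariants of the pruning algorithm -/

/-- The adjacency lists of a multigraph with `n` vertices and `m` edges. -/
structure IsSymmAdj (adj : ℕ → List (ℕ × ℕ)) (n m : ℕ) : Prop where
  nodup : ∀ v, (adj v).Nodup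
  symm : ∀ {v u e}, (u, e) ∈ adj v → (v, e) ∈ adj u
  ends : ∀ {v u v' u' e}, (u, e) ∈ adj v → (u', e) ∈ adj v' →
    (v' = v ∧ u' = u) ∨ (v' = u ∧ u' = v)
  vert_lt : ∀ {v u e}, (u, e) ∈ adj v → v < n
  edge_lt : ∀ {v u e}, (u, e) ∈ adj v → e < m
  sum_le : ∑ v ∈ Finset.range n, (adj v).length ≤ 2 * m

/-- The flow into `v` along the arc `a`; a dead edge counts as a full one. -/
def inflow (U : ℕ) (fl dead : ℕ → ℕ) (v : ℕ) (a : ℕ × ℕ) : ℤ :=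
  if dead a.2 = 0 then (fl (slot a.1 v a.2) : ℤ) - fl (slot v a.1 a.2) else U

/-- The number of units waiting at `v`. -/
def pend (sp : ℕ) (sv sc : ℕ → ℕ) (v : ℕ) : ℕ :=
  ∑ i ∈ Finset.range sp, if sv i = v then sc i else 0

/-- The invariants of the flow and of the levels. -/
structure Core (adj : ℕ → List (ℕ × ℕ)) (U H : ℕ) (σ : Conf) : Prop where
  fl_le : ∀ i, σ.fl i ≤ U
  ab_le : ∀ v, σ.ab v ≤ (adj v).length
  lev_le : ∀ v, σ.lev v ≤ H
  cur_le : ∀ v, σ.cur v ≤ (adj v).length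
  full : ∀ v, σ.lev v ≠ 0 ∨ σ.cur v ≠ 0 → σ.ab v = (adj v).length ∧ 0 < (adj v).length
  valid : ∀ v u e, (u, e) ∈ adj v → Res U σ.fl σ.dead v u e → σ.lev v ≤ σ.lev u + 1
  scanned : ∀ v j u e, j < σ.cur v → ArcAt adj v j u e → Res U σ.fl σ.dead v u e →
    σ.lev v ≤ σ.lev u
  stack : ∀ i < σ.sp, 0 < (adj (σ.sv i)).length
  pr_full : ∀ v, σ.pr v ≠ 0 → σ.ab v = (adj v).length ∧ 0 < (adj v).length
  balance : ∀ v, σ.pr v = 0 → ∑ a ∈ (adj v).toFinset, inflow U σ.fl σ.dead v a ≤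
    σ.ab v + pend σ.sp σ.sv σ.sc v + if (σ.mode = 1 ∨ σ.mode = 2) ∧ σ.tok = v then 1 else 0

/-- The number of units absorbed, waiting or walking. -/
def mass (n : ℕ) (σ : Conf) : ℕ :=
  ∑ v ∈ Finset.range n, σ.ab v + ∑ i ∈ Finset.range σ.sp, σ.sc i + if σ.mode = 1 then 1 else 0

/-- The volume of the pruned set. -/
def prVol (adj : ℕ → List (ℕ × ℕ)) (n : ℕ) (pr : ℕ → ℕ) : ℕ :=
  ∑ v ∈ Finset.range n, if pr v = 0 then 0 else (adj v).length

/-- All edges at pruned vertices are dead. -/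
def Closed (adj : ℕ → List (ℕ × ℕ)) (σ : Conf) : Prop :=
  ∀ v, σ.pr v ≠ 0 → ∀ u e, (u, e) ∈ adj v → σ.dead e ≠ 0

/-- The number of units that are needed to make all edges at pruned vertices dead. -/
def debt (adj : ℕ → List (ℕ × ℕ)) (n U : ℕ) (pr fl dead : ℕ → ℕ) : ℤ :=
  ∑ v ∈ Finset.range n, if pr v = 0 then
    ∑ a ∈ (adj v).toFinset, if pr a.1 ≠ 0 ∧ dead a.2 = 0 then U - inflow U fl dead v a else 0
  else 0

/-- The invariants of the search for a cut. -/
structure Searching (adj : ℕ → List (ℕ × ℕ)) (n U H c : ℕ) (σ : Conf) : Prop where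
  idx_le : σ.idx ≤ σ.lo
  lo_pos : 0 < σ.lo
  lo_le : σ.lo ≤ σ.len
  head : σ.Q 0 = σ.tok
  pos_eq : ∀ i < σ.len, σ.pos (σ.Q i) = i
  deg_pos : ∀ i < σ.len, 0 < (adj (σ.Q i)).length
  pr_iff : ∀ i < σ.len, σ.pr (σ.Q i) = 0 ↔ σ.idx ≤ i
  closed : ∀ v, σ.pr v ≠ 0 → (∀ u e, (u, e) ∈ adj v → σ.dead e ≠ 0) ∨ ∃ i < σ.idx, σ.Q i = v
  arc_le : σ.idx < σ.lo → σ.arc ≤ (adj (σ.Q σ.idx)).length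
  arc_eq : σ.idx = σ.lo → σ.arc = 0
  seen : ∀ i < σ.idx, ∀ u e, (u, e) ∈ adj (σ.Q i) → Res U σ.fl σ.dead (σ.Q i) u e →
    ∃ j < σ.len, σ.Q j = u
  seen_idx : ∀ j < σ.arc, ∀ u e, ArcAt adj (σ.Q σ.idx) j u e →
    Res U σ.fl σ.dead (σ.Q σ.idx) u e → ∃ j < σ.len, σ.Q j = u
  vS_eq : σ.vS = ∑ i ∈ Finset.range σ.lo, (adj (σ.Q i)).length
  vQ_eq : σ.vQ = ∑ i ∈ Finset.range σ.len, (adj (σ.Q i)).length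
  layer : ∃ r : ℕ, (∀ i < σ.lo, H ≤ σ.lev (σ.Q i) + r) ∧ (∀ i < σ.len, H ≤ σ.lev (σ.Q i) + r + 1) ∧
    (1 + 1 / (8 * U) : ℝ) ^ r ≤ σ.vS
  mass_le : 4 * mass n σ + ∑ i ∈ Finset.range σ.idx, (adj (σ.Q i)).length ≤
    8 * U * c + prVol adj n σ.pr

/-- The invariants of the removal of the edges at the vertices of a cut. -/
structure Killing (adj : ℕ → List (ℕ × ℕ)) (n U c : ℕ) (σ : Conf) : Prop where
  idx_le : σ.idx ≤ σ.lo
  arc_le : σ.idx < σ.lo → σ.arc ≤ (adj (σ.Q σ.idx)).length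
  arc_eq : σ.idx = σ.lo → σ.arc = 0
  pr_ne : ∀ i < σ.lo, σ.pr (σ.Q i) ≠ 0
  closed : ∀ v, σ.pr v ≠ 0 → ∀ j u e, ArcAt adj v j u e → σ.dead e ≠ 0 ∨
    ∃ i, σ.idx ≤ i ∧ i < σ.lo ∧ σ.Q i = v ∧ (i = σ.idx → σ.arc ≤ j)
  mass_le : 4 * (mass n σ + debt adj n U σ.pr σ.fl σ.dead) ≤ 8 * U * c + prVol adj n σ.pr

/-- The invariants of the pruning algorithm during the `c`-th request. -/
structure Invariant (adj : ℕ → List (ℕ × ℕ)) (n U H c : ℕ) (σ : Conf) : Prop where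
  core : Core adj U H σ
  mode_le : σ.mode ≤ 3
  closed : σ.mode ≤ 1 → Closed adj σ
  mass_le : σ.mode ≤ 1 → 4 * mass n σ ≤ 8 * U * c + prVol adj n σ.pr
  walking : σ.mode = 1 → σ.pr σ.tok = 0 ∧ 0 < (adj σ.tok).length
  searching : σ.mode = 2 → Searching adj n U H c σ
  killing : σ.mode = 3 → Killing adj n U c σ

/-! ### Arcs, slots and sums in which one term changes. -/

section Lemmas

variable {adj : ℕ → List (ℕ × ℕ)} {n m U H c : ℕ} {σ σ' : Conf}

theorem ArcAt.mem {v j u e : ℕ} (h : ArcAt adj v j u e) : (u, e) ∈ adj v := by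
  obtain ⟨hj, rfl, rfl⟩ := h
  rw [List.getD_eq_getElem _ _ hj]
  exact List.getElem_mem hj

theorem exists_arcAt {v u e : ℕ} (h : (u, e) ∈ adj v) : ∃ j, ArcAt adj v j u e := by
  obtain ⟨j, hj, h⟩ := List.getElem_of_mem h
  refine ⟨j, hj, ?_⟩
  rw [List.getD_eq_getElem _ _ hj, h]
  exact ⟨rfl, rfl⟩

theorem ArcAt.length_pos {v j u e : ℕ} (h : ArcAt adj v j u e) : 0 < (adj v).length :=
  (Nat.zero_le _).trans_lt h.1

theorem IsSymmAdj.length_pos_of_mem (hA : IsSymmAdj adj n m) {v u e : ℕ} (h : (u, e) ∈ adj v) :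
    0 < (adj u).length := List.length_pos_of_mem (hA.symm h)

theorem IsSymmAdj.lt_of_length_pos (hA : IsSymmAdj adj n m) {v : ℕ} (h : 0 < (adj v).length) :
    v < n := by
  obtain ⟨a, ha⟩ := List.exists_mem_of_length_pos h
  exact hA.vert_lt (u := a.1) (e := a.2) ha

theorem IsSymmAdj.card_eq (hA : IsSymmAdj adj n m) (v : ℕ) :
    (adj v).toFinset.card = (adj v).length := List.toFinset_card_of_nodup (hA.nodup v)

theorem sum_change {ι : Type*} [DecidableEq ι] {s : Finset ι} {f f' : ι → ℤ} {a : ι} (ha : a ∈ s)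
    (h : ∀ b ∈ s, b ≠ a → f' b = f b) : ∑ b ∈ s, f' b = ∑ b ∈ s, f b + (f' a - f a) := by
  rw [← Finset.add_sum_erase _ _ ha, ← Finset.add_sum_erase _ f ha,
    Finset.sum_congr rfl fun b hb => h b (Finset.mem_of_mem_erase hb) (Finset.ne_of_mem_erase hb)]
  ring

theorem sum_change_nat {ι : Type*} [DecidableEq ι] {s : Finset ι} {f f' : ι → ℕ} {a : ι} (ha : a ∈ s)
    (h : ∀ b ∈ s, b ≠ a → f' b = f b) : ∑ b ∈ s, f' b + f a = ∑ b ∈ s, f b + f' a := by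
  rw [← Finset.add_sum_erase _ _ ha, ← Finset.add_sum_erase _ f ha,
    Finset.sum_congr rfl fun b hb => h b (Finset.mem_of_mem_erase hb) (Finset.ne_of_mem_erase hb)]
  ring

theorem slot_ne {v u e v' u' e' : ℕ} (h : e ≠ e') : slot v u e ≠ slot v' u' e' := by
  unfold slot; split_ifs <;> omega

/-- For a self-loop the two directions share one slot, so its net flow is always zero; this is
harmless, as no unit ever moves along a loop. -/
theorem slot_swap_ne {v u e : ℕ} (h : v ≠ u) : slot v u e ≠ slot u v e := by
  unfold slot; split_ifs <;> omega

theorem inflow_le (hfl : ∀ i, σ.fl i ≤ U) (v : ℕ) (a : ℕ × ℕ) : inflow U σ.fl σ.dead v a ≤ U := by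
  have := hfl (slot a.1 v a.2)
  unfold inflow; split <;> omega

theorem neg_le_inflow (hfl : ∀ i, σ.fl i ≤ U) (v : ℕ) (a : ℕ × ℕ) :
    -U ≤ inflow U σ.fl σ.dead v a := by
  have := hfl (slot v a.1 a.2)
  unfold inflow; split <;> omega

theorem pend_succ (sp : ℕ) (sv sc : ℕ → ℕ) (v : ℕ) :
    pend (sp + 1) sv sc v = pend sp sv sc v + if sv sp = v then sc sp else 0 :=
  Finset.sum_range_succ _ _

theorem pend_congr {sp : ℕ} {sv sc sv' sc' : ℕ → ℕ} (h : ∀ i < sp, sv' i = sv i ∧ sc' i = sc i)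
    (v : ℕ) : pend sp sv' sc' v = pend sp sv sc v :=
  Finset.sum_congr rfl fun i hi => by
    rw [(h i (Finset.mem_range.1 hi)).1, (h i (Finset.mem_range.1 hi)).2]

end Lemmas

/-! ### Preservation of the flow and level invariants. -/

section Core

variable {adj : ℕ → List (ℕ × ℕ)} {n m U H c : ℕ} {σ σ' : Conf}

/-- The invariants are kept when a unit moves along an arc to the next level. -/
theorem Core.move (hA : IsSymmAdj adj n m) (hσ : Core adj U H σ) (hm : σ.mode = 1) {u e : ℕ}
    (ha : (u, e) ∈ adj σ.tok) (hl : σ.lev u + 1 = σ.lev σ.tok) (hd : σ.dead e = 0) {fl' : ℕ → ℕ}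
    (hU : ∀ i, fl' i ≤ U) (hne : ∀ v w e', e' ≠ e → fl' (slot v w e') = σ.fl (slot v w e'))
    (hflow : (fl' (slot σ.tok u e) : ℤ) - fl' (slot u σ.tok e) =
      σ.fl (slot σ.tok u e) - σ.fl (slot u σ.tok e) + 1)
    (hres : Res U fl' σ.dead σ.tok u e → Res U σ.fl σ.dead σ.tok u e) :
    Core adj U H { σ with fl := fl', tok := u } := by
  -- An admissible arc descends a level, so it is not a loop.
  have hut : u ≠ σ.tok := by rintro rfl; omega
  -- Only the reversed arc can become residual, and it goes up one level, so it violates neither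
  -- `valid` nor `scanned`.
  have hR : ∀ v w e', (w, e') ∈ adj v → Res U fl' σ.dead v w e' →
      Res U σ.fl σ.dead v w e' ∨ v = u ∧ w = σ.tok := by
    intro v w e' hv hr
    by_cases he : e' = e
    · subst he
      rcases hA.ends ha hv with ⟨rfl, rfl⟩ | ⟨rfl, rfl⟩
      · exact .inl (hres hr)
      · exact .inr ⟨rfl, rfl⟩
    · left
      simpa only [Res, hne _ _ _ he] using hr
  refine { hσ with fl_le := hU, valid := ?_, scanned := ?_, balance := ?_ }
  · intro v w e' hv hr
    rcases hR v w e' hv hr with h | ⟨rfl, rfl⟩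
    · exact hσ.valid v w e' hv h
    · show σ.lev v ≤ σ.lev σ.tok + 1
      omega
  · intro v j w e' hj hv hr
    rcases hR v w e' hv.mem hr with h | ⟨rfl, rfl⟩
    · exact hσ.scanned v j w e' hj hv h
    · show σ.lev v ≤ σ.lev σ.tok
      omega
  · intro v hv
    have hb := hσ.balance v hv
    simp only [hm, true_or, true_and] at hb ⊢
    have hother : ∀ b : ℕ × ℕ, b.2 ≠ e → inflow U fl' σ.dead v b = inflow U σ.fl σ.dead v b := by
      intro b hb
      simp only [inflow, hne _ _ _ hb]
    by_cases hvt : v = σ.tok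
    · subst hvt
      rw [sum_change (f := inflow U σ.fl σ.dead σ.tok) (List.mem_toFinset.2 ha)]
      · simp only [if_neg hut, inflow, hd, if_true] at hb ⊢
        linarith
      · intro b hb hbe
        refine hother b fun h => hbe ?_
        subst h
        rcases hA.ends ha (List.mem_toFinset.1 hb) with ⟨-, h⟩ | ⟨h, -⟩
        · exact Prod.ext h rfl
        · exact absurd h.symm hut
    · by_cases hvu : v = u
      · subst hvu
        rw [sum_change (f := inflow U σ.fl σ.dead v) (List.mem_toFinset.2 (hA.symm ha))]
        · simp only [if_neg (Ne.symm hut), inflow, hd, if_true] at hb ⊢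
          linarith
        · intro b hb hbe
          refine hother b fun h => hbe ?_
          subst h
          rcases hA.ends ha (List.mem_toFinset.1 hb) with ⟨h, -⟩ | ⟨-, h⟩
          · exact absurd h hut
          · exact Prod.ext h rfl
      · rw [Finset.sum_congr rfl (g := inflow U σ.fl σ.dead v)]
        · rw [if_neg (Ne.symm hvt)] at hb
          rw [if_neg (Ne.symm hvu)]
          exact hb
        · intro b hb
          refine hother b ?_
          rintro rfl
          rcases hA.ends ha (List.mem_toFinset.1 hb) with ⟨h, -⟩ | ⟨h, -⟩
          · exact hvt h
          · exact hvu h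

/-- The death of an edge creates no residual arc, hence all conditions on levels survive it. -/
theorem res_of_kill {fl dead : ℕ → ℕ} {e v w e' : ℕ}
    (h : Res U fl (Function.update dead e 1) v w e') : Res U fl dead v w e' := by
  refine ⟨?_, h.2⟩
  have := h.1
  rcases eq_or_ne e' e with rfl | he
  · simp at this
  · rwa [Function.update_of_ne he] at this

/-- The net flow into `v` when the edge `e` dies. -/
theorem sum_inflow_kill_of_notMem {fl dead : ℕ → ℕ} {v e : ℕ} (h : ∀ w, (w, e) ∉ adj v) :
    ∑ a ∈ (adj v).toFinset, inflow U fl (Function.update dead e 1) v a =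
      ∑ a ∈ (adj v).toFinset, inflow U fl dead v a := by
  refine Finset.sum_congr rfl fun a ha => ?_
  have : a.2 ≠ e := by
    rintro rfl
    exact h a.1 (List.mem_toFinset.1 ha)
  simp only [inflow, Function.update_of_ne this]

/-- The edge occurs in only one entry of the list (a loop is listed once), and the inflow of this
entry is raised to U. -/
theorem sum_inflow_kill (hA : IsSymmAdj adj n m) {fl dead : ℕ → ℕ} {v u e : ℕ} (h : (u, e) ∈ adj v) :
    ∑ a ∈ (adj v).toFinset, inflow U fl (Function.update dead e 1) v a =
      ∑ a ∈ (adj v).toFinset, inflow U fl dead v a + (U - inflow U fl dead v (u, e)) := by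
  rw [sum_change (f := inflow U fl dead v) (List.mem_toFinset.2 h)]
  · simp [inflow]
  · intro b hb hbe
    have : b.2 ≠ e := by
      rintro rfl
      refine hbe ?_
      rcases hA.ends h (List.mem_toFinset.1 hb) with ⟨-, h⟩ | ⟨h, h'⟩
      · exact Prod.ext h rfl
      · exact Prod.ext (h'.trans h) rfl
    simp only [inflow, Function.update_of_ne this]

/-- The number of units sent to `u` when the edge `e` to `v` dies. -/
theorem refund_eq (hfl : ∀ i, σ.fl i ≤ U) {v u e : ℕ} :
    ((U + σ.fl (slot u v e) - σ.fl (slot v u e) : ℕ) : ℤ) =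
      U + σ.fl (slot u v e) - σ.fl (slot v u e) := by
  have := hfl (slot v u e)
  rw [Nat.cast_sub (by omega)]
  push_cast
  ring

/-- The balance is an inequality and concerns unpruned vertices only; this is what allows units at
pruned vertices to be discarded. The levels obey the usual push-relabel rules. -/
theorem Core.step (hA : IsSymmAdj adj n m) (hH : ∀ r : ℕ, (1 + 1 / (8 * U) : ℝ) ^ r ≤
    (2 * m : ℕ) → r < H) (hvS : σ.mode = 2 → σ.vS ≤ 2 * m) (hσ : Invariant adj n U H c σ)
    (hs : Step adj U H σ σ') : Core adj U H σ' := by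
  have hc := hσ.core
  cases hs with
  | pop hm hsp h =>
    obtain ⟨k, hk⟩ : ∃ k, σ.sp = k + 1 := ⟨σ.sp - 1, by omega⟩
    simp only [hk, Nat.add_sub_cancel] at h ⊢
    refine { hc with stack := fun i hi => hc.stack i (by simp only at hi; omega), balance := ?_ }
    intro v hv
    have := hc.balance v hv
    rw [hk, pend_succ] at this
    simp only at hv ⊢
    rcases h with h | h
    · simpa [h] using this
    -- The dropped entry belongs to a pruned vertex, for which no balance is claimed.
    · have hne : σ.sv k ≠ v := by rintro rfl; exact h hv
      simpa [hne] using this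
  | take hm hsp h h' =>
    obtain ⟨k, hk⟩ : ∃ k, σ.sp = k + 1 := ⟨σ.sp - 1, by omega⟩
    simp only [hk, Nat.add_sub_cancel] at h h' ⊢
    refine { hc with stack := fun i hi => hc.stack i (by rw [hk]; exact hi), balance := ?_ }
    intro v hv
    have := hc.balance v hv
    rw [hk, pend_succ] at this
    simp only [hm] at this ⊢
    rw [pend_succ, pend_congr (sv := σ.sv) (sc := σ.sc) fun i hi =>
      ⟨rfl, Function.update_of_ne (by omega) _ _⟩, Function.update_self]
    simp only [true_or, true_and] at this ⊢
    have hz : (0 = 1 ∨ 0 = 2) = False := by simp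
    simp only [hz, false_and, if_false] at this
    split_ifs at this ⊢ with hv'
    · push_cast [Nat.one_le_iff_ne_zero.2 h] at this ⊢
      linarith
    · push_cast at this ⊢
      linarith
  | absorb hm h =>
    refine { hc with ab_le := ?_, full := ?_, pr_full := ?_, balance := ?_ }
    · intro v
      rcases eq_or_ne v σ.tok with rfl | hv
      · simpa using h
      · simpa [hv] using hc.ab_le v
    · intro v hv
      have := hc.full v hv
      -- A saturated vertex is not the one that has just absorbed a unit.
      have hne : v ≠ σ.tok := by rintro rfl; omega
      simpa [hne] using this
    · intro v hv
      have := hc.pr_full v hv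
      have hne : v ≠ σ.tok := by rintro rfl; omega
      simpa [hne] using this
    · intro v hv
      have := hc.balance v hv
      simp only [hm, true_or, true_and] at this
      have hz : (0 = 1 ∨ 0 = 2) = False := by simp
      simp only [hz, false_and, if_false]
      rcases eq_or_ne v σ.tok with rfl | hv
      · simp only [if_true, Function.update_self] at this ⊢
        push_cast at this ⊢
        linarith
      · simpa [hv, hv.symm] using this
  | @cancel u e hm h ha hl hd hf =>
    have hut : u ≠ σ.tok := by rintro rfl; omega
    refine hc.move hA hm ha.mem hl hd ?_ ?_ ?_ ?_
    · intro i
      have := hc.fl_le i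
      rcases eq_or_ne i (slot u σ.tok e) with rfl | hi
      · simp only [Function.update_self]; omega
      · simpa [hi] using this
    · intro v w e' he
      rw [Function.update_of_ne (slot_ne he)]
    · rw [Function.update_self, Function.update_of_ne (slot_swap_ne hut.symm)]
      push_cast [hf]
      ring
    · exact fun _ => ⟨hd, .inl hf⟩
  | @forward u e hm h ha hl hd hf hf' =>
    have hut : u ≠ σ.tok := by rintro rfl; omega
    refine hc.move hA hm ha.mem hl hd ?_ ?_ ?_ ?_
    · intro i
      have := hc.fl_le i
      rcases eq_or_ne i (slot σ.tok u e) with rfl | hi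
      · simp only [Function.update_self]; omega
      · simpa [hi] using this
    · intro v w e' he
      rw [Function.update_of_ne (slot_ne he)]
    · rw [Function.update_self, Function.update_of_ne (slot_swap_ne hut)]
      push_cast
      ring
    · exact fun _ => ⟨hd, .inr hf'⟩
  | @advance u e hm h ha hn =>
    have hfull : σ.ab σ.tok = (adj σ.tok).length := le_antisymm (hc.ab_le _) h
    refine { hc with cur_le := ?_, full := ?_, scanned := ?_ }
    · intro v
      rcases eq_or_ne v σ.tok with rfl | hv
      · simpa using ha.1
      · simpa [hv] using hc.cur_le v
    · intro v hv
      rcases eq_or_ne v σ.tok with rfl | hv'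
      · exact ⟨hfull, ha.length_pos⟩
      · simp only [Function.update_of_ne hv'] at hv
        exact hc.full v hv
    · intro v j w e' hj hv hr
      rcases eq_or_ne v σ.tok with rfl | hv'
      · simp only [Function.update_self] at hj
        rcases (Nat.lt_succ_iff_lt_or_eq.1 hj) with hj | rfl
        · exact hc.scanned _ j w e' hj hv hr
        · obtain ⟨-, rfl, rfl⟩ := ha
          obtain ⟨hlt, rfl, rfl⟩ := hv
          -- The arc is residual but not admissible, so equality in `valid` is excluded and the arc
          -- counts as scanned.
          have h1 := hc.valid _ _ _ (ArcAt.mem ⟨hlt, rfl, rfl⟩) hr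
          simp only [hr, and_true] at hn
          simp only at h1 ⊢
          omega
      · simp only [Function.update_of_ne hv'] at hj
        exact hc.scanned v j w e' hj hv hr
  | relabel hm h hcur hl =>
    have hfull : σ.ab σ.tok = (adj σ.tok).length := le_antisymm (hc.ab_le _) h
    have hmono : ∀ w, σ.lev w ≤ Function.update σ.lev σ.tok (σ.lev σ.tok + 1) w := by
      intro w
      rcases eq_or_ne w σ.tok with rfl | hw
      · simp
      · simp [hw]
    refine { hc with lev_le := ?_, cur_le := ?_, full := ?_, valid := ?_, scanned := ?_ }
    · intro v
      rcases eq_or_ne v σ.tok with rfl | hv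
      · simpa using hl
      · simpa [hv] using hc.lev_le v
    · intro v
      rcases eq_or_ne v σ.tok with rfl | hv
      · simp
      · simpa [hv] using hc.cur_le v
    · intro v hv
      rcases eq_or_ne v σ.tok with rfl | hv'
      · exact ⟨hfull, (hσ.walking hm).2⟩
      · simp only [Function.update_of_ne hv'] at hv
        exact hc.full v hv
    · intro v w e' hv hr
      have := hmono w
      rcases eq_or_ne v σ.tok with rfl | hv'
      · obtain ⟨j, hj⟩ := exists_arcAt hv
        -- All arcs have been scanned, so raising the level by one keeps `valid`.
        have := hc.scanned _ j w e' (hj.1.trans_le hcur) hj hr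
        simp only [Function.update_self] at this ⊢
        omega
      · have := hc.valid v w e' hv hr
        simp only [Function.update_of_ne hv'] at this ⊢
        omega
    · intro v j w e' hj hv hr
      have := hmono w
      rcases eq_or_ne v σ.tok with rfl | hv'
      · simp at hj
      · simp only [Function.update_of_ne hv'] at hj ⊢
        exact (hc.scanned v j w e' hj hv hr).trans this
  | search hm h hcur hl =>
    refine { hc with balance := ?_ }
    intro v hv
    have := hc.balance v hv
    simpa [hm] using this
  | enqueue => exact { hc with }
  | pass => exact { hc with }
  | finish hm hi ha =>
    have hS := hσ.searching hm
    have hlen := hi.trans_le hS.lo_le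
    obtain ⟨r, hr, -, hr'⟩ := hS.layer
    -- The layers are too few to reach level 0. The scanned vertex has positive level, hence is
    -- saturated, and it may be pruned.
    have hrH : r < H := hH r (hr'.trans (by exact_mod_cast hvS hm))
    have hlev := hr _ hi
    refine { hc with pr_full := ?_, balance := ?_ }
    · intro v hv
      rcases eq_or_ne v (σ.Q σ.idx) with rfl | hv'
      · exact hc.full _ (.inl (by omega))
      · simp only [Function.update_of_ne hv'] at hv
        exact hc.pr_full v hv
    · intro v hv
      have hv' : v ≠ σ.Q σ.idx := by
        rintro rfl
        simp at hv
      simp only [Function.update_of_ne hv'] at hv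
      exact hc.balance v hv
  | extend => exact { hc with }
  | cut hm hi h =>
    have hS := hσ.searching hm
    refine { hc with balance := ?_ }
    intro v hv
    have := hc.balance v hv
    -- The stuck unit sits at the head of the queue, which is pruned by now, so it can be dropped
    -- from the balance.
    have hne : σ.tok ≠ v := by
      rintro rfl
      have := (hS.pr_iff 0 (hS.lo_pos.trans_le hS.lo_le)).1 (by rwa [hS.head])
      have := hS.lo_pos
      omega
    simpa [hm, hne] using this
  | @kill_send u e hm hi ha hd hu =>
    have hK := hσ.killing hm
    have hpr := hK.pr_ne _ hi
    refine { hc with valid := ?_, scanned := ?_, stack := ?_, balance := ?_ }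
    · exact fun v w e' hv hr => hc.valid v w e' hv (res_of_kill hr)
    · exact fun v j w e' hj hv hr => hc.scanned v j w e' hj hv (res_of_kill hr)
    · intro i hi
      rcases eq_or_ne i σ.sp with rfl | hi'
      · simpa using List.length_pos_of_mem (hA.symm ha.mem)
      · simpa [hi'] using hc.stack i (by simp only at hi; omega)
    · intro v hv
      have := hc.balance v hv
      simp only at hv
      simp only [hm] at this ⊢
      rw [pend_succ, pend_congr (sv := σ.sv) (sc := σ.sc) fun i hi =>
        ⟨Function.update_of_ne (by omega) _ _, Function.update_of_ne (by omega) _ _⟩,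
        Function.update_self, Function.update_self]
      rcases eq_or_ne v u with rfl | hvu
      · rw [sum_inflow_kill hA (hA.symm ha.mem), if_pos rfl]
        have hin : inflow U σ.fl σ.dead v (σ.Q σ.idx, e) =
            σ.fl (slot (σ.Q σ.idx) v e) - σ.fl (slot v (σ.Q σ.idx) e) := by simp [inflow, hd]
        rw [hin]
        have hz : ((3 = 1 ∨ 3 = 2) ∧ σ.tok = v) = False := by simp
        simp only [hz, if_false] at this ⊢
        push_cast [refund_eq hc.fl_le]
        linarith
      · rw [sum_inflow_kill_of_notMem, if_neg hvu.symm]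
        · simpa using this
        · intro w hw
          rcases hA.ends ha.mem hw with ⟨h, -⟩ | ⟨h, -⟩
          · rw [h] at hv; exact hpr hv
          · exact hvu h
  | @kill_inner u e hm hi ha hd hu =>
    have hK := hσ.killing hm
    have hpr := hK.pr_ne _ hi
    refine { hc with valid := ?_, scanned := ?_, balance := ?_ }
    · exact fun v w e' hv hr => hc.valid v w e' hv (res_of_kill hr)
    · exact fun v j w e' hj hv hr => hc.scanned v j w e' hj hv (res_of_kill hr)
    · intro v hv
      have := hc.balance v hv
      simp only at hv ⊢
      rw [sum_inflow_kill_of_notMem]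
      · exact this
      · intro w hw
        rcases hA.ends ha.mem hw with ⟨h, -⟩ | ⟨h, -⟩
        · rw [h] at hv; exact hpr hv
        · rw [h] at hv; exact hu hv
  | kill_pass => exact { hc with }
  | kill_next => exact { hc with }
  | kill_done hm hi =>
    refine { hc with balance := ?_ }
    intro v hv
    have := hc.balance v hv
    simpa [hm] using this

end Core

/-! ### The search for a sparse residual cut, and the debt it creates. -/

section Modes

variable {adj : ℕ → List (ℕ × ℕ)} {n m U H c : ℕ} {σ σ' : Conf}

theorem IsSymmAdj.sum_image_le (hA : IsSymmAdj adj n m) {Q : ℕ → ℕ} {s : Finset ℕ}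
    (hQ : Set.InjOn Q s) : ∑ i ∈ s, (adj (Q i)).length ≤ 2 * m := by
  rw [← Finset.sum_image (f := fun v => (adj v).length) hQ]
  refine le_trans ?_ hA.sum_le
  refine Finset.sum_le_sum_of_ne_zero fun v _ hv => ?_
  exact Finset.mem_range.2 (hA.lt_of_length_pos (Nat.pos_of_ne_zero hv))

theorem IsSymmAdj.length_le (hA : IsSymmAdj adj n m) (v : ℕ) : (adj v).length ≤ 2 * m := by
  have := hA.sum_image_le (Q := id) (s := {v}) (Set.injOn_id _)
  simpa using this

/-- On the queue, `pos` is a left inverse of `Q`. -/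
theorem Searching.inj (hS : Searching adj n U H c σ) {i j : ℕ} (hi : i < σ.len) (hj : j < σ.len)
    (h : σ.Q i = σ.Q j) : i = j := by
  rw [← hS.pos_eq i hi, ← hS.pos_eq j hj, h]

theorem Searching.vQ_le (hA : IsSymmAdj adj n m) (hS : Searching adj n U H c σ) : σ.vQ ≤ 2 * m := by
  rw [hS.vQ_eq]
  refine hA.sum_image_le fun i hi j hj h => hS.inj ?_ ?_ h
  · simpa using hi
  · simpa using hj

theorem Searching.len_le (hS : Searching adj n U H c σ) : σ.len ≤ σ.vQ := by
  rw [hS.vQ_eq]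
  calc σ.len = ∑ i ∈ Finset.range σ.len, 1 := by simp
    _ ≤ _ := Finset.sum_le_sum fun i hi => hS.deg_pos i (Finset.mem_range.1 hi)

theorem Searching.vS_le (hS : Searching adj n U H c σ) : σ.vS ≤ σ.vQ := by
  rw [hS.vQ_eq, hS.vS_eq]
  exact Finset.sum_le_sum_of_subset (Finset.range_subset_range.2 hS.lo_le)

theorem Searching.lo_le_vS (hS : Searching adj n U H c σ) : σ.lo ≤ σ.vS := by
  rw [hS.vS_eq]
  calc σ.lo = ∑ i ∈ Finset.range σ.lo, 1 := by simp
    _ ≤ _ := Finset.sum_le_sum fun i hi =>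
      hS.deg_pos i ((Finset.mem_range.1 hi).trans_le hS.lo_le)

theorem prVol_update (hA : IsSymmAdj adj n m) {pr : ℕ → ℕ} {v : ℕ} (hv : pr v = 0) :
    prVol adj n (Function.update pr v 1) = prVol adj n pr + (adj v).length := by
  by_cases hn : v < n
  · have := sum_change_nat (s := Finset.range n) (f := fun v => if pr v = 0 then 0 else (adj v).length)
      (f' := fun w => if Function.update pr v 1 w = 0 then 0 else (adj w).length)
      (Finset.mem_range.2 hn) (fun b _ hb => by simp [hb])
    simp only [Function.update_self, hv, if_true, one_ne_zero, if_false, add_zero] at this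
    exact this
  · have h0 : (adj v).length = 0 := by
      by_contra h
      exact hn (hA.lt_of_length_pos (Nat.pos_of_ne_zero h))
    rw [h0, add_zero]
    refine Finset.sum_congr rfl fun w hw => ?_
    have : w ≠ v := by
      rintro rfl
      exact hn (Finset.mem_range.1 hw)
    simp [this]

theorem debt_nonneg (hfl : ∀ i, σ.fl i ≤ U) : 0 ≤ debt adj n U σ.pr σ.fl σ.dead := by
  refine Finset.sum_nonneg fun v _ => ?_
  split_ifs
  · refine Finset.sum_nonneg fun a _ => ?_
    split_ifs
    · have := inflow_le hfl v a
      linarith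
    · rfl
  · rfl

/-- Few units are needed when the residual graph of the searched part has a sparse cut. -/
theorem Searching.debt_le (hA : IsSymmAdj adj n m) (hfl : ∀ i, σ.fl i ≤ U)
    (hS : Searching adj n U H c σ) (hi : σ.lo ≤ σ.idx) :
    debt adj n U σ.pr σ.fl σ.dead ≤ 2 * U * (σ.vQ - σ.vS) := by
  have hidx : σ.idx = σ.lo := le_antisymm hS.idx_le hi
  have hinj : Set.InjOn σ.Q (Finset.Ico σ.lo σ.len) := fun i hi j hj h =>
    hS.inj (by simp at hi; omega) (by simp at hj; omega) h
  -- The last layer: found, but not scanned. Only its vertices can need new units.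
  set T := (Finset.Ico σ.lo σ.len).image σ.Q with hT
  have hsum : (σ.vQ : ℤ) - σ.vS = ∑ v ∈ T, ((adj v).length : ℤ) := by
    rw [hT, Finset.sum_image hinj, hS.vQ_eq, hS.vS_eq, ← Finset.sum_range_add_sum_Ico _ hS.lo_le]
    push_cast
    ring
  have hterm : ∀ v ∈ Finset.range n, (if σ.pr v = 0 then
      ∑ a ∈ (adj v).toFinset, if σ.pr a.1 ≠ 0 ∧ σ.dead a.2 = 0 then
        U - inflow U σ.fl σ.dead v a else 0 else 0) ≤
      if v ∈ T then 2 * U * ((adj v).length : ℤ) else 0 := by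
    intro v _
    by_cases hv : σ.pr v = 0
    · rw [if_pos hv]
      split_ifs with hvT
      · rw [← hA.card_eq v, mul_comm, ← nsmul_eq_mul]
        refine Finset.sum_le_card_nsmul _ _ _ fun a _ => ?_
        -- The inflow is between -U and U, so an arc costs at most 2U.
        have := neg_le_inflow hfl v a
        split_ifs
        · linarith
        · positivity
      · refine (Finset.sum_eq_zero fun a ha => ?_).le
        split_ifs with h
        · have ha' : (a.1, a.2) ∈ adj v := List.mem_toFinset.1 ha
          rcases hS.closed a.1 h.1 with hd | ⟨i, hi', hQ⟩
          · exact absurd h.2 (hd _ _ (hA.symm ha'))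
          -- A residual arc out of the scanned part would have put its head into the queue. A live
          -- arc that is not residual carries U units, with nothing flowing back, and costs nothing.
          · by_cases hr : Res U σ.fl σ.dead (σ.Q i) v a.2
            · obtain ⟨j, hj, rfl⟩ := hS.seen i hi' v a.2 (by rw [hQ]; exact hA.symm ha') hr
              refine absurd (Finset.mem_image_of_mem _ ?_) hvT
              have := (hS.pr_iff j hj).1 hv
              exact Finset.mem_Ico.2 ⟨by omega, hj⟩
            · have := hfl (slot a.1 v a.2)
              rw [hQ] at hr
              simp only [Res, h.2, true_and, not_or] at hr
              simp only [inflow, h.2, if_true]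
              omega
        · rfl
    · rw [if_neg hv]
      split_ifs <;> positivity
  calc debt adj n U σ.pr σ.fl σ.dead
      ≤ ∑ v ∈ Finset.range n, if v ∈ T then 2 * U * ((adj v).length : ℤ) else 0 :=
        Finset.sum_le_sum hterm
    _ = ∑ v ∈ (Finset.range n).filter (· ∈ T), 2 * U * ((adj v).length : ℤ) :=
        (Finset.sum_filter _ _).symm
    _ ≤ ∑ v ∈ T, 2 * U * ((adj v).length : ℤ) :=
        Finset.sum_le_sum_of_subset_of_nonneg (fun v hv => (Finset.mem_filter.1 hv).2)
          fun _ _ _ => by positivity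
    _ = 2 * U * (σ.vQ - σ.vS) := by rw [hsum, Finset.mul_sum]

/-- The debt falls by exactly the number of units pushed on the stack, so mass plus debt is constant
during the removal. Likewise the potential can price a unit of debt and a waiting unit equally. -/
theorem debt_kill_send (hA : IsSymmAdj adj n m) {pr fl dead : ℕ → ℕ} {v u e : ℕ}
    (ha : (u, e) ∈ adj v) (hv : pr v ≠ 0) (hu : pr u = 0) (hd : dead e = 0) :
    debt adj n U pr fl (Function.update dead e 1) =
      debt adj n U pr fl dead - (U - inflow U fl dead u (v, e)) := by
  have hun : u ∈ Finset.range n := Finset.mem_range.2 (hA.vert_lt (hA.symm ha))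
  unfold debt
  rw [sum_change (f := fun v => if pr v = 0 then ∑ a ∈ (adj v).toFinset,
    if pr a.1 ≠ 0 ∧ dead a.2 = 0 then U - inflow U fl dead v a else 0 else 0) hun]
  · simp only [hu, if_true]
    rw [sum_change (f := fun a => if pr a.1 ≠ 0 ∧ dead a.2 = 0 then (U : ℤ) - inflow U fl dead u a
      else 0) (List.mem_toFinset.2 (hA.symm ha))]
    · simp only [Function.update_self, one_ne_zero, and_false, if_false, hv, hd, ne_eq,
        not_false_eq_true, and_self, if_true]
      ring
    · intro b hb hbe
      have : b.2 ≠ e := by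
        rintro rfl
        rcases hA.ends ha (List.mem_toFinset.1 hb) with ⟨h, -⟩ | ⟨-, h⟩
        · rw [h] at hu; exact absurd hu hv
        · exact hbe (Prod.ext h rfl)
      simp only [inflow, Function.update_of_ne this]
  · intro w _ hw
    by_cases hpw : pr w = 0
    · simp only [hpw, if_true]
      refine Finset.sum_congr rfl fun b hb => ?_
      have : b.2 ≠ e := by
        rintro rfl
        rcases hA.ends ha (List.mem_toFinset.1 hb) with ⟨h, -⟩ | ⟨h, -⟩
        · rw [h] at hpw; exact hv hpw
        · exact hw h
      simp only [inflow, Function.update_of_ne this]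
    · simp only [hpw, if_false]

theorem debt_kill_inner (hA : IsSymmAdj adj n m) {pr fl dead : ℕ → ℕ} {v u e : ℕ}
    (ha : (u, e) ∈ adj v) (hv : pr v ≠ 0) (hu : pr u ≠ 0) :
    debt adj n U pr fl (Function.update dead e 1) = debt adj n U pr fl dead := by
  refine Finset.sum_congr rfl fun w _ => ?_
  by_cases hpw : pr w = 0
  · simp only [hpw, if_true]
    refine Finset.sum_congr rfl fun b hb => ?_
    have : b.2 ≠ e := by
      rintro rfl
      rcases hA.ends ha (List.mem_toFinset.1 hb) with ⟨h, -⟩ | ⟨h, -⟩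
      · rw [h] at hpw; exact hv hpw
      · rw [h] at hpw; exact hu hpw
    simp only [inflow, Function.update_of_ne this]
  · simp only [hpw, if_false]

/-- The new vertex extends the next layer; the current layer and its volume vS are untouched. -/
theorem Searching.enqueue (hA : IsSymmAdj adj n m) (hc : Core adj U H σ)
    (hS : Searching adj n U H c σ) {u e : ℕ} (hi : σ.idx < σ.lo) (ha : ArcAt adj (σ.Q σ.idx) σ.arc u e)
    (hr : Res U σ.fl σ.dead (σ.Q σ.idx) u e) (hq : ¬ (σ.pos u < σ.len ∧ σ.Q (σ.pos u) = u)) :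
    Searching adj n U H c
      { σ with
        Q := Function.update σ.Q σ.len u, pos := Function.update σ.pos u σ.len, len := σ.len + 1,
        vQ := σ.vQ + (adj u).length, arc := σ.arc + 1 } := by
  have hlen := hi.trans_le hS.lo_le
  have hQ : ∀ i < σ.len, Function.update σ.Q σ.len u i = σ.Q i := fun i hi =>
    Function.update_of_ne hi.ne _ _
  have hQu : ∀ i < σ.len, σ.Q i ≠ u := by
    rintro i hi rfl
    exact hq (by rw [hS.pos_eq i hi]; exact ⟨hi, rfl⟩)
  -- A pruned vertex with a live edge is one pruned during this search, and those are in the queue.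
  have hpu : σ.pr u = 0 := by
    by_contra hpu
    rcases hS.closed u hpu with h | ⟨i, hi', hQi⟩
    · exact h _ _ (hA.symm ha.mem) hr.1
    · exact hQu i (by omega) hQi
  have old : ∀ w, (∃ j < σ.len, σ.Q j = w) →
      ∃ j < σ.len + 1, Function.update σ.Q σ.len u j = w := by
    rintro w ⟨j, hj, rfl⟩
    exact ⟨j, by omega, hQ j hj⟩
  have hcases : ∀ P : ℕ → ℕ → Prop, (∀ i < σ.len, P i (σ.Q i)) → P σ.len u →
      ∀ i < σ.len + 1, P i (Function.update σ.Q σ.len u i) := by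
    intro P h1 h2 i hi
    rcases Nat.lt_succ_iff_lt_or_eq.1 hi with hi | rfl
    · rw [hQ i hi]; exact h1 i hi
    · rw [Function.update_self]; exact h2
  have hlo := hS.lo_pos
  have hlo' := hS.lo_le
  refine ⟨hS.idx_le, hS.lo_pos, by simp only; omega, ?_, ?_, ?_, ?_, ?_, ?_, ?_, ?_, ?_, ?_, ?_, ?_, ?_⟩
  · exact (hQ 0 (by omega)).trans hS.head
  · refine hcases (fun i v => Function.update σ.pos u σ.len v = i) (fun i hi => ?_) ?_
    · rw [Function.update_of_ne (hQu i hi), hS.pos_eq i hi]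
    · exact Function.update_self ..
  · exact hcases (fun i v => 0 < (adj v).length) hS.deg_pos (List.length_pos_of_mem (hA.symm ha.mem))
  · exact hcases (fun i v => σ.pr v = 0 ↔ σ.idx ≤ i) hS.pr_iff (by simp only [hpu, true_iff]; omega)
  · intro v hv
    refine (hS.closed v hv).imp id ?_
    rintro ⟨i, hi', h⟩
    exact ⟨i, hi', (hQ i (by omega)).trans h⟩
  · intro _
    simp only [hQ _ hlen]
    exact ha.1
  · intro h
    exact absurd h hi.ne
  · intro i hi' w e' hw hres
    simp only [hQ i (hi'.trans hlen)] at hw hres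
    exact old w (hS.seen i hi' w e' hw hres)
  · intro j hj w e' hw hres
    simp only [hQ _ hlen] at hw hres
    rcases Nat.lt_succ_iff_lt_or_eq.1 hj with hj | rfl
    · exact old w (hS.seen_idx j hj w e' hw hres)
    · obtain ⟨-, rfl, -⟩ := hw
      obtain ⟨-, rfl, -⟩ := ha
      exact ⟨σ.len, by simp only; omega, Function.update_self ..⟩
  · rw [hS.vS_eq]
    refine Finset.sum_congr rfl fun i hi' => ?_
    simp only [hQ i ((Finset.mem_range.1 hi').trans_le hS.lo_le)]
  · rw [hS.vQ_eq, Finset.sum_range_succ]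
    simp only [Function.update_self]
    congr 1
    refine Finset.sum_congr rfl fun i hi' => ?_
    simp only [hQ i (Finset.mem_range.1 hi')]
  · obtain ⟨r, h1, h2, h3⟩ := hS.layer
    refine ⟨r, fun i hi' => ?_, ?_, h3⟩
    · simp only [hQ i (lt_of_lt_of_le hi' hS.lo_le)]
      exact h1 i hi'
    · refine hcases (fun i v => H ≤ σ.lev v + r + 1) h2 ?_
      -- A residual arc descends at most one level, whence the next layer is at most one level
      -- lower.
      have := hc.valid _ _ _ ha.mem hr
      have := h1 _ hi
      omega
  · refine le_of_eq_of_le ?_ hS.mass_le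
    congr 1
    refine Finset.sum_congr rfl fun i hi' => ?_
    simp only [hQ i ((Finset.mem_range.1 hi').trans hlen)]

theorem Searching.finish (hA : IsSymmAdj adj n m) (hS : Searching adj n U H c σ)
    (hi : σ.idx < σ.lo) (ha : (adj (σ.Q σ.idx)).length ≤ σ.arc) :
    Searching adj n U H c
      { σ with pr := Function.update σ.pr (σ.Q σ.idx) 1, idx := σ.idx + 1, arc := 0 } := by
  have hlen := hi.trans_le hS.lo_le
  have hpr : σ.pr (σ.Q σ.idx) = 0 := (hS.pr_iff _ hlen).2 le_rfl
  refine { hS with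
    idx_le := hi, pr_iff := ?_, closed := ?_, arc_le := ?_, arc_eq := ?_, seen := ?_,
    seen_idx := ?_, mass_le := ?_ }
  · intro i hi'
    rcases eq_or_ne i σ.idx with rfl | hne
    · simp
    · have : σ.Q i ≠ σ.Q σ.idx := fun h => hne (hS.inj hi' hlen h)
      have h2 := hS.pr_iff i hi'
      simp only [Function.update_of_ne this]
      omega
  · intro v hv
    rcases eq_or_ne v (σ.Q σ.idx) with rfl | hv'
    · exact .inr ⟨σ.idx, by simp, rfl⟩
    · simp only [Function.update_of_ne hv'] at hv
      refine (hS.closed v hv).imp id ?_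
      rintro ⟨i, hi', h⟩
      exact ⟨i, by simp only; omega, h⟩
  · exact fun _ => Nat.zero_le _
  · exact fun _ => rfl
  · intro i hi' u e hu hr
    rcases Nat.lt_succ_iff_lt_or_eq.1 hi' with hi' | rfl
    · exact hS.seen i hi' u e hu hr
    · obtain ⟨j, hj⟩ := exists_arcAt hu
      exact hS.seen_idx j (hj.1.trans_le ha) u e hj hr
  · intro j hj
    exact absurd hj (Nat.not_lt_zero j)
  -- Both sides grow by the degree of the vertex: the sum over the finished vertices is held in
  -- reserve until the cut, where it covers the debt.
  · have := hS.mass_le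
    simp only [mass, Finset.sum_range_succ, prVol_update hA hpr] at this ⊢
    omega

/-- The failed cut test says that the volume grew by more than the factor 1 + 1/(8U), which raises
the exponent r of the lower bound by one. -/
theorem Searching.extend (hU : 0 < U) (hS : Searching adj n U H c σ) (hi : σ.lo ≤ σ.idx)
    (h : σ.vS * (8 * U + 1) < 8 * U * σ.vQ) :
    Searching adj n U H c { σ with lo := σ.len, vS := σ.vQ } := by
  have hidx : σ.idx = σ.lo := le_antisymm hS.idx_le hi
  have hlo := hS.lo_le
  refine { hS with
    idx_le := hidx.le.trans hlo, lo_pos := hS.lo_pos.trans_le hlo, lo_le := le_rfl,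
    arc_le := ?_, arc_eq := ?_, vS_eq := hS.vQ_eq, layer := ?_ }
  · intro _
    simp [hS.arc_eq hidx]
  · exact fun _ => hS.arc_eq hidx
  · obtain ⟨r, h1, h2, h3⟩ := hS.layer
    refine ⟨r + 1, fun i hi' => ?_, fun i hi' => ?_, ?_⟩
    · have := h2 i hi'
      simp only; omega
    · have := h2 i hi'
      simp only; omega
    · have hU' : (0 : ℝ) < 8 * U := by positivity
      have h' : (σ.vS : ℝ) * (8 * U + 1) ≤ 8 * U * σ.vQ := by exact_mod_cast h.le
      rw [pow_succ]
      calc (1 + 1 / (8 * U) : ℝ) ^ r * (1 + 1 / (8 * U)) ≤ σ.vS * (1 + 1 / (8 * U)) := by gcongr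
        _ = σ.vS * (8 * U + 1) / (8 * U) := by field_simp
        _ ≤ σ.vQ := by rw [div_le_iff₀ hU']; linarith

/-- The test reads 8U (vQ - vS) ≤ vS, and the debt is at most 2U (vQ - vS). So four times the debt
fits into the volume vS that was reserved in `mass_le` of the search. -/
theorem Searching.cut (hA : IsSymmAdj adj n m) (hc : Core adj U H σ) (hS : Searching adj n U H c σ)
    (hm : σ.mode = 2) (hi : σ.lo ≤ σ.idx) (h : 8 * U * σ.vQ ≤ σ.vS * (8 * U + 1)) :
    4 * debt adj n U σ.pr σ.fl σ.dead ≤ σ.vS ∧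
    Killing adj n U c { σ with idx := 0, arc := 0, mode := 3 } := by
  have hidx : σ.idx = σ.lo := le_antisymm hS.idx_le hi
  have hd := hS.debt_le hA hc.fl_le hi
  have h' : (8 * U * σ.vQ : ℤ) ≤ σ.vS * (8 * U + 1) := by exact_mod_cast h
  have hd' : 4 * debt adj n U σ.pr σ.fl σ.dead ≤ σ.vS := by linarith
  refine ⟨hd', Nat.zero_le _, fun _ => Nat.zero_le _, fun _ => rfl, ?_, ?_, ?_⟩
  · intro i hi'
    have := hS.pr_iff i (lt_of_lt_of_le hi' hS.lo_le)
    simp only at hi' ⊢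
    omega
  · intro v hv j u e hj
    rcases hS.closed v hv with h | ⟨i, hi', hQ⟩
    · exact .inl (h u e hj.mem)
    · exact .inr ⟨i, Nat.zero_le _, by simp only; omega, hQ, fun _ => Nat.zero_le _⟩
  · have := hS.mass_le
    rw [hidx, ← hS.vS_eq] at this
    simp only [mass, hm] at this ⊢
    zify at this
    norm_num at this ⊢
    linarith

end Modes

/-! ### Preservation of the full invariant by every transition. -/

section Invariant

variable {adj : ℕ → List (ℕ × ℕ)} {n m U H c : ℕ} {σ σ' : Conf}

/-- The invariants survive in modes `0` and `1` if no pruned vertex, no dead edge changes. -/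
theorem Invariant.of_mode_le_one (hσ : Invariant adj n U H c σ) (hc : Core adj U H σ')
    (hm : σ.mode ≤ 1) (hm' : σ'.mode ≤ 1) (hpr : σ'.pr = σ.pr) (hd : σ'.dead = σ.dead)
    (hmass : mass n σ' ≤ mass n σ)
    (hw : σ'.mode = 1 → σ.pr σ'.tok = 0 ∧ 0 < (adj σ'.tok).length) :
    Invariant adj n U H c σ' where
  core := hc
  mode_le := by omega
  closed _ := by simpa only [Closed, hpr, hd] using hσ.closed hm
  mass_le _ := by
    have := hσ.mass_le hm
    rw [hpr]
    omega
  walking h := by rw [hpr]; exact hw h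
  searching h := by omega
  killing h := by omega

theorem Invariant.of_searching (hc : Core adj U H σ') (hm : σ'.mode = 2)
    (h : Searching adj n U H c σ') : Invariant adj n U H c σ' where
  core := hc
  mode_le := by omega
  closed := by omega
  mass_le := by omega
  walking := by omega
  searching _ := h
  killing := by omega

theorem Invariant.of_killing (hc : Core adj U H σ') (hm : σ'.mode = 3)
    (h : Killing adj n U c σ') : Invariant adj n U H c σ' where
  core := hc
  mode_le := by omega
  closed := by omega
  mass_le := by omega
  walking := by omega
  searching := by omega
  killing _ := h

/-- Common to the three transitions that pass an arc of a pruned vertex. What remains to be killed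
is described by the arcs from position `arc` of the vertex at `idx` onwards. -/
theorem Killing.arc_succ {u e : ℕ} {σ' : Conf} (hK : Killing adj n U c σ) (hi : σ.idx < σ.lo)
    (ha : ArcAt adj (σ.Q σ.idx) σ.arc u e) (hpr : σ'.pr = σ.pr) (hQ : σ'.Q = σ.Q)
    (hidx : σ'.idx = σ.idx) (hlo : σ'.lo = σ.lo) (harc : σ'.arc = σ.arc + 1)
    (hd : ∀ i, σ.dead i ≠ 0 → σ'.dead i ≠ 0) (he : σ'.dead e ≠ 0)
    (hmass : mass n σ' + debt adj n U σ'.pr σ'.fl σ'.dead =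
      mass n σ + debt adj n U σ.pr σ.fl σ.dead) : Killing adj n U c σ' where
  idx_le := by rw [hidx, hlo]; exact hK.idx_le
  arc_le _ := by rw [harc, hQ, hidx]; exact ha.1
  arc_eq h := by omega
  pr_ne i h := by rw [hpr, hQ]; exact hK.pr_ne i (by omega)
  closed := by
    intro v hv j w e' hw
    rw [hpr] at hv
    rcases hK.closed v hv j w e' hw with h | ⟨i, h1, h2, rfl, h4⟩
    · exact .inl (hd _ h)
    · rw [hidx, hlo, hQ, harc]
      by_cases hij : i = σ.idx ∧ j = σ.arc
      · obtain ⟨rfl, rfl⟩ := hij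
        obtain ⟨-, -, rfl⟩ := hw
        obtain ⟨-, -, rfl⟩ := ha
        exact .inl he
      · exact .inr ⟨i, h1, h2, rfl, fun h => by have := h4 h; omega⟩
  mass_le := by rw [hmass, hpr]; exact hK.mass_le

theorem sum_range_update_pred {sc : ℕ → ℕ} {k : ℕ} (h : sc k ≠ 0) :
    ∑ i ∈ Finset.range (k + 1), Function.update sc k (sc k - 1) i + 1 =
      ∑ i ∈ Finset.range (k + 1), sc i := by
  have := sum_change_nat (s := Finset.range (k + 1)) (f := sc)
    (f' := Function.update sc k (sc k - 1)) (Finset.self_mem_range_succ k)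
    (fun b _ hb => Function.update_of_ne hb _ _)
  rw [Function.update_self] at this
  omega

theorem sum_range_update_succ {ab : ℕ → ℕ} {v : ℕ} (h : v < n) :
    ∑ i ∈ Finset.range n, Function.update ab v (ab v + 1) i = ∑ i ∈ Finset.range n, ab i + 1 := by
  have := sum_change_nat (s := Finset.range n) (f := ab)
    (f' := Function.update ab v (ab v + 1)) (Finset.mem_range.2 h)
    (fun b _ hb => Function.update_of_ne hb _ _)
  rw [Function.update_self] at this
  omega

theorem sum_range_push {sc : ℕ → ℕ} {k x : ℕ} :
    ∑ i ∈ Finset.range (k + 1), Function.update sc k x i = ∑ i ∈ Finset.range k, sc i + x := by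
  rw [Finset.sum_range_succ, Function.update_self]
  congr 1
  refine Finset.sum_congr rfl fun i hi => Function.update_of_ne ?_ _ _
  exact (Finset.mem_range.1 hi).ne

theorem Invariant.step (hA : IsSymmAdj adj n m) (hU : 0 < U)
    (hH : ∀ r : ℕ, (1 + 1 / (8 * U) : ℝ) ^ r ≤ (2 * m : ℕ) → r < H)
    (hσ : Invariant adj n U H c σ) (hs : Step adj U H σ σ') : Invariant adj n U H c σ' := by
  have hc := hσ.core
  have hc' := Core.step hA hH
    (fun hm => (hσ.searching hm).vS_le.trans ((hσ.searching hm).vQ_le hA)) hσ hs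
  cases hs with
  | pop hm hsp h =>
    obtain ⟨k, hk⟩ : ∃ k, σ.sp = k + 1 := ⟨σ.sp - 1, by omega⟩
    refine hσ.of_mode_le_one hc' (by omega) (by simp only; omega) rfl rfl ?_ ?_
    · simp only [mass, hk, Nat.add_sub_cancel, Finset.sum_range_succ]
      omega
    · intro h; simp only at h; omega
  | take hm hsp h h' =>
    refine hσ.of_mode_le_one hc' (by omega) le_rfl rfl rfl ?_ fun _ => ⟨h', hc.stack _ (by omega)⟩
    obtain ⟨k, hk⟩ : ∃ k, σ.sp = k + 1 := ⟨σ.sp - 1, by omega⟩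
    simp only [hk, Nat.add_sub_cancel] at h h' ⊢
    have := sum_range_update_pred h
    simp only [mass, hm, hk]
    split_ifs <;> omega
  | absorb hm h =>
    refine hσ.of_mode_le_one hc' (by omega) (Nat.zero_le _) rfl rfl ?_ ?_
    · have := sum_range_update_succ (ab := σ.ab) (hA.lt_of_length_pos (hσ.walking hm).2)
      simp only [mass, hm, this, if_true, zero_ne_one, if_false]
      omega
    · intro h; simp only at h; omega
  | @cancel u e hm h ha hl hd hf =>
    refine hσ.of_mode_le_one hc' (by omega) (by simp only; omega) rfl rfl le_rfl fun _ => ⟨?_, ?_⟩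
    -- The unit moved along a live edge, and pruned vertices have only dead ones.
    · by_contra hu
      exact hσ.closed (by omega) u hu _ _ (hA.symm ha.mem) hd
    · exact hA.length_pos_of_mem ha.mem
  | @forward u e hm h ha hl hd hf hf' =>
    refine hσ.of_mode_le_one hc' (by omega) (by simp only; omega) rfl rfl le_rfl fun _ => ⟨?_, ?_⟩
    · by_contra hu
      exact hσ.closed (by omega) u hu _ _ (hA.symm ha.mem) hd
    · exact hA.length_pos_of_mem ha.mem
  | advance hm =>
    exact hσ.of_mode_le_one hc' (by omega) (by simp only; omega) rfl rfl le_rfl hσ.walking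
  | relabel hm =>
    exact hσ.of_mode_le_one hc' (by omega) (by simp only; omega) rfl rfl le_rfl hσ.walking
  | search hm h hcur hl =>
    have hw := hσ.walking hm
    refine .of_searching hc' rfl ⟨?_, ?_, ?_, ?_, ?_, ?_, ?_, ?_, ?_, ?_, ?_, ?_, ?_, ?_, ?_, ?_⟩
    · exact Nat.zero_le _
    · exact Nat.one_pos
    · exact le_rfl
    · exact Function.update_self (f := σ.Q) 0 σ.tok
    · intro i hi
      obtain rfl : i = 0 := by simp only at hi; omega
      simp
    · intro i hi
      obtain rfl : i = 0 := by simp only at hi; omega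
      simpa using hw.2
    · intro i hi
      obtain rfl : i = 0 := by simp only at hi; omega
      simpa using hw.1
    · exact fun v hv => .inl (hσ.closed (by omega) v hv)
    · exact fun _ => Nat.zero_le _
    · exact fun _ => rfl
    · exact fun i hi => absurd hi (Nat.not_lt_zero i)
    · exact fun j hj => absurd hj (Nat.not_lt_zero j)
    · simp
    · simp
    · refine ⟨0, fun i hi => ?_, fun i hi => ?_, ?_⟩
      · obtain rfl : i = 0 := by simp only at hi; omega
        simpa using hl
      · obtain rfl : i = 0 := by simp only at hi; omega
        simp only [Function.update_self]
        omega
      · simpa using Nat.succ_le_of_lt hw.2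
    -- The stuck unit leaves the mass when the search begins, so the bound only becomes weaker.
    · have := hσ.mass_le (by omega)
      simp only [mass, hm] at this ⊢
      norm_num at this ⊢
      omega
  | enqueue hm hi ha hr hq =>
    exact .of_searching hc' hm ((hσ.searching hm).enqueue hA hc hi ha hr hq)
  | @pass u e hm hi ha hn =>
    have hS := hσ.searching hm
    refine .of_searching hc' hm { hS with arc_le := ?_, arc_eq := ?_, seen_idx := ?_ }
    · exact fun _ => ha.1
    · exact fun h => absurd h hi.ne
    · intro j hj w e' hw hr
      rcases Nat.lt_succ_iff_lt_or_eq.1 hj with hj | rfl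
      · exact hS.seen_idx j hj w e' hw hr
      · obtain ⟨-, rfl, rfl⟩ := ha
        obtain ⟨-, rfl, rfl⟩ := hw
        exact ⟨_, (hn hr).1, (hn hr).2⟩
  | finish hm hi ha => exact .of_searching hc' hm ((hσ.searching hm).finish hA hi ha)
  | extend hm hi h => exact .of_searching hc' hm ((hσ.searching hm).extend hU hi h)
  | cut hm hi h => exact .of_killing hc' rfl ((hσ.searching hm).cut hA hc hm hi h).2
  | @kill_send u e hm hi ha hd hu =>
    have hK := hσ.killing hm
    have hne : ∀ i, σ.dead i ≠ 0 → Function.update σ.dead e 1 i ≠ 0 := by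
      intro i hi
      rcases eq_or_ne i e with rfl | h
      · simp
      · simpa [h] using hi
    refine .of_killing hc' hm (hK.arc_succ hi ha rfl rfl rfl rfl rfl hne (by simp) ?_)
    have hin : inflow U σ.fl σ.dead u (σ.Q σ.idx, e) =
      σ.fl (slot (σ.Q σ.idx) u e) - σ.fl (slot u (σ.Q σ.idx) e) := by simp [inflow, hd]
    simp only [mass, hm, sum_range_push]
    rw [debt_kill_send hA ha.mem (hK.pr_ne _ hi) hu hd, hin]
    push_cast [refund_eq hc.fl_le]
    ring
  | @kill_inner u e hm hi ha hd hu =>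
    have hK := hσ.killing hm
    have hne : ∀ i, σ.dead i ≠ 0 → Function.update σ.dead e 1 i ≠ 0 := by
      intro i hi
      rcases eq_or_ne i e with rfl | h
      · simp
      · simpa [h] using hi
    refine .of_killing hc' hm (hK.arc_succ hi ha rfl rfl rfl rfl rfl hne (by simp) ?_)
    simp only [mass, hm]
    rw [debt_kill_inner hA ha.mem (hK.pr_ne _ hi) hu]
  | kill_pass hm hi ha hd =>
    have hK := hσ.killing hm
    exact .of_killing hc' hm (hK.arc_succ hi ha rfl rfl rfl rfl rfl (fun _ => id) hd rfl)
  | kill_next hm hi ha =>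
    have hK := hσ.killing hm
    refine .of_killing hc' hm
      { hK with idx_le := hi, arc_le := fun _ => Nat.zero_le _, arc_eq := fun _ => rfl, closed := ?_ }
    intro v hv j w e' hw
    refine (hK.closed v hv j w e' hw).imp id ?_
    rintro ⟨i, h1, h2, rfl, h4⟩
    refine ⟨i, ?_, h2, rfl, fun _ => Nat.zero_le _⟩
    rcases eq_or_ne i σ.idx with rfl | h
    · have h4 := h4 rfl
      have hj := hw.1
      omega
    · simp only; omega
  | kill_done hm hi =>
    have hK := hσ.killing hm
    have hidx : σ.idx = σ.lo := le_antisymm hK.idx_le hi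
    refine ⟨hc', Nat.zero_le _, fun _ => ?_, fun _ => ?_, ?_, ?_, ?_⟩
    · intro v hv u e hu
      obtain ⟨j, hj⟩ := exists_arcAt hu
      rcases hK.closed v hv j u e hj with h | ⟨i, h1, h2, -⟩
      · exact h
      · omega
    -- A nonnegative debt can simply be dropped.
    · have h1 := hK.mass_le
      have h2 := debt_nonneg (adj := adj) (n := n) hc.fl_le
      simp only [mass, hm] at h1 ⊢
      zify
      norm_num at h1 ⊢
      linarith
    all_goals exact fun h => by simp at h

/-! ### Bounds for the data -/

/-- Bounds for the data that do not follow from the other invariants. -/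
structure Ranged (n m U : ℕ) (σ : Conf) : Prop where
  pr : ∀ i, σ.pr i ≤ 1
  dead : ∀ i, σ.dead i ≤ 1
  Q : ∀ i, σ.Q i ≤ n
  pos : ∀ i, σ.pos i ≤ 2 * m
  sv : ∀ i, σ.sv i ≤ n
  sc : ∀ i, σ.sc i ≤ 2 * U
  tok : σ.tok ≤ n
  idx : σ.idx ≤ 2 * m
  arc : σ.arc ≤ 2 * m
  lo : σ.lo ≤ 2 * m
  len : σ.len ≤ 2 * m
  vS : σ.vS ≤ 2 * m
  vQ : σ.vQ ≤ 2 * m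

theorem forall_update_le {f : ℕ → ℕ} {i x B : ℕ} (hf : ∀ j, f j ≤ B) (hx : x ≤ B) (j : ℕ) :
    Function.update f i x j ≤ B := by
  rcases eq_or_ne j i with rfl | h
  · simpa
  · simpa [h] using hf j

theorem Ranged.step (hA : IsSymmAdj adj n m) (hσ : Invariant adj n U H c σ)
    (hσ' : Invariant adj n U H c σ') (hR : Ranged n m U σ) (hs : Step adj U H σ σ') :
    Ranged n m U σ' := by
  have hlen := hA.length_le
  cases hs with
  | pop => exact { hR with }
  | take hm hsp h h' =>
    refine { hR with tok := hR.sv _, sc := forall_update_le hR.sc ?_ }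
    have := hR.sc (σ.sp - 1)
    omega
  | absorb => exact { hR with }
  | cancel hm h ha => exact { hR with tok := (hA.vert_lt (hA.symm ha.mem)).le }
  | forward hm h ha => exact { hR with tok := (hA.vert_lt (hA.symm ha.mem)).le }
  | advance => exact { hR with }
  | relabel => exact { hR with }
  | search hm h =>
    have h1 := (hσ.walking hm).2
    have h2 := hlen σ.tok
    exact { hR with
      Q := forall_update_le hR.Q hR.tok, pos := forall_update_le hR.pos (Nat.zero_le _),
      idx := Nat.zero_le _, arc := Nat.zero_le _, lo := by simp only; omega,
      len := by simp only; omega, vS := h2, vQ := h2 }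
  | enqueue hm hi ha hr hq =>
    -- The invariant after the transition is used, since the enlarged queue must still have volume
    -- at most 2m.
    have hS := hσ'.searching hm
    have h1 := hS.vQ_le hA
    have h2 := hS.len_le
    have h3 := ha.1
    have h4 := hlen (σ.Q σ.idx)
    exact { hR with
      Q := forall_update_le hR.Q (hA.vert_lt (hA.symm ha.mem)).le,
      pos := forall_update_le hR.pos hR.len, arc := by simp only; omega, len := h2.trans h1,
      vQ := h1 }
  | pass hm hi ha => exact { hR with arc := ha.1.trans_le (hlen _) }
  | finish hm hi => exact { hR with
      pr := forall_update_le hR.pr le_rfl, arc := Nat.zero_le _, idx := Nat.succ_le_of_lt (hi.trans_le hR.lo) }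
  | extend => exact { hR with lo := hR.len, vS := hR.vQ }
  | cut => exact { hR with idx := Nat.zero_le _, arc := Nat.zero_le _ }
  | @kill_send u e hm hi ha =>
    refine { hR with
      dead := forall_update_le hR.dead le_rfl,
      sv := forall_update_le hR.sv (hA.vert_lt (hA.symm ha.mem)).le,
      sc := forall_update_le hR.sc ?_, arc := ha.1.trans_le (hlen _) }
    have := hσ.core.fl_le (slot u (σ.Q σ.idx) e)
    omega
  | kill_inner hm hi ha =>
    exact { hR with dead := forall_update_le hR.dead le_rfl, arc := ha.1.trans_le (hlen _) }
  | kill_pass hm hi ha => exact { hR with arc := ha.1.trans_le (hlen _) }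
  | kill_next hm hi => exact { hR with
      arc := Nat.zero_le _, idx := Nat.succ_le_of_lt (hi.trans_le hR.lo) }
  | kill_done => exact { hR with }

end Invariant

/-! ### The potential -/

/-- The credit of a vertex. -/
def credit (adj : ℕ → List (ℕ × ℕ)) (H : ℕ) (ab lev cur : ℕ → ℕ) (v : ℕ) : ℤ :=
  (7 * H + 14) * ab v - 2 * (lev v * ((adj v).length + 1) + cur v)

/-- The total credit of the vertices that are not pruned. -/
def reserve (adj : ℕ → List (ℕ × ℕ)) (n H : ℕ) (pr ab lev cur : ℕ → ℕ) : ℤ :=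
  ∑ v ∈ Finset.range n, if pr v = 0 then credit adj H ab lev cur v else 0

/-- The part of the potential that depends on the mode. -/
def modePotential (adj : ℕ → List (ℕ × ℕ)) (n U H : ℕ) (σ : Conf) : ℤ :=
  if σ.mode = 0 then 0
  else if σ.mode = 1 then 7 * H + 15 + σ.lev σ.tok
  else if σ.mode = 2 then
    (2 * H + 9) * ∑ i ∈ Finset.range σ.idx, ((adj (σ.Q i)).length : ℤ) - σ.arc +
      if σ.idx = σ.lo then 1 else 0
  else (8 * H + 16) * debt adj n U σ.pr σ.fl σ.dead +
    ∑ i ∈ Finset.Ico σ.idx σ.lo, (3 * ((adj (σ.Q i)).length : ℤ) + 1) - 3 * σ.arc + 1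

/-- An upper bound for the number of transitions until the stack is empty. -/
def potential (adj : ℕ → List (ℕ × ℕ)) (n U H : ℕ) (σ : Conf) : ℤ :=
  reserve adj n H σ.pr σ.ab σ.lev σ.cur +
    (8 * H + 16) * (∑ i ∈ Finset.range σ.sp, σ.sc i : ℕ) + σ.sp + modePotential adj n U H σ

section Potential

variable {adj : ℕ → List (ℕ × ℕ)} {n m U H c : ℕ} {σ σ' : Conf}

/-- A vertex that has scanned an arc or risen is saturated with positive degree. Then the level is
at most H, deg + 1 ≤ 2 deg, and the current arc is at most deg: all the scanning is paid for by the
absorbed units. -/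
theorem Core.scan_le (hc : Core adj U H σ) (v : ℕ) :
    2 * ((σ.lev v : ℤ) * ((adj v).length + 1) + σ.cur v) ≤ (4 * H + 2) * σ.ab v := by
  by_cases h : σ.lev v ≠ 0 ∨ σ.cur v ≠ 0
  · obtain ⟨h1, h2⟩ := hc.full v h
    have h3 := hc.lev_le v
    have h4 := hc.cur_le v
    rw [h1]
    have h5 : σ.lev v * ((adj v).length + 1) ≤ H * (2 * (adj v).length) :=
      Nat.mul_le_mul h3 (by omega)
    zify at h4 h5
    linarith
  · simp only [not_or, not_not] at h
    rw [h.1, h.2]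
    simp only [Nat.cast_zero, zero_mul, add_zero, mul_zero]
    positivity

/-- What is left after scanning, 3H + 12 per absorbed unit, finances the search, the removal of
edges and the new units if the vertex is pruned. -/
theorem Core.credit_ge (hc : Core adj U H σ) (v : ℕ) :
    (3 * H + 12 : ℤ) * σ.ab v ≤ credit adj H σ.ab σ.lev σ.cur v := by
  have := hc.scan_le v
  unfold credit
  linarith

theorem Core.credit_nonneg (hc : Core adj U H σ) (v : ℕ) :
    0 ≤ credit adj H σ.ab σ.lev σ.cur v :=
  le_trans (by positivity) (hc.credit_ge v)

theorem Core.reserve_nonneg (hc : Core adj U H σ) :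
    0 ≤ reserve adj n H σ.pr σ.ab σ.lev σ.cur := by
  refine Finset.sum_nonneg fun v _ => ?_
  split_ifs
  · exact hc.credit_nonneg v
  · rfl

theorem Core.credit_le_reserve (hc : Core adj U H σ) {v : ℕ} (hv : v < n) (hp : σ.pr v = 0) :
    credit adj H σ.ab σ.lev σ.cur v ≤ reserve adj n H σ.pr σ.ab σ.lev σ.cur := by
  have := Finset.single_le_sum (f := fun v => if σ.pr v = 0 then credit adj H σ.ab σ.lev σ.cur v else 0)
    (s := Finset.range n) (fun v _ => by
      split_ifs
      · exact hc.credit_nonneg v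
      · rfl) (Finset.mem_range.2 hv)
  rw [if_pos hp] at this
  exact this

theorem Searching.ab_eq (hA : IsSymmAdj adj n m)
    (hH : ∀ r : ℕ, (1 + 1 / (8 * U) : ℝ) ^ r ≤ (2 * m : ℕ) → r < H) (hc : Core adj U H σ)
    (hS : Searching adj n U H c σ) {i : ℕ} (hi : i < σ.lo) :
    σ.ab (σ.Q i) = (adj (σ.Q i)).length := by
  obtain ⟨r, hr, -, hr'⟩ := hS.layer
  have hrH : r < H := hH r (hr'.trans (by exact_mod_cast hS.vS_le.trans (hS.vQ_le hA)))
  have := hr i hi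
  exact (hc.full _ (.inl (by omega))).1

theorem reserve_change {pr ab lev cur ab' lev' cur' : ℕ → ℕ} {v : ℕ} (hv : v < n) (hp : pr v = 0)
    (h : ∀ w, w ≠ v → ab' w = ab w ∧ lev' w = lev w ∧ cur' w = cur w) :
    reserve adj n H pr ab' lev' cur' = reserve adj n H pr ab lev cur +
      (credit adj H ab' lev' cur' v - credit adj H ab lev cur v) := by
  unfold reserve
  rw [sum_change (f := fun v => if pr v = 0 then credit adj H ab lev cur v else 0)
    (Finset.mem_range.2 hv)]
  · simp only [hp, if_true]
  · intro w _ hw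
    obtain ⟨h1, h2, h3⟩ := h w hw
    simp only [credit, h1, h2, h3]

theorem reserve_prune {pr ab lev cur : ℕ → ℕ} {v : ℕ} (hv : v < n) (hp : pr v = 0) :
    reserve adj n H (Function.update pr v 1) ab lev cur = reserve adj n H pr ab lev cur -
      credit adj H ab lev cur v := by
  unfold reserve
  rw [sum_change (f := fun v => if pr v = 0 then credit adj H ab lev cur v else 0)
    (Finset.mem_range.2 hv)]
  · simp [hp]
    ring
  · intro w _ hw
    simp [hw]

/-- The remaining terms of the potential are nonnegative together; the negative term -arc of the
search is covered by the credit of the vertex being scanned. This bounds the stack, and it makes the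
potential usable for termination. -/
theorem Invariant.sp_le_potential (hA : IsSymmAdj adj n m)
    (hH : ∀ r : ℕ, (1 + 1 / (8 * U) : ℝ) ^ r ≤ (2 * m : ℕ) → r < H) (hσ : Invariant adj n U H c σ) :
    (σ.sp : ℤ) ≤ potential adj n U H σ := by
  have hc := hσ.core
  have h1 : 0 ≤ reserve adj n H σ.pr σ.ab σ.lev σ.cur + modePotential adj n U H σ := by
    have h0 : 0 ≤ reserve adj n H σ.pr σ.ab σ.lev σ.cur := hc.reserve_nonneg
    have hm := hσ.mode_le
    unfold modePotential
    split_ifs with m0 m1 m2 hi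
    · linarith
    · positivity
    · have := (hσ.searching m2).arc_eq hi
      rw [this, Nat.cast_zero, sub_zero]
      positivity
    · have hS := hσ.searching m2
      have hlt : σ.idx < σ.lo := lt_of_le_of_ne hS.idx_le hi
      have hlen := hlt.trans_le hS.lo_le
      have hpr := (hS.pr_iff _ hlen).2 le_rfl
      have h2 := hc.credit_le_reserve (n := n) (hA.lt_of_length_pos (hS.deg_pos _ hlen)) hpr
      have h3 := hc.credit_ge (σ.Q σ.idx)
      have h4 : σ.arc ≤ (adj (σ.Q σ.idx)).length := hS.arc_le hlt
      have h6 : 0 ≤ (2 * H + 9 : ℤ) * ∑ i ∈ Finset.range σ.idx, ((adj (σ.Q i)).length : ℤ) := by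
        positivity
      rw [hS.ab_eq hA hH hc hlt] at h3
      zify at h4
      have h5 : (0 : ℤ) ≤ (3 * H + 11) * (adj (σ.Q σ.idx)).length := by positivity
      linarith
    · have hK := hσ.killing (by omega)
      have h2 := debt_nonneg (adj := adj) (n := n) hc.fl_le
      have h3 : (3 * σ.arc : ℤ) ≤ ∑ i ∈ Finset.Ico σ.idx σ.lo, (3 * ((adj (σ.Q i)).length : ℤ) + 1) := by
        rcases hK.idx_le.lt_or_eq with h | h
        · have h4 := hK.arc_le h
          have h5 := Finset.single_le_sum (f := fun i => (3 * ((adj (σ.Q i)).length : ℤ) + 1))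
            (s := Finset.Ico σ.idx σ.lo) (fun i _ => by positivity) (Finset.mem_Ico.2 ⟨le_rfl, h⟩)
          zify at h4
          linarith
        · rw [hK.arc_eq h]
          simp only [Nat.cast_zero, mul_zero]
          exact Finset.sum_nonneg fun i _ => by positivity
      have h6 : 0 ≤ (8 * H + 16 : ℤ) * debt adj n U σ.pr σ.fl σ.dead := by positivity
      linarith
  have h2 : 0 ≤ (8 * H + 16 : ℤ) * (∑ i ∈ Finset.range σ.sp, σ.sc i : ℕ) := by positivity
  unfold potential
  linarith

/-- A waiting unit is worth 8H + 16, a walking one 7H + 15 + level, an absorbed one 7H + 14. Passing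
an arc or raising a level costs the vertex 2, of which a rise gives 1 to the walking unit. Pruning
turns the credit of a vertex into 2H + 9 per degree; at a cut this buys the debt, at 8H + 16 per
unit, and the passage over all arcs, at 3 each. -/
theorem Invariant.potential_step (hA : IsSymmAdj adj n m)
    (hH : ∀ r : ℕ, (1 + 1 / (8 * U) : ℝ) ^ r ≤ (2 * m : ℕ) → r < H)
    (hσ : Invariant adj n U H c σ) (hs : Step adj U H σ σ') :
    potential adj n U H σ' + 1 ≤ potential adj n U H σ := by
  have hc := hσ.core
  cases hs with
  | pop hm hsp h =>
    obtain ⟨k, hk⟩ : ∃ k, σ.sp = k + 1 := ⟨σ.sp - 1, by omega⟩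
    simp only [potential, modePotential, hm, hk, Nat.add_sub_cancel, Finset.sum_range_succ, if_true]
    push_cast
    have : (0 : ℤ) ≤ (8 * H + 16) * σ.sc k := by positivity
    linarith
  | take hm hsp h h' =>
    obtain ⟨k, hk⟩ : ∃ k, σ.sp = k + 1 := ⟨σ.sp - 1, by omega⟩
    simp only [hk, Nat.add_sub_cancel] at h h' ⊢
    have h1 := sum_range_update_pred h
    have h2 := hc.lev_le (σ.sv k)
    simp only [potential, modePotential, hm, hk, if_true, one_ne_zero, if_false, ← h1]
    push_cast
    zify at h2
    linarith
  | absorb hm h =>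
    have hw := hσ.walking hm
    simp only [potential, modePotential, hm, if_true, one_ne_zero, if_false]
    rw [reserve_change (ab := σ.ab) (lev := σ.lev) (cur := σ.cur) (hA.lt_of_length_pos hw.2) hw.1
      fun w hw => ⟨Function.update_of_ne hw _ _, rfl, rfl⟩]
    simp only [credit, Function.update_self]
    push_cast
    linarith
  | @cancel u e hm h ha hl hd hf =>
    simp only [potential, modePotential, hm, if_true, one_ne_zero, if_false]
    zify at hl
    linarith
  | @forward u e hm h ha hl hd hf hf' =>
    simp only [potential, modePotential, hm, if_true, one_ne_zero, if_false]
    zify at hl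
    linarith
  | @advance u e hm h ha hn =>
    have hw := hσ.walking hm
    simp only [potential, modePotential, hm, if_true, one_ne_zero, if_false]
    rw [reserve_change (ab := σ.ab) (lev := σ.lev) (cur := σ.cur) (hA.lt_of_length_pos hw.2) hw.1
      fun w hw => ⟨rfl, rfl, Function.update_of_ne hw _ _⟩]
    simp only [credit, Function.update_self]
    push_cast
    linarith
  | relabel hm h hcur hl =>
    have hw := hσ.walking hm
    have hcur' : σ.cur σ.tok = (adj σ.tok).length := le_antisymm (hc.cur_le _) hcur
    simp only [potential, modePotential, hm, if_true, one_ne_zero, if_false]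
    rw [reserve_change (ab := σ.ab) (lev := σ.lev) (cur := σ.cur) (hA.lt_of_length_pos hw.2) hw.1
      fun w hw => ⟨rfl, Function.update_of_ne hw _ _, Function.update_of_ne hw _ _⟩]
    simp only [credit, Function.update_self, hcur']
    push_cast
    linarith
  | search hm h hcur hl =>
    simp only [potential, modePotential, hm, if_true, one_ne_zero, if_false, Finset.range_zero,
      Finset.sum_empty, OfNat.ofNat_ne_zero, OfNat.ofNat_ne_one, zero_ne_one]
    push_cast
    have : (0 : ℤ) ≤ 7 * H + σ.lev σ.tok := by positivity
    linarith
  | @enqueue u e hm hi ha hr hq =>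
    have hS := hσ.searching hm
    have hlen := hi.trans_le hS.lo_le
    have hsum : ∑ i ∈ Finset.range σ.idx, ((adj (Function.update σ.Q σ.len u i)).length : ℤ) =
        ∑ i ∈ Finset.range σ.idx, ((adj (σ.Q i)).length : ℤ) := by
      refine Finset.sum_congr rfl fun i hi' => ?_
      rw [Function.update_of_ne ((Finset.mem_range.1 hi').trans hlen).ne]
    simp only [potential, modePotential, hm, if_true, if_false, OfNat.ofNat_ne_zero,
      OfNat.ofNat_ne_one, hsum]
    push_cast
    linarith
  | pass hm hi ha hn =>
    simp only [potential, modePotential, hm, if_true, if_false, OfNat.ofNat_ne_zero,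
      OfNat.ofNat_ne_one]
    push_cast
    linarith
  | finish hm hi ha =>
    have hS := hσ.searching hm
    have hlen := hi.trans_le hS.lo_le
    have hpr := (hS.pr_iff _ hlen).2 le_rfl
    have hdeg := hS.deg_pos _ hlen
    have harc := le_antisymm (hS.arc_le hi) ha
    have hab := hS.ab_eq hA hH hc hi
    have h3 := hc.scan_le (σ.Q σ.idx)
    have hite : (if σ.idx + 1 = σ.lo then 1 else 0 : ℤ) ≤ 1 := by split_ifs <;> norm_num
    have h4 : (1 : ℤ) ≤ (adj (σ.Q σ.idx)).length := by exact_mod_cast hdeg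
    have h5 : (0 : ℤ) ≤ H * (adj (σ.Q σ.idx)).length := by positivity
    rw [hab] at h3
    simp only [potential, modePotential, hm, if_true, if_false, OfNat.ofNat_ne_zero,
      OfNat.ofNat_ne_one, hi.ne, Finset.sum_range_succ]
    rw [reserve_prune (hA.lt_of_length_pos hdeg) hpr, harc]
    simp only [credit, hab]
    push_cast
    linarith
  | extend hm hi h =>
    have hS := hσ.searching hm
    have hidx : σ.idx = σ.lo := le_antisymm hS.idx_le hi
    -- An empty new layer would have passed the cut test. So the bonus 1, granted when the layer is
    -- fully scanned, is really consumed.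
    have hlt : σ.lo ≠ σ.len := by
      intro he
      have : σ.vQ = σ.vS := by rw [hS.vQ_eq, hS.vS_eq, he]
      rw [this] at h
      nlinarith
    simp only [potential, modePotential, hm, if_true, if_false, OfNat.ofNat_ne_zero,
      OfNat.ofNat_ne_one, hidx, hlt]
    linarith
  | cut hm hi h =>
    have hS := hσ.searching hm
    have hidx : σ.idx = σ.lo := le_antisymm hS.idx_le hi
    have hd := (hS.cut hA hc hm hi h).1
    have harc := hS.arc_eq hidx
    have hlo := hS.lo_le_vS
    have hlo0 := hS.lo_pos
    have hvS : ∑ i ∈ Finset.range σ.lo, ((adj (σ.Q i)).length : ℤ) = σ.vS := by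
      rw [hS.vS_eq]; push_cast; rfl
    have h1 : ∑ i ∈ Finset.Ico 0 σ.lo, (3 * ((adj (σ.Q i)).length : ℤ) + 1) = 3 * σ.vS + σ.lo := by
      rw [← hvS, Finset.mul_sum, Finset.sum_add_distrib]
      simp
    -- Here the debt is at most vS/4. The passage costs 3 vS + lo ≤ 4 vS more, so 2H + 9 per unit of
    -- volume leaves a surplus of vS.
    have h2 : (8 * H + 16 : ℤ) * debt adj n U σ.pr σ.fl σ.dead ≤ (2 * H + 4) * σ.vS := by
      nlinarith
    simp only [potential, modePotential, hm, if_true, if_false, OfNat.ofNat_ne_zero,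
      OfNat.ofNat_ne_one, hidx, harc, h1, hvS]
    simp only [show (3 : ℕ) ≠ 2 by norm_num, if_false]
    push_cast
    zify at hlo hlo0
    linarith
  | @kill_send u e hm hi ha hd hu =>
    have hK := hσ.killing hm
    have hin : inflow U σ.fl σ.dead u (σ.Q σ.idx, e) =
      σ.fl (slot (σ.Q σ.idx) u e) - σ.fl (slot u (σ.Q σ.idx) e) := by simp [inflow, hd]
    simp only [potential, modePotential, hm, if_false, OfNat.ofNat_ne_zero, OfNat.ofNat_ne_one,
      show (3 : ℕ) ≠ 2 by norm_num, sum_range_push]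
    rw [debt_kill_send hA ha.mem (hK.pr_ne _ hi) hu hd, hin]
    push_cast [refund_eq hc.fl_le]
    linarith
  | @kill_inner u e hm hi ha hd hu =>
    have hK := hσ.killing hm
    simp only [potential, modePotential, hm, if_false, OfNat.ofNat_ne_zero, OfNat.ofNat_ne_one,
      show (3 : ℕ) ≠ 2 by norm_num]
    rw [debt_kill_inner hA ha.mem (hK.pr_ne _ hi) hu]
    push_cast
    linarith
  | kill_pass hm hi ha hd =>
    simp only [potential, modePotential, hm, if_false, OfNat.ofNat_ne_zero, OfNat.ofNat_ne_one,
      show (3 : ℕ) ≠ 2 by norm_num]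
    push_cast
    linarith
  | kill_next hm hi ha =>
    have hK := hσ.killing hm
    have harc := le_antisymm (hK.arc_le hi) ha
    simp only [potential, modePotential, hm, if_false, OfNat.ofNat_ne_zero, OfNat.ofNat_ne_one,
      show (3 : ℕ) ≠ 2 by norm_num]
    rw [Finset.sum_eq_sum_Ico_succ_bot hi, harc]
    push_cast
    linarith
  | kill_done hm hi =>
    have hK := hσ.killing hm
    have hidx : σ.idx = σ.lo := le_antisymm hK.idx_le hi
    have h2 := debt_nonneg (adj := adj) (n := n) hc.fl_le
    have h6 : 0 ≤ (8 * H + 16 : ℤ) * debt adj n U σ.pr σ.fl σ.dead := by positivity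
    simp only [potential, modePotential, hm, if_false, if_true, OfNat.ofNat_ne_zero,
      OfNat.ofNat_ne_one, show (3 : ℕ) ≠ 2 by norm_num, hidx, hK.arc_eq hidx, Finset.Ico_self,
      Finset.sum_empty]
    push_cast
    linarith

end Potential

/-! ### Requests -/

/-- The configuration before a request, with the edge `e` between `l` and `r` removed. -/
def Conf.remove (U : ℕ) (σ : Conf) (e l r : ℕ) : Conf :=
  { σ with
    sv := Function.update (Function.update σ.sv 0 l) 1 r,
    sc := Function.update (Function.update σ.sc 0 (U + σ.fl (slot l r e) - σ.fl (slot r l e))) 1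
      (U + σ.fl (slot r l e) - σ.fl (slot l r e)),
    sp := 2, dead := Function.update σ.dead e 1 }

/-- What holds between the requests, after `c` of them. -/
structure Ready (adj : ℕ → List (ℕ × ℕ)) (n m U H c : ℕ) (σ : Conf) : Prop where
  mode_eq : σ.mode = 0
  sp_eq : σ.sp = 0
  invariant : Invariant adj n U H c σ
  ranged : Ranged n m U σ

section Requests

variable {adj : ℕ → List (ℕ × ℕ)} {n m U H c : ℕ} {σ : Conf}

theorem ready_blank : Ready adj n m U H 0 (Conf.ofState State.blank) where
  mode_eq := rfl
  sp_eq := rfl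
  invariant :=
    { core :=
        { fl_le _ := Nat.zero_le _
          ab_le _ := Nat.zero_le _
          lev_le _ := Nat.zero_le _
          cur_le _ := Nat.zero_le _
          full v h := by simp [Conf.ofState, State.blank] at h
          valid _ _ _ _ _ := Nat.zero_le _
          scanned _ _ _ _ _ _ _ := Nat.zero_le _
          stack i hi := absurd hi (Nat.not_lt_zero i)
          pr_full v h := absurd rfl h
          balance v _ := by simp [Conf.ofState, State.blank, inflow, pend] }
      mode_le := Nat.zero_le _
      closed _ v h := absurd rfl h
      mass_le _ := by simp [Conf.ofState, State.blank, mass]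
      walking h := by simp [Conf.ofState, State.blank] at h
      searching h := by simp [Conf.ofState, State.blank] at h
      killing h := by simp [Conf.ofState, State.blank] at h }
  ranged := by
    constructor <;> intros <;> exact Nat.zero_le _

theorem potential_blank : potential adj n U H (Conf.ofState State.blank) = 0 := by
  simp [potential, modePotential, reserve, credit, Conf.ofState, State.blank]

/-- The flow along the edge cancels: a request injects exactly 2U units whatever the edge carried.
-/
theorem refund_add (hfl : ∀ i, σ.fl i ≤ U) (e l r : ℕ) :
    (U + σ.fl (slot l r e) - σ.fl (slot r l e)) + (U + σ.fl (slot r l e) - σ.fl (slot l r e)) =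
      2 * U := by
  have h1 := hfl (slot l r e)
  have h2 := hfl (slot r l e)
  omega

theorem refund_ge (hfl : ∀ i, σ.fl i ≤ U) (v u e : ℕ) :
    (U : ℤ) - inflow U σ.fl σ.dead v (u, e) ≤ (U + σ.fl (slot v u e) - σ.fl (slot u v e) : ℕ) := by
  rw [refund_eq hfl]
  have := hfl (slot u v e)
  unfold inflow
  split_ifs
  · dsimp only; linarith
  · zify at this
    have h2 : (0 : ℤ) ≤ σ.fl (slot v u e) := by positivity
    linarith

theorem pend_remove (e l r v : ℕ) :
    pend 2 (Function.update (Function.update σ.sv 0 l) 1 r)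
      (Function.update (Function.update σ.sc 0 (U + σ.fl (slot l r e) - σ.fl (slot r l e))) 1
        (U + σ.fl (slot r l e) - σ.fl (slot l r e))) v =
      (if l = v then U + σ.fl (slot l r e) - σ.fl (slot r l e) else 0) +
      if r = v then U + σ.fl (slot r l e) - σ.fl (slot l r e) else 0 := by
  simp [pend, Finset.sum_range_succ]

/-- The units injected at the two ends raise the inflow along the edge to U. The edge may already be
dead, if an end was pruned; then the units are superfluous but harmless. -/
theorem Ready.remove (hA : IsSymmAdj adj n m) (hσ : Ready adj n m U H c σ) {e l r : ℕ}
    (ha : (r, e) ∈ adj l) :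
    Invariant adj n U H (c + 1) (σ.remove U e l r) ∧ Ranged n m U (σ.remove U e l r) ∧
    potential adj n U H (σ.remove U e l r) =
      potential adj n U H σ + (2 * U * (8 * H + 16) + 2 : ℕ) := by
  obtain ⟨hm, hsp, hI, hR⟩ := hσ
  have hc := hI.core
  have hadd := refund_add hc.fl_le e l r
  refine ⟨⟨?_, hI.mode_le, fun _ => ?_, fun _ => ?_, ?_, ?_, ?_⟩, ?_, ?_⟩
  · refine { hc with valid := ?_, scanned := ?_, stack := ?_, balance := ?_ }
    · exact fun v w e' hv hr => hc.valid v w e' hv (res_of_kill hr)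
    · exact fun v j w e' hj hv hr => hc.scanned v j w e' hj hv (res_of_kill hr)
    · intro i hi
      have hl := List.length_pos_of_mem ha
      have hr := List.length_pos_of_mem (hA.symm ha)
      have : i = 0 ∨ i = 1 := by simp only [Conf.remove] at hi; omega
      rcases this with rfl | rfl
      · simpa [Conf.remove] using hl
      · simpa [Conf.remove] using hr
    · intro v hv
      have h1 := hc.balance v hv
      have hz : ((0 = 1 ∨ 0 = 2) ∧ σ.tok = v) = False := by simp
      simp only [Conf.remove, pend_remove, hm, hsp, hz, if_false] at h1 ⊢
      have hp0 : pend 0 σ.sv σ.sc v = 0 := rfl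
      rw [hp0, Nat.cast_zero] at h1
      -- For a loop both refunds arrive at the same vertex; the second one is not needed.
      by_cases hvl : l = v
      · subst hvl
        have h2 := refund_ge hc.fl_le l r e
        rw [sum_inflow_kill hA ha, if_pos rfl]
        have h3 : (0 : ℤ) ≤ ((if r = l then U + σ.fl (slot r l e) - σ.fl (slot l r e) else 0 : ℕ) : ℤ) :=
          Int.natCast_nonneg _
        rw [Nat.cast_add]
        linarith
      · by_cases hvr : r = v
        · subst hvr
          have h2 := refund_ge hc.fl_le r l e
          rw [sum_inflow_kill hA (hA.symm ha), if_neg hvl, if_pos rfl]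
          rw [Nat.cast_add]
          linarith
        · rw [sum_inflow_kill_of_notMem, if_neg hvl, if_neg hvr]
          · simpa using h1
          · intro w hw
            rcases hA.ends ha hw with ⟨h, -⟩ | ⟨h, -⟩
            · exact hvl h.symm
            · exact hvr h.symm
  · intro v hv u e' hu
    have := hI.closed (by omega) v hv u e' hu
    rcases eq_or_ne e' e with rfl | h
    · simp [Conf.remove]
    · simpa [Conf.remove, h] using this
  · have := hI.mass_le (by omega)
    simp only [mass, hm, hsp, Conf.remove, Finset.sum_range_succ, Finset.range_zero,
      Finset.sum_empty] at this ⊢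
    simp only [Function.update_self, ne_eq, zero_ne_one, not_false_eq_true, Function.update_of_ne,
      if_false] at this ⊢
    -- The 2U new units count four times.
    rw [show 8 * U * (c + 1) = 8 * U * c + 8 * U by ring]
    omega
  · intro h; simp only [Conf.remove] at h; omega
  · intro h; simp only [Conf.remove] at h; omega
  · intro h; simp only [Conf.remove] at h; omega
  · exact { hR with
      dead := forall_update_le hR.dead le_rfl
      sv := forall_update_le (forall_update_le hR.sv (hA.vert_lt ha).le)
        (hA.vert_lt (hA.symm ha)).le
      sc := forall_update_le (forall_update_le hR.sc (by omega)) (by omega) }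
  · have : ∑ i ∈ Finset.range 2, (σ.remove U e l r).sc i = 2 * U := by
      rw [← hadd]
      simp [Conf.remove, Finset.sum_range_succ]
    have h2 : (σ.remove U e l r).sp = 2 := rfl
    simp only [potential, modePotential]
    rw [h2, this, hsp]
    simp only [Conf.remove, hm, if_true, Finset.range_zero, Finset.sum_empty]
    push_cast
    ring

theorem Ready.potential_nonneg (hσ : Ready adj n m U H c σ) : 0 ≤ potential adj n U H σ := by
  have := hσ.invariant.core.reserve_nonneg (n := n)
  simp only [potential, modePotential, hσ.mode_eq, hσ.sp_eq, if_true]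
  simpa using this

end Requests

/-! ### Choice of the parameters, and the handling of one request. -/

section Run

variable {adj : ℕ → List (ℕ × ℕ)} {n m U H c B W : ℕ} {σ : Conf} {I : Input} {s : State}

theorem Invariant.bounded (hA : IsSymmAdj adj n m)
    (hH : ∀ r : ℕ, (1 + 1 / (8 * U) : ℝ) ^ r ≤ (2 * m : ℕ) → r < H)
    (hσ : Invariant adj n U H c σ) (hR : Ranged n m U σ) (hpot : potential adj n U H σ ≤ B)
    (hB : 1 ≤ B) (hn : n ≤ B) (hm : 2 * m ≤ B) (hUB : 2 * U ≤ B) (hHB : H ≤ B) : σ.Bounded B where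
  pr i := (hR.pr i).trans hB
  dead i := (hR.dead i).trans hB
  ab i := ((hσ.core.ab_le i).trans (hA.length_le i)).trans hm
  lev i := (hσ.core.lev_le i).trans hHB
  cur i := ((hσ.core.cur_le i).trans (hA.length_le i)).trans hm
  fl i := (hσ.core.fl_le i).trans (by omega)
  Q i := (hR.Q i).trans hn
  pos i := (hR.pos i).trans hm
  sv i := (hR.sv i).trans hn
  sc i := (hR.sc i).trans hUB
  mode := hσ.mode_le
  sp := by exact_mod_cast (hσ.sp_le_potential hA hH).trans hpot
  tok := hR.tok.trans hn
  idx := hR.idx.trans hm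
  arc := hR.arc.trans hm
  lo := hR.lo.trans hm
  len := hR.len.trans hm
  vS := hR.vS.trans hm
  vQ := hR.vQ.trans hm

theorem IsSymmAdj.boundedAdj (hA : IsSymmAdj adj n m) (hn : n ≤ B) (hm : 2 * m ≤ B) :
    BoundedAdj B adj where
  length_le v := (hA.length_le v).trans hm
  fst_le v j := by
    by_cases hj : j < (adj v).length
    · exact (hA.vert_lt (hA.symm (ArcAt.mem ⟨hj, rfl, rfl⟩))).le.trans hn
    · rw [List.getD_eq_default _ _ (not_lt.1 hj)]
      exact Nat.zero_le _
  snd_le v j := by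
    by_cases hj : j < (adj v).length
    · exact (hA.edge_lt (ArcAt.mem ⟨hj, rfl, rfl⟩)).le.trans (by omega)
    · rw [List.getD_eq_default _ _ (not_lt.1 hj)]
      exact Nat.zero_le _

/-- The capacity of an edge. -/
def capacity (I : Input) : ℕ := 2 * I.phiDen / I.phiNum + 1

/-- The number of doublings after which the volume of the graph is exceeded. -/
def doublings (I : Input) : ℕ := Nat.clog 2 (2 * I.numEdges + 1)

/-- The largest level. -/
def maxLevel (I : Input) : ℕ := 8 * capacity I * doublings I

/-- The volume at least doubles in every 8U layers, so after `maxLevel` layers it would exceed 2m.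
-/
theorem lt_maxLevel (r : ℕ) (h : (1 + 1 / (8 * capacity I) : ℝ) ^ r ≤ (2 * I.numEdges : ℕ)) :
    r < maxLevel I := by
  by_contra! hr
  have hU : (0 : ℝ) < 8 * capacity I := by unfold capacity; positivity
  have h1 : (1 : ℝ) ≤ 1 + 1 / (8 * capacity I) := by
    have : (0 : ℝ) ≤ 1 / (8 * capacity I) := by positivity
    linarith
  -- Bernoulli's inequality.
  have h2 : (2 : ℝ) ≤ (1 + 1 / (8 * capacity I)) ^ (8 * capacity I) := by
    have := one_add_mul_le_pow (a := (1 / (8 * capacity I) : ℝ)) (by linarith) (8 * capacity I)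
    push_cast at this
    rw [mul_one_div_cancel hU.ne'] at this
    linarith
  have h3 : (2 * I.numEdges + 1 : ℕ) ≤ (2 : ℝ) ^ doublings I := by
    exact_mod_cast Nat.le_pow_clog one_lt_two _
  have h4 : (2 : ℝ) ^ doublings I ≤ (1 + 1 / (8 * capacity I)) ^ r :=
    calc (2 : ℝ) ^ doublings I ≤ ((1 + 1 / (8 * capacity I)) ^ (8 * capacity I)) ^ doublings I := by
          gcongr
      _ = (1 + 1 / (8 * capacity I)) ^ maxLevel I := by rw [← pow_mul, maxLevel]
      _ ≤ _ := pow_le_pow_right₀ h1 hr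
  push_cast at h h3
  linarith

/-- The parameters are recomputed at each request, in O(log m) steps, which the time bound allows.
-/
theorem runs_setupProgram (hp : 0 < I.phiNum) (hpW : I.phiNum ≤ W) (hq : 2 * I.phiDen + 1 ≤ W)
    (hm : 4 * I.numEdges + 2 ≤ W) (hW : maxLevel I + 8 * capacity I + 8 ≤ W) :
    Runs I W setupProgram s fun s' t => s'.reg 3 = capacity I ∧ s'.reg 4 = maxLevel I ∧
      s'.cell = s.cell ∧ (∀ r, r ≠ 3 → r ≠ 4 → r ≠ 17 → s'.reg r = s.reg r) ∧
      t ≤ 50 * (doublings I + 1) := by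
  have hdiv : 2 * I.phiDen / I.phiNum ≤ 2 * I.phiDen := Nat.div_le_self _ _
  have hU : 2 * I.phiDen / I.phiNum + 1 = capacity I := rfl
  refine runs_seq (runs_setReg ?_ (runs_seq (runs_setReg ?_ (runs_seq (runs_setReg ?_ ?_)))))
  · simp only [Expr.Fits, Expr.eval, eval_mul, eval_div, eval_add]
    omega
  · simp only [Expr.Fits]; omega
  · simp only [Expr.Fits]; omega
  set s₁ := ((s.setReg 3 _).setReg 4 _).setReg 17 _ with hs₁
  -- After l rounds register 17 holds 2^l and register 4 holds 8Ul. A doubling occurs only below 2m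
  -- + 1, hence the bound 4m + 2.
  refine (runs_loop 20 (fun s' => s'.reg 3 = capacity I ∧ s'.cell = s.cell ∧
    (∀ r, r ≠ 3 → r ≠ 4 → r ≠ 17 → s'.reg r = s.reg r) ∧
    ∃ l ≤ doublings I, s'.reg 17 = 2 ^ l ∧ s'.reg 4 = 8 * capacity I * l ∧
      2 ^ l ≤ 4 * I.numEdges + 2)
    (fun s' => doublings I - Nat.log 2 (s'.reg 17)) ?_ ?_ ?_).mono ?_
  · rintro s' ⟨h3, -, -, l, hl, h17, -, hle⟩
    simp only [Expr.Fits, Expr.eval, eval_add, eval_mul]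
    exact ⟨by omega, by omega, eval_lt_le (by omega)⟩
  · rintro s' ⟨h3, hcell, hreg, l, hl, h17, h4, hle⟩ hb
    have hlt : 2 ^ l < 2 * I.numEdges + 1 := by
      by_contra! hc
      simp only [Expr.eval, eval_add, eval_mul, h17, ne_eq, eval_lt_eq_zero] at hb
      exact hb hc
    have hl' : l < doublings I := (Nat.lt_clog_iff_pow_lt one_lt_two).2 hlt
    have hH : 8 * capacity I * l ≤ maxLevel I := Nat.mul_le_mul_left _ hl
    refine runs_seq (runs_setReg ?_ (runs_setReg ?_ ⟨by simp [Expr.size], ?_, ?_⟩))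
    · simp only [Expr.Fits, Expr.eval, eval_mul, h17]
      omega
    · simp [Expr.Fits, Expr.eval, eval_mul, eval_add, State.setReg, h3, h4]
      omega
    · refine ⟨?_, ?_, ?_, l + 1, hl', ?_, ?_, ?_⟩
      · simpa [State.setReg] using h3
      · simpa [State.setReg] using hcell
      · intro r h3 h4 h17
        simpa [State.setReg, h4, h17] using hreg r h3 h4 h17
      · simp [State.setReg, Expr.eval, eval_mul, h17, pow_succ]
      · simp [State.setReg, Expr.eval, eval_mul, eval_add, h3, h4]
        ring
      · rw [pow_succ]; omega
    · simp only [State.setReg, Expr.eval, eval_mul, h17]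
      simp only [ne_eq, Nat.reduceEqDiff, not_false_eq_true, Function.update_of_ne,
        Function.update_self, ← pow_succ, Nat.log_pow one_lt_two]
      omega
  · refine ⟨?_, ?_, ?_, 0, Nat.zero_le _, ?_, ?_, ?_⟩
    · simp [hs₁, State.setReg, Expr.eval, eval_mul, eval_div, eval_add, capacity]
    · simp [hs₁, State.setReg]
    · intro r h3 h4 h17
      simp [hs₁, State.setReg, h3, h4, h17]
    · simp [hs₁, State.setReg, Expr.eval]
    · simp [hs₁, State.setReg, Expr.eval]
    · omega
  · rintro s' t ⟨⟨h3, hcell, hreg, l, hl, h17, h4, hle⟩, hb, ht⟩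
    have hge : 2 * I.numEdges + 1 ≤ 2 ^ l := by
      simpa only [Expr.eval, eval_add, eval_mul, h17, eval_lt_eq_zero] using hb
    have : l = doublings I := le_antisymm hl (Nat.clog_le_of_le_pow hge)
    refine ⟨h3, by rw [h4, this, maxLevel], hcell, hreg, ?_⟩
    have h1 : Nat.log 2 (s₁.reg 17) = 0 := by simp [hs₁, State.setReg, Expr.eval]
    simp only [Expr.size] at ht ⊢
    rw [h1, Nat.sub_zero] at ht
    omega

theorem update_ne_zero {f : ℕ → ℕ} {i j x : ℕ} (hx : x ≠ 0) (h : f j ≠ 0) :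
    Function.update f i x j ≠ 0 := by
  rcases eq_or_ne j i with rfl | hj
  · simpa
  · simpa [hj] using h

theorem Step.pr_ne_zero {σ' : Conf} (h : Step adj U H σ σ') {v : ℕ} (hv : σ.pr v ≠ 0) :
    σ'.pr v ≠ 0 := by
  cases h <;> first | exact hv | exact update_ne_zero one_ne_zero hv

theorem Step.dead_ne_zero {σ' : Conf} (h : Step adj U H σ σ') {e : ℕ} (he : σ.dead e ≠ 0) :
    σ'.dead e ≠ 0 := by
  cases h <;> first | exact he | exact update_ne_zero one_ne_zero he

/-- The effect of a request. -/
theorem runs_program (hA : IsSymmAdj I.adj I.numVertices I.numEdges) (hp : 0 < I.phiNum)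
    {B D : ℕ} (hD : D = 2 * capacity I * (8 * maxLevel I + 16) + 2)
    (hn : I.numVertices ≤ B) (hm : 2 * I.numEdges ≤ B) (hUB : 2 * capacity I ≤ B)
    (hHB : maxLevel I ≤ B) (hpB : I.phiNum ≤ B) (hqB : 2 * I.phiDen + 1 ≤ B)
    (hW : B * (8 * B + 1) + 8 * B + 10 ≤ W)
    (hs : Ready I.adj I.numVertices I.numEdges (capacity I) (maxLevel I) c (Conf.ofState s))
    (hpot : potential I.adj I.numVertices (capacity I) (maxLevel I) (Conf.ofState s) + D ≤ B)
    {d : Deletion} (hd : (d.right, d.edge) ∈ I.adj d.left) :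
    Runs I W program (s.receive d) fun s' t =>
      Ready I.adj I.numVertices I.numEdges (capacity I) (maxLevel I) (c + 1) (Conf.ofState s') ∧
      (∀ v, s.cell 0 v ≠ 0 → s'.cell 0 v ≠ 0) ∧ s'.cell 1 d.edge ≠ 0 ∧
      (∀ e, s.cell 1 e ≠ 0 → s'.cell 1 e ≠ 0) ∧
      (t : ℤ) + 300 * potential I.adj I.numVertices (capacity I) (maxLevel I) (Conf.ofState s') ≤
        300 * (potential I.adj I.numVertices (capacity I) (maxLevel I) (Conf.ofState s) + D) +
          200 * (doublings I + 1) := by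
  have hB1 : 1 ≤ B := by omega
  have hBW : 8 * B + 10 ≤ W := by omega
  have hU0 : 0 < capacity I := Nat.succ_pos _
  obtain ⟨hI, hR, hpot'⟩ := hs.remove hA hd
  rw [← hD] at hpot'
  refine runs_seq ((runs_setupProgram (s := s.receive d) hp (by omega) (by omega) (by omega)
    (by omega)).mono ?_)
  rintro s₁ t₁ ⟨h3, h4, hcell, hreg, ht₁⟩
  have hl := (hA.vert_lt hd).le.trans hn
  have hr := (hA.vert_lt (hA.symm hd)).le.trans hn
  have he : d.edge ≤ B := (hA.edge_lt hd).le.trans (by omega)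
  have r0 : s₁.reg 0 = d.edge := by
    rw [hreg 0 (by norm_num) (by norm_num) (by norm_num)]; simp [State.receive, State.setReg]
  have r1 : s₁.reg 1 = d.left := by
    rw [hreg 1 (by norm_num) (by norm_num) (by norm_num)]; simp [State.receive, State.setReg]
  have r2 : s₁.reg 2 = d.right := by
    rw [hreg 2 (by norm_num) (by norm_num) (by norm_num)]; simp [State.receive, State.setReg]
  have hcell' : s₁.cell = s.cell := by rw [hcell]; rfl
  have hconf : Conf.ofState s₁ = Conf.ofState s := by
    have : ∀ r, 5 ≤ r → r ≤ 13 → s₁.reg r = s.reg r := by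
      intro r h5 h13
      rw [hreg r (by omega) (by omega) (by omega)]
      have h0 : r ≠ 0 := by omega
      have h1 : r ≠ 1 := by omega
      have h2 : r ≠ 2 := by omega
      simp [State.receive, State.setReg, h0, h1, h2]
    simp only [Conf.ofState, hcell']
    rw [this 5, this 6, this 7, this 8, this 9, this 10, this 11, this 12, this 13] <;> norm_num
  have h5 : ∀ i, s₁.cell 5 i ≤ capacity I := by
    rw [hcell']; exact hs.invariant.core.fl_le
  have f0 : ∀ s : State, s.reg 0 = d.edge → (Expr.reg 0).Fits I W s := fun s h => by
    simp only [Expr.Fits, h]; omega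
  have f1 : ∀ s : State, s.reg 1 = d.left → (Expr.reg 1).Fits I W s := fun s h => by
    simp only [Expr.Fits, h]; omega
  have f2 : ∀ s : State, s.reg 2 = d.right → (Expr.reg 2).Fits I W s := fun s h => by
    simp only [Expr.Fits, h]; omega
  have fl : ∀ x ≤ 2, ∀ s : State, (Expr.lit x).Fits I W s := fun x hx s => by
    simp only [Expr.Fits]; omega
  have fr : ∀ v u s, v.Fits I W s → u.Fits I W s → s.reg 0 = d.edge → s.reg 3 = capacity I →
      s.cell 5 = s₁.cell 5 → (refundE v u (.reg 0)).Fits I W s := by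
    intro v u s hv hu h0 h3 hc
    refine fits_refundE (B := B) hv hu (f0 s h0) (by simpa only [Expr.eval, h0] using he)
      (by omega) (by omega) ?_
    rw [hc]
    exact fun i => (h5 i).trans (by omega)
  refine runs_seq ?_
  refine runs_seq (runs_setCell (fl 0 (by omega) _) (f1 _ r1) (runs_seq (runs_setCell
    (fl 0 (by omega) _) (fr _ _ _ (f1 _ r1) (f2 _ r2) r0 h3 ?_) (runs_seq (runs_setCell
    (fl 1 (by omega) _) (f2 _ r2) (runs_seq (runs_setCell (fl 1 (by omega) _)
    (fr _ _ _ (f2 _ r2) (f1 _ r1) r0 h3 ?_) (runs_seq (runs_setReg (fl 2 le_rfl _)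
    (runs_setCell (f0 _ ?_) (fl 1 (by omega) _) ?_))))))))))
  · simp [State.setCell]
  · simp [State.setCell]
  · simpa [State.setReg, State.setCell] using r0
  set s₂ := State.setCell _ 1 _ _ with hs₂
  have hconf₂ : Conf.ofState s₂ = (Conf.ofState s).remove (capacity I) d.edge d.left d.right := by
    rw [← hconf, hs₂]
    simp [Conf.ofState, Conf.remove, State.setCell, State.setReg, Expr.eval, refundE, eval_add,
      eval_sub, r0, r1, r2, h3]
  have hdead₂ : ∀ e, s.cell 1 e ≠ 0 ∨ e = d.edge → s₂.cell 1 e ≠ 0 := by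
    intro e he
    have : s₂.cell 1 = ((Conf.ofState s).remove (capacity I) d.edge d.left d.right).dead := by
      rw [← hconf₂]; rfl
    rw [this]
    rcases eq_or_ne e d.edge with rfl | hne
    · simp [Conf.remove]
    · simpa [Conf.remove, hne, Conf.ofState] using he
  have hpr₂ : s₂.cell 0 = s.cell 0 := by
    have : s₂.cell 0 = ((Conf.ofState s).remove (capacity I) d.edge d.left d.right).pr := by
      rw [← hconf₂]; rfl
    rw [this]; rfl
  have hbdd := hA.boundedAdj hn hm
  have hbdd' : ∀ s', Invariant I.adj I.numVertices (capacity I) (maxLevel I) (c + 1)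
      (Conf.ofState s') → Ranged I.numVertices I.numEdges (capacity I) (Conf.ofState s') →
      potential I.adj I.numVertices (capacity I) (maxLevel I) (Conf.ofState s') ≤ B →
      (Conf.ofState s').Bounded B := fun s' h1 h2 h3 =>
    h1.bounded hA (fun r => lt_maxLevel r) h2 h3 hB1 hn hm hUB hHB
  -- The bound on the potential belongs to the loop invariant because it controls the stack height,
  -- and so the size of words. The potential is nonnegative under the invariant, so `toNat` loses
  -- nothing.
  refine (runs_loop 200 (fun s' => s'.reg 3 = capacity I ∧ s'.reg 4 = maxLevel I ∧
    Invariant I.adj I.numVertices (capacity I) (maxLevel I) (c + 1) (Conf.ofState s') ∧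
    Ranged I.numVertices I.numEdges (capacity I) (Conf.ofState s') ∧
    potential I.adj I.numVertices (capacity I) (maxLevel I) (Conf.ofState s') ≤ B ∧
    (∀ v, s.cell 0 v ≠ 0 → s'.cell 0 v ≠ 0) ∧ (∀ e, s₂.cell 1 e ≠ 0 → s'.cell 1 e ≠ 0))
    (fun s' => (potential I.adj I.numVertices (capacity I) (maxLevel I) (Conf.ofState s')).toNat)
    ?_ ?_ ?_).mono ?_
  · rintro s' ⟨-, -, h1, h2, h3, -⟩
    have h4 := hbdd' s' h1 h2 h3
    have h5 := h4.mode
    have h6 := h4.sp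
    simp only [Conf.ofState] at h5 h6
    simp only [busyE, Expr.Fits, Expr.eval, eval_add]
    omega
  · rintro s' ⟨h3, h4, h1, h2, hle, hpr, hdead⟩ hb
    refine (runs_bodyProgram h3 h4 (by omega) (hbdd' s' h1 h2 hle) hbdd (by omega) hHB hb).mono ?_
    rintro s'' t ⟨ht, hstep, h3', h4'⟩
    have h1' := h1.step hA hU0 (fun r => lt_maxLevel r) hstep
    have hpos := h1.potential_step hA (fun r => lt_maxLevel r) hstep
    have hnn := (Int.natCast_nonneg _).trans (h1'.sp_le_potential hA (fun r => lt_maxLevel r))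
    refine ⟨ht, ⟨h3', h4', h1', h2.step hA h1 h1' hstep, by omega, ?_, ?_⟩, by omega⟩
    · exact fun v hv => hstep.pr_ne_zero (hpr v hv)
    · exact fun e he => hstep.dead_ne_zero (hdead e he)
  · rw [hconf₂]
    refine ⟨?_, ?_, hI, hR, by rw [hpot']; exact hpot, ?_, fun e => id⟩
    · rw [hs₂]; simpa [State.setReg, State.setCell] using h3
    · rw [hs₂]; simpa [State.setReg, State.setCell] using h4
    · rw [hpr₂]; exact fun v => id
  · rintro s' t ⟨⟨-, -, h1, h2, -, hpr, hdead⟩, hb, ht⟩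
    simp only [busyE, Expr.eval, eval_add, Nat.add_eq_zero_iff] at hb
    have hnn := (Int.natCast_nonneg _).trans (h1.sp_le_potential hA (fun r => lt_maxLevel r))
    have hnn' := (Int.natCast_nonneg _).trans (hI.sp_le_potential hA (fun r => lt_maxLevel r))
    refine ⟨⟨hb.1, hb.2, h1, h2⟩, hpr, hdead _ (hdead₂ _ (.inr rfl)),
      fun e he => hdead _ (hdead₂ _ (.inl he)), ?_⟩
    rw [hconf₂] at ht
    simp only [busyE, Expr.size, refundE, slotE] at ht ⊢
    zify at ht ht₁
    rw [Int.toNat_of_nonneg hnn, Int.toNat_of_nonneg hnn', hpot'] at ht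
    push_cast at ht ⊢
    have h9 : (0 : ℤ) ≤ doublings I := by positivity
    linarith

end Run

/-! ### Cuts -/

/-- The arcs that leave `S`. -/
def boundary (adj : ℕ → List (ℕ × ℕ)) (S : Finset ℕ) : Finset (Σ _ : ℕ, ℕ × ℕ) :=
  (S.sigma fun v => (adj v).toFinset).filter fun x => x.2.1 ∉ S

section Cuts

variable {adj : ℕ → List (ℕ × ℕ)} {n m U H c : ℕ} {σ : Conf} {S : Finset ℕ}

theorem mem_boundary {x : Σ _ : ℕ, ℕ × ℕ} :
    x ∈ boundary adj S ↔ x.1 ∈ S ∧ x.2 ∈ adj x.1 ∧ x.2.1 ∉ S := by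
  simp [boundary, and_assoc]

/-- An edge that leaves S has only one end in S, so it gives a single boundary arc. -/
theorem IsSymmAdj.injOn_boundary (hA : IsSymmAdj adj n m) :
    Set.InjOn (fun x : Σ _ : ℕ, ℕ × ℕ => x.2.2) (boundary adj S) := by
  rintro ⟨v, u, e⟩ h ⟨v', u', e'⟩ h' rfl
  obtain ⟨h1, h2, h3⟩ := mem_boundary.1 (Finset.mem_coe.1 h)
  obtain ⟨h1', h2', h3'⟩ := mem_boundary.1 (Finset.mem_coe.1 h')
  rcases hA.ends h2 h2' with ⟨hv, hu⟩ | ⟨hv, hu⟩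
  · simp only at hv hu
    rw [hv, hu]
  · simp only at hv hu h1' h3
    exact absurd (hv ▸ h1') h3

theorem IsSymmAdj.card_boundary_le (hA : IsSymmAdj adj n m) :
    (boundary adj S).card ≤ ∑ v ∈ S, (adj v).length :=
  (Finset.card_filter_le _ _).trans (by rw [Finset.card_sigma]; simp only [hA.card_eq, le_refl])

/-- The two inflows along a live edge cancel; along a dead one they add up to 2U. -/
theorem inflow_add_swap_nonneg (v u e : ℕ) :
    0 ≤ inflow U σ.fl σ.dead v (u, e) + inflow U σ.fl σ.dead u (v, e) := by
  unfold inflow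
  split_ifs
  · simp only; linarith
  · positivity

/-- The dead arcs that leave a set are paid for by the absorbed units and by the live arcs. -/
theorem Core.cut (hA : IsSymmAdj adj n m) (hc : Core adj U H σ) (hm : σ.mode = 0) (hsp : σ.sp = 0)
    (hS : ∀ v ∈ S, σ.pr v = 0) :
    U * ((boundary adj S).filter fun x => σ.dead x.2.2 ≠ 0).card ≤
      ∑ v ∈ S, σ.ab v + U * ((boundary adj S).filter fun x => ¬ σ.dead x.2.2 ≠ 0).card := by
  have htot : ∑ x ∈ S.sigma fun v => (adj v).toFinset, inflow U σ.fl σ.dead x.1 x.2 ≤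
      ∑ v ∈ S, (σ.ab v : ℤ) := by
    rw [Finset.sum_sigma]
    refine Finset.sum_le_sum fun v hv => ?_
    have := hc.balance v (hS v hv)
    simpa [hm, hsp, pend] using this
  rw [← Finset.sum_filter_add_sum_filter_not _ (fun x : Σ _ : ℕ, ℕ × ℕ => x.2.1 ∉ S)] at htot
  -- Reversal is an involution of the arcs inside S, so twice the sum is a sum of nonnegative pairs.
  -- A loop is paired with itself.
  have hin : 0 ≤ ∑ x ∈ (S.sigma fun v => (adj v).toFinset).filter (fun x => ¬ x.2.1 ∉ S),
      inflow U σ.fl σ.dead x.1 x.2 := by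
    have hswap : ∑ x ∈ (S.sigma fun v => (adj v).toFinset).filter (fun x => ¬ x.2.1 ∉ S),
        inflow U σ.fl σ.dead x.1 x.2 =
        ∑ x ∈ (S.sigma fun v => (adj v).toFinset).filter (fun x => ¬ x.2.1 ∉ S),
        inflow U σ.fl σ.dead x.2.1 (x.1, x.2.2) := by
      refine Finset.sum_nbij' (fun x => ⟨x.2.1, x.1, x.2.2⟩) (fun x => ⟨x.2.1, x.1, x.2.2⟩)
        ?_ ?_ (fun _ _ => rfl) (fun _ _ => rfl) (fun _ _ => rfl)
      all_goals
        rintro ⟨v, u, e⟩ h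
        simp only [Finset.mem_filter, Finset.mem_sigma, List.mem_toFinset, not_not] at h ⊢
        exact ⟨⟨h.2, hA.symm h.1.2⟩, h.1.1⟩
    have hadd : 0 ≤ ∑ x ∈ (S.sigma fun v => (adj v).toFinset).filter (fun x => ¬ x.2.1 ∉ S),
        (inflow U σ.fl σ.dead x.1 x.2 + inflow U σ.fl σ.dead x.2.1 (x.1, x.2.2)) :=
      Finset.sum_nonneg fun x _ => inflow_add_swap_nonneg x.1 x.2.1 x.2.2
    rw [Finset.sum_add_distrib, ← hswap] at hadd
    linarith
  change ∑ x ∈ boundary adj S, _ + _ ≤ _ at htot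
  rw [← Finset.sum_filter_add_sum_filter_not _ (fun x : Σ _ : ℕ, ℕ × ℕ => σ.dead x.2.2 ≠ 0)] at htot
  have hdead : ∑ x ∈ (boundary adj S).filter (fun x => σ.dead x.2.2 ≠ 0),
      inflow U σ.fl σ.dead x.1 x.2 =
      U * ((boundary adj S).filter fun x => σ.dead x.2.2 ≠ 0).card := by
    refine (Finset.sum_eq_card_nsmul (b := (U : ℤ)) fun x hx =>
      if_neg (Finset.mem_filter.1 hx).2).trans ?_
    rw [nsmul_eq_mul, mul_comm]
  have hlive : -(U * ((boundary adj S).filter fun x => ¬ σ.dead x.2.2 ≠ 0).card : ℤ) ≤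
      ∑ x ∈ (boundary adj S).filter (fun x => ¬ σ.dead x.2.2 ≠ 0),
        inflow U σ.fl σ.dead x.1 x.2 := by
    have := Finset.card_nsmul_le_sum ((boundary adj S).filter fun x => ¬ σ.dead x.2.2 ≠ 0)
      (fun x => inflow U σ.fl σ.dead x.1 x.2) (-U) fun x _ => neg_le_inflow hc.fl_le x.1 x.2
    rw [nsmul_eq_mul] at this
    linarith
  rw [← Nat.cast_le (α := ℤ)]
  rw [Nat.cast_add, Nat.cast_mul, Nat.cast_mul, Nat.cast_sum]
  linarith

end Cuts

/-! ### The adjacency lists of a graph -/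

section Represents

variable {I : Input} {G : Graph ℕ ℕ} {S : Finset ℕ}

theorem isSymmAdj_of_represents (h : I.Represents G) :
    IsSymmAdj I.adj I.numVertices I.numEdges where
  nodup := h.nodup
  symm {v u e} hu := by rw [h.mem_adj] at hu ⊢; exact hu.symm
  ends {v u v' u' e} hu hu' := by
    rw [h.mem_adj] at hu hu'
    rcases hu.eq_and_eq_or_eq_and_eq hu' with ⟨rfl, rfl⟩ | ⟨rfl, rfl⟩
    · exact .inl ⟨rfl, rfl⟩
    · exact .inr ⟨rfl, rfl⟩
  vert_lt {v u e} hu := by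
    have := ((h.mem_adj _ _ _).1 hu).left_mem
    rwa [h.vertexSet_eq] at this
  edge_lt {v u e} hu := by
    have := ((h.mem_adj _ _ _).1 hu).edge_mem
    rwa [h.edgeSet_eq] at this
  sum_le := by
    have hcard : ∑ v ∈ Finset.range I.numVertices, (I.adj v).length =
        ((Finset.range I.numVertices).sigma fun v => (I.adj v).toFinset).card := by
      rw [Finset.card_sigma]
      exact Finset.sum_congr rfl fun v _ => (List.toFinset_card_of_nodup (h.nodup v)).symm
    rw [hcard]
    refine (Finset.card_le_mul_card_image_of_maps_to (f := fun x : Σ _ : ℕ, ℕ × ℕ => x.2.2)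
      (t := Finset.range I.numEdges) ?_ 2 ?_).trans (by rw [Finset.card_range])
    · rintro ⟨v, u, e⟩ hx
      simp only [Finset.mem_sigma, List.mem_toFinset, h.mem_adj] at hx
      have := hx.2.edge_mem
      rw [h.edgeSet_eq] at this
      exact Finset.mem_range.2 this
    · intro e _
      rcases Finset.eq_empty_or_nonempty (((Finset.range I.numVertices).sigma
        fun v => (I.adj v).toFinset).filter fun x => x.2.2 = e) with h0 | ⟨⟨v, u, e'⟩, hx⟩
      · rw [h0]; simp
      · simp only [Finset.mem_filter, Finset.mem_sigma, List.mem_toFinset, h.mem_adj] at hx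
        obtain ⟨hx, rfl⟩ := hx
        -- An edge gives at most two arcs, and a loop only one.
        refine (Finset.card_le_card (t := {⟨v, u, e'⟩, ⟨u, v, e'⟩}) ?_).trans Finset.card_le_two
        rintro ⟨v', u', e''⟩ hy
        simp only [Finset.mem_filter, Finset.mem_sigma, List.mem_toFinset, h.mem_adj] at hy
        obtain ⟨hy, rfl⟩ := hy
        rcases hx.2.eq_and_eq_or_eq_and_eq hy.2 with ⟨rfl, rfl⟩ | ⟨rfl, rfl⟩ <;> simp

theorem degreeAt_eq (h : I.Represents G) (v : ℕ) : G.degreeAt v = (I.adj v).length := by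
  rw [← List.toFinset_card_of_nodup (h.nodup v), ← Finset.card_image_of_injOn (f := Prod.snd),
    ← Set.ncard_coe_finset, Graph.degreeAt]
  · congr 1
    ext e
    simp [Graph.Inc, h.mem_adj]
  · rintro ⟨u, e⟩ hu ⟨u', e'⟩ hu' rfl
    simp only [List.coe_toFinset, Set.mem_ofPred_eq, h.mem_adj] at hu hu'
    rcases hu.eq_and_eq_or_eq_and_eq hu' with ⟨-, rfl⟩ | ⟨rfl, rfl⟩ <;> rfl

theorem vol_eq (h : I.Represents G) (S : Finset ℕ) : G.vol S = ∑ v ∈ S, (I.adj v).length := by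
  rw [Graph.vol, finsum_mem_coe_finset]
  exact Finset.sum_congr rfl fun v _ => degreeAt_eq h v

theorem numEdgesBetween_le (h : I.Represents G) (S T : Finset ℕ) (hST : Disjoint S T) :
    G.numEdgesBetween S T ≤ (boundary I.adj S).card := by
  rw [← Finset.card_image_of_injOn (isSymmAdj_of_represents h).injOn_boundary,
    ← Set.ncard_coe_finset, Graph.numEdgesBetween]
  refine Set.ncard_le_ncard ?_ (Finset.finite_toSet _)
  rintro e ⟨x, hx, y, hy, hl⟩
  simp only [Finset.coe_image, Set.mem_image, Finset.mem_coe, mem_boundary]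
  exact ⟨⟨x, y, e⟩, ⟨hx, (h.mem_adj _ _ _).2 hl, Finset.disjoint_right.1 hST hy⟩, rfl⟩

end Represents

/-! ### Expansion of the remaining graph -/

section Expansion

variable {I : Input} {G : Graph ℕ ℕ} {U H c : ℕ} {σ : Conf} {φ : ℝ}

theorem numEdgesBetween_comm (G : Graph ℕ ℕ) (S T : Set ℕ) :
    G.numEdgesBetween S T = G.numEdgesBetween T S := by
  unfold Graph.numEdgesBetween
  congr 1
  ext e
  exact ⟨fun ⟨x, hx, y, hy, h⟩ => ⟨y, hy, x, hx, h.symm⟩,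
    fun ⟨x, hx, y, hy, h⟩ => ⟨y, hy, x, hx, h.symm⟩⟩

theorem vertexSet_eq_coe (h : I.Represents G) : V(G) = (Finset.range I.numVertices : Set ℕ) := by
  rw [h.vertexSet_eq]; ext; simp

theorem cutConductance_nonneg (G : Graph ℕ ℕ) (S : Set ℕ) : 0 ≤ G.cutConductance S := by
  unfold Graph.cutConductance; positivity

theorem conductance_le {G : Graph ℕ ℕ} {S : Set ℕ} (hS : S ∈ G.properCuts) :
    G.conductance ≤ G.cutConductance S := by
  rw [Graph.conductance, if_pos ⟨S, hS⟩]
  refine csInf_le ⟨0, ?_⟩ ⟨S, hS, rfl⟩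
  rintro _ ⟨T, -, rfl⟩
  exact cutConductance_nonneg G T

theorem le_conductance {G : Graph ℕ ℕ} {x : ℝ} (hx : x ≤ 1)
    (h : ∀ S ∈ G.properCuts, x ≤ G.cutConductance S) : x ≤ G.conductance := by
  unfold Graph.conductance
  split_ifs with hne
  · refine le_csInf (hne.image _) ?_
    rintro _ ⟨S, hS, rfl⟩
    exact h S hS
  · exact hx

theorem numEdgesBetween_le_vol (h : I.Represents G) {S T : Finset ℕ} (hST : Disjoint S T) :
    G.numEdgesBetween S T ≤ G.vol S := by
  rw [vol_eq h]
  exact (numEdgesBetween_le h S T hST).trans (isSymmAdj_of_represents h).card_boundary_le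

/-- A side of a cut has at least as much volume as the cut has edges. The resulting φ ≤ 1 is needed
for U ≤ 3/φ and for 10k ≤ m. -/
theorem conductance_le_one (h : I.Represents G) : G.conductance ≤ 1 := by
  by_cases hne : G.properCuts.Nonempty
  · obtain ⟨S, hS⟩ := hne
    refine (conductance_le hS).trans ?_
    obtain ⟨hSV, h1, h2⟩ := hS
    rw [vertexSet_eq_coe h] at hSV h2
    lift S to Finset ℕ using (Finset.finite_toSet _).subset hSV
    rw [Graph.cutConductance, vertexSet_eq_coe h]
    rw [← Finset.coe_sdiff] at h2 ⊢
    refine div_le_one_of_le₀ ?_ (Nat.cast_nonneg _)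
    rw [Nat.cast_le]
    refine le_min (numEdgesBetween_le_vol h Finset.disjoint_sdiff) ?_
    rw [numEdgesBetween_comm]
    exact numEdgesBetween_le_vol h Finset.sdiff_disjoint
  · rw [Graph.conductance, if_neg hne]

theorem mul_vol_le_boundary (h : I.Represents G) (hG : G.IsExpander φ) {S : Finset ℕ}
    (hS : S ⊆ Finset.range I.numVertices)
    (hvol : G.vol S ≤ G.vol (Finset.range I.numVertices \ S : Finset ℕ)) :
    φ * G.vol S ≤ (boundary I.adj S).card := by
  rcases Nat.eq_zero_or_pos (G.vol S) with h0 | h0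
  · rw [h0, Nat.cast_zero, mul_zero]
    exact Nat.cast_nonneg _
  · have hcut : (S : Set ℕ) ∈ G.properCuts := by
      refine ⟨?_, h0, ?_⟩
      · rw [vertexSet_eq_coe h]; exact_mod_cast hS
      · rw [vertexSet_eq_coe h, ← Finset.coe_sdiff]; omega
    have := hG.trans (conductance_le hcut)
    rw [Graph.cutConductance, vertexSet_eq_coe h, ← Finset.coe_sdiff, min_eq_left hvol,
      le_div_iff₀ (by exact_mod_cast h0)] at this
    exact this.trans (by exact_mod_cast numEdgesBetween_le h _ _ Finset.disjoint_sdiff)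

theorem finite_edges (h : I.Represents G) (S T : Set ℕ) :
    {e | ∃ x ∈ S, ∃ y ∈ T, G.IsLink e x y}.Finite := by
  refine (Set.finite_Iio I.numEdges).subset ?_
  rintro e ⟨x, -, y, -, hl⟩
  rw [← h.edgeSet_eq]
  exact hl.edge_mem

theorem isLink_of_induceWithLoops {F A : Set ℕ} {e x y : ℕ}
    (h : ((G.deleteEdges F).induceWithLoops A).IsLink e x y) : ∃ z, G.IsLink e x z := by
  rcases h with ⟨h, -⟩ | ⟨-, -, z, -, h⟩
  · exact ⟨y, h.1⟩
  · exact ⟨z, h.1⟩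

/-- The loops replace edges that leave `A`, so only the deletions in `F` lower degrees. One
inequality suffices, as volumes stand in the denominator of the conductance. -/
theorem vol_induceWithLoops_le (h : I.Represents G) (F A : Set ℕ) (S : Finset ℕ) :
    ((G.deleteEdges F).induceWithLoops A).vol S ≤ G.vol S := by
  rw [Graph.vol, Graph.vol, finsum_mem_coe_finset, finsum_mem_coe_finset]
  refine Finset.sum_le_sum fun v _ => Set.ncard_le_ncard ?_ ?_
  · rintro e ⟨y, hy⟩
    exact isLink_of_induceWithLoops hy
  · refine (finite_edges h Set.univ Set.univ).subset ?_
    rintro e ⟨y, hy⟩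
    exact ⟨v, trivial, y, trivial, hy⟩

/-- Cuts of the remaining graph with the smaller side `S` have many live edges. -/
theorem Ready.mul_vol_le (h : I.Represents G)
    (hG : G.IsExpander φ) (hU : 2 ≤ φ * U)
    (hσ : Ready I.adj I.numVertices I.numEdges U H c σ) {F : Set ℕ} (hF : ∀ e ∈ F, σ.dead e ≠ 0)
    {A S : Finset ℕ} (hA : A = (Finset.range I.numVertices).filter fun v => σ.pr v = 0)
    (hS : S ⊆ A) (hvol : G.vol S ≤ G.vol (A \ S : Finset ℕ)) :
    φ / 4 * G.vol S ≤
      ((G.deleteEdges F).induceWithLoops A).numEdgesBetween S (A \ S : Finset ℕ) := by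
  have hsymm := isSymmAdj_of_represents h
  have hmem : ∀ v, v ∈ A ↔ v < I.numVertices ∧ σ.pr v = 0 := by simp [hA]
  have hcut := hσ.invariant.core.cut hsymm hσ.mode_eq hσ.sp_eq
    (S := S) fun v hv => ((hmem v).1 (hS hv)).2
  have hsub : S ⊆ Finset.range I.numVertices := fun v hv =>
    Finset.mem_range.2 ((hmem v).1 (hS hv)).1
  -- The smaller side within `A` is also the smaller side within the whole vertex set.
  have hexp := mul_vol_le_boundary h hG hsub (hvol.trans (by
    rw [vol_eq h, vol_eq h]
    refine Finset.sum_le_sum_of_subset fun v hv => ?_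
    rw [Finset.mem_sdiff] at hv ⊢
    exact ⟨Finset.mem_range.2 ((hmem v).1 hv.1).1, hv.2⟩))
  have hab : ∑ v ∈ S, σ.ab v ≤ G.vol S := by
    rw [vol_eq h]
    exact Finset.sum_le_sum fun v _ => hσ.invariant.core.ab_le v
  rw [← Finset.card_filter_add_card_filter_not (fun x : Σ _ : ℕ, ℕ × ℕ => σ.dead x.2.2 ≠ 0)] at hexp
  have hlive : ((boundary I.adj S).filter fun x => ¬ σ.dead x.2.2 ≠ 0).card ≤
      ((G.deleteEdges F).induceWithLoops A).numEdgesBetween S (A \ S : Finset ℕ) := by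
    rw [← Finset.card_image_of_injOn (hsymm.injOn_boundary.mono (Finset.coe_subset.2
      (Finset.filter_subset _ _))), ← Set.ncard_coe_finset, Graph.numEdgesBetween]
    refine Set.ncard_le_ncard ?_ ((finite_edges h Set.univ Set.univ).subset ?_)
    · rintro e he
      simp only [Finset.coe_image, Set.mem_image, Finset.mem_coe, Finset.mem_filter,
        mem_boundary, not_not] at he
      obtain ⟨⟨v, u, e⟩, ⟨⟨hv, hu, huS⟩, hd⟩, rfl⟩ := he
      -- Edges at pruned vertices are dead, so a live boundary arc ends in `A`.
      have huA : u ∈ A := by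
        refine (hmem u).2 ⟨hsymm.vert_lt (hsymm.symm hu), ?_⟩
        by_contra hpr
        exact hσ.invariant.closed (by rw [hσ.mode_eq]; omega) u hpr v e (hsymm.symm hu) hd
      refine ⟨v, hv, u, Finset.mem_coe.2 (Finset.mem_sdiff.2 ⟨huA, huS⟩),
        .inl ⟨⟨(h.mem_adj _ _ _).1 hu, ?_⟩, hS hv, huA⟩⟩
      exact fun heF => hF e heF hd
    · rintro e ⟨x, -, y, -, hl⟩
      obtain ⟨z, hz⟩ := isLink_of_induceWithLoops hl
      exact ⟨x, trivial, z, trivial, hz⟩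
  have hU0 : (0 : ℝ) < U := by
    rcases Nat.eq_zero_or_pos U with h0 | h0
    · rw [h0] at hU; norm_num at hU
    · exact_mod_cast h0
  have hφ : 0 < φ := by
    by_contra! hn
    nlinarith
  set dd := ((boundary I.adj S).filter fun x => σ.dead x.2.2 ≠ 0).card
  set ll := ((boundary I.adj S).filter fun x => ¬ σ.dead x.2.2 ≠ 0).card
  have hcut' : (U : ℝ) * dd ≤ G.vol S + U * ll := by exact_mod_cast hcut.trans (by omega)
  have hlive' : (ll : ℝ) ≤ ((G.deleteEdges F).induceWithLoops A).numEdgesBetween S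
    (A \ S : Finset ℕ) := by exact_mod_cast hlive
  refine le_trans ?_ hlive'
  -- This is where φU ≥ 2 enters: dead ≤ φ vol(S)/2 + live, and with dead + live ≥ φ vol(S) it
  -- follows that 2 live ≥ φ vol(S)/2.
  have hv : (G.vol S : ℝ) ≤ φ / 2 * G.vol S * U := by
    have : (0 : ℝ) ≤ G.vol S := by positivity
    nlinarith
  have hdd : (dd : ℝ) ≤ φ / 2 * G.vol S + ll := by
    refine le_of_mul_le_mul_left ?_ hU0
    linarith
  push_cast at hexp
  linarith

theorem Ready.isExpander (h : I.Represents G)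
    (hG : G.IsExpander φ) (hU : 2 ≤ φ * U)
    (hσ : Ready I.adj I.numVertices I.numEdges U H c σ) {F : Set ℕ} (hF : ∀ e ∈ F, σ.dead e ≠ 0) :
    ((G.deleteEdges F).induceWithLoops (V(G) \ {v | v ∈ V(G) ∧ σ.pr v ≠ 0})).IsExpander (φ / 6) := by
  have hφ : 0 < φ := by
    by_contra! hn
    have : (0 : ℝ) ≤ U := Nat.cast_nonneg _
    nlinarith
  have hφ1 := hG.trans (conductance_le_one h)
  obtain ⟨A, hA⟩ : ∃ A, A = (Finset.range I.numVertices).filter fun v => σ.pr v = 0 := ⟨_, rfl⟩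
  have hset : V(G) \ {v | v ∈ V(G) ∧ σ.pr v ≠ 0} = A := by
    rw [vertexSet_eq_coe h, hA]
    ext v
    simp only [Set.mem_sdiff, Set.mem_ofPred_eq, Finset.coe_filter, Finset.mem_coe]
    tauto
  have hV : V((G.deleteEdges F).induceWithLoops A) = A := by
    change V(G) ∩ A = A
    rw [vertexSet_eq_coe h, hA]
    ext v
    simp
  rw [hset]
  refine le_conductance (by linarith) fun S hS => ?_
  obtain ⟨hSA, h1, h2⟩ := hS
  rw [hV] at hSA h2
  lift S to Finset ℕ using (Finset.finite_toSet _).subset hSA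
  rw [Finset.coe_subset] at hSA
  rw [Graph.cutConductance, hV]
  rw [← Finset.coe_sdiff] at h2 ⊢
  rw [le_div_iff₀ (by exact_mod_cast lt_min h1 h2)]
  -- The smaller side is chosen by volume in the initial graph, although the denominator uses
  -- volumes in the remaining graph; its minimum is at most the initial volume of either side.
  rcases le_total (G.vol S) (G.vol (A \ S : Finset ℕ)) with hle | hle
  · have key := hσ.mul_vol_le h hG hU hF hA hSA hle
    have hmin : ((min (((G.deleteEdges F).induceWithLoops A).vol S)
        (((G.deleteEdges F).induceWithLoops A).vol (A \ S : Finset ℕ)) : ℕ) : ℝ) ≤ G.vol S :=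
      Nat.cast_le.2 ((min_le_left _ _).trans (vol_induceWithLoops_le h F A S))
    refine le_trans ?_ key
    have : (0 : ℝ) ≤ G.vol S := by positivity
    nlinarith
  · have hss : A \ (A \ S) = S := Finset.sdiff_sdiff_eq_self hSA
    have key := hσ.mul_vol_le h hG hU hF hA (S := A \ S) Finset.sdiff_subset (by rwa [hss])
    rw [hss, numEdgesBetween_comm] at key
    have hmin : ((min (((G.deleteEdges F).induceWithLoops A).vol S)
        (((G.deleteEdges F).induceWithLoops A).vol (A \ S : Finset ℕ)) : ℕ) : ℝ) ≤
        G.vol (A \ S : Finset ℕ) :=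
      Nat.cast_le.2 ((min_le_right _ _).trans (vol_induceWithLoops_le h F A _))
    refine le_trans ?_ key
    have : (0 : ℝ) ≤ G.vol (A \ S : Finset ℕ) := by positivity
    nlinarith

/-- The size of the pruned set and of its boundary. -/
theorem Ready.prVol_add_le (h : I.Represents G)
    (hσ : Ready I.adj I.numVertices I.numEdges U H c σ) :
    3 * G.vol {v | v ∈ V(G) ∧ σ.pr v ≠ 0} +
      4 * ∑ v ∈ (Finset.range I.numVertices).filter (fun v => σ.pr v = 0), σ.ab v ≤ 8 * U * c := by
  have hset : {v | v ∈ V(G) ∧ σ.pr v ≠ 0} =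
      ((Finset.range I.numVertices).filter (fun v => ¬ σ.pr v = 0) : Finset ℕ) := by
    rw [vertexSet_eq_coe h]
    ext v
    simp
  have hmass := hσ.invariant.mass_le (by rw [hσ.mode_eq]; omega)
  rw [mass, hσ.mode_eq, hσ.sp_eq, ← Finset.sum_filter_add_sum_filter_not _ (fun v => σ.pr v = 0)]
    at hmass
  -- Pruned vertices are saturated, so they account for their whole volume in the mass.
  have hpr : ∑ v ∈ (Finset.range I.numVertices).filter (fun v => ¬ σ.pr v = 0), σ.ab v =
      ∑ v ∈ (Finset.range I.numVertices).filter (fun v => ¬ σ.pr v = 0), (I.adj v).length :=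
    Finset.sum_congr rfl fun v hv =>
      (hσ.invariant.core.pr_full v (Finset.mem_filter.1 hv).2).1
  have hprVol : prVol I.adj I.numVertices σ.pr =
      ∑ v ∈ (Finset.range I.numVertices).filter (fun v => ¬ σ.pr v = 0), (I.adj v).length := by
    rw [prVol, Finset.sum_filter]
    exact Finset.sum_congr rfl fun v _ => by split_ifs <;> rfl
  rw [hset, vol_eq h]
  rw [hpr, hprVol] at hmass
  simp only [Finset.range_zero, Finset.sum_empty, zero_ne_one, if_false] at hmass
  omega

/-- All edges between pruned and unpruned vertices are dead, so `Core.cut` for the unpruned set has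
no live term: U times the boundary is at most the units absorbed there, hence at most 2Uc. -/
theorem Ready.numEdgesBetween_le (h : I.Represents G) (hU : 0 < U)
    (hσ : Ready I.adj I.numVertices I.numEdges U H c σ) :
    G.numEdgesBetween {v | v ∈ V(G) ∧ σ.pr v ≠ 0} (V(G) \ {v | v ∈ V(G) ∧ σ.pr v ≠ 0}) ≤ 2 * c := by
  have hsymm := isSymmAdj_of_represents h
  obtain ⟨A, hA⟩ : ∃ A, A = (Finset.range I.numVertices).filter fun v => σ.pr v = 0 := ⟨_, rfl⟩
  have hset : V(G) \ {v | v ∈ V(G) ∧ σ.pr v ≠ 0} = A := by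
    rw [vertexSet_eq_coe h, hA]
    ext v
    simp only [Set.mem_sdiff, Set.mem_ofPred_eq, Finset.coe_filter, Finset.mem_coe]
    tauto
  have hset' : {v | v ∈ V(G) ∧ σ.pr v ≠ 0} = (Finset.range I.numVertices \ A : Finset ℕ) := by
    rw [vertexSet_eq_coe h, hA]
    ext v
    simp only [Finset.mem_coe, Finset.mem_range, Finset.mem_sdiff, Finset.mem_filter,
      Set.mem_ofPred_eq]
    tauto
  have hmem : ∀ v ∈ A, σ.pr v = 0 := by simp [hA]
  rw [hset, hset', numEdgesBetween_comm]
  refine (Pruning.numEdgesBetween_le h _ _ Finset.disjoint_sdiff).trans ?_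
  have hcut := hσ.invariant.core.cut hsymm hσ.mode_eq hσ.sp_eq hmem
  have hall : ∀ x ∈ boundary I.adj A, σ.dead x.2.2 ≠ 0 := by
    rintro ⟨v, u, e⟩ hx
    obtain ⟨hv, hu, huA⟩ := mem_boundary.1 hx
    have hpr : σ.pr u ≠ 0 := by
      intro hpr
      refine huA ?_
      rw [hA]
      exact Finset.mem_filter.2 ⟨Finset.mem_range.2 (hsymm.vert_lt (hsymm.symm hu)), hpr⟩
    exact hσ.invariant.closed (by rw [hσ.mode_eq]; omega) u hpr v e (hsymm.symm hu)
  rw [Finset.filter_true_of_mem hall, Finset.filter_false_of_mem fun x hx => not_not.2 (hall x hx),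
    Finset.card_empty] at hcut
  have := hσ.prVol_add_le h
  rw [← hA] at this
  refine Nat.le_of_mul_le_mul_left (c := U) ?_ hU
  have h1 : U * (2 * c) = 2 * (U * c) := by ring
  have h2 : 8 * U * c = 8 * (U * c) := by ring
  omega

end Expansion

/-! ### The online run -/

/-- An upper bound for the potential created by a request. -/
def requestCost (I : Input) : ℕ := 2 * capacity I * (8 * maxLevel I + 16) + 2

section OnlineRun

variable {I : Input} {G : Graph ℕ ℕ} {φ : ℝ} {k B W : ℕ} {d : ℕ → Deletion}

/-- The potential telescopes over the requests, which gives both the total time and a bound on the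
data throughout the run. -/
theorem exists_onlineRun (hA : IsSymmAdj I.adj I.numVertices I.numEdges) (hp : 0 < I.phiNum)
    (hn : I.numVertices ≤ B) (hm : 2 * I.numEdges ≤ B) (hUB : 2 * capacity I ≤ B)
    (hHB : maxLevel I ≤ B) (hpB : I.phiNum ≤ B) (hqB : 2 * I.phiDen + 1 ≤ B)
    (hW : B * (8 * B + 1) + 8 * B + 10 ≤ W) (hB : k * (requestCost I + (doublings I + 1)) ≤ B)
    (hd : ∀ i < k, ((d i).right, (d i).edge) ∈ I.adj (d i).left) :
    ∃ s t, OnlineRun I W program k d s t ∧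
      (∀ i ≤ k, Ready I.adj I.numVertices I.numEdges (capacity I) (maxLevel I) i
        (Conf.ofState (s i)) ∧ ∀ j < i, (s i).cell 1 (d j).edge ≠ 0) ∧
      (∀ i < k, ∀ v, (s i).cell 0 v ≠ 0 → (s (i + 1)).cell 0 v ≠ 0) ∧
      ∑ i ∈ Finset.range k, t i ≤ k * (300 * requestCost I + 200 * (doublings I + 1)) := by
  set pot : State → ℤ := fun s =>
    potential I.adj I.numVertices (capacity I) (maxLevel I) (Conf.ofState s) with hpot
  set Good : ℕ → State → Prop := fun i s =>
    Ready I.adj I.numVertices I.numEdges (capacity I) (maxLevel I) i (Conf.ofState s) ∧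
    (∀ j < i, s.cell 1 (d j).edge ≠ 0) ∧
    pot s ≤ (i * (requestCost I + (doublings I + 1)) : ℕ) with hGood
  -- Stated for all states, with the conditions inside, so that successor and time can be chosen as
  -- functions. Outside the good states the values are arbitrary.
  have hstep : ∀ i s, ∃ s' t, i < k → Good i s →
      Exec I W program (s.receive (d i)) s' t ∧ Good (i + 1) s' ∧
      (∀ v, s.cell 0 v ≠ 0 → s'.cell 0 v ≠ 0) ∧
      (t : ℤ) + 300 * pot s' ≤ 300 * (pot s + requestCost I) + 200 * (doublings I + 1) := by
    intro i s
    by_cases h : i < k ∧ Good i s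
    · obtain ⟨hi, hR, hdead, hle⟩ := h
      have hle' : pot s + requestCost I ≤ B := by
        have h1 : (i + 1) * (requestCost I + (doublings I + 1)) ≤
          k * (requestCost I + (doublings I + 1)) := Nat.mul_le_mul_right _ hi
        rw [add_mul, one_mul] at h1
        omega
      obtain ⟨s', t, hexec, hR', hpr, hde, hdead', ht⟩ :=
        runs_program hA hp rfl hn hm hUB hHB hpB hqB hW hR hle' (hd i hi)
      refine ⟨s', t, fun _ _ => ⟨hexec, ⟨hR', fun j hj => ?_, ?_⟩, hpr, ht⟩⟩
      · rcases Nat.lt_succ_iff_lt_or_eq.1 hj with hj | rfl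
        · exact hdead' _ (hdead j hj)
        · exact hde
      -- The time is dropped, and 200 ≤ 300 turns the time estimate into one for the potential;
      -- hence the summand `doublings I + 1`.
      · rw [add_mul, one_mul]
        change (t : ℤ) + 300 * pot s' ≤ 300 * (pot s + requestCost I) + _ at ht
        push_cast at hle ⊢
        have : (0 : ℤ) ≤ t := Int.natCast_nonneg _
        linarith
    · exact ⟨s, 0, fun h1 h2 => absurd ⟨h1, h2⟩ h⟩
  choose f g hfg using hstep
  set s : ℕ → State := fun i => Nat.rec State.blank f i with hs
  have hgood : ∀ i ≤ k, Good i (s i) := by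
    intro i
    induction i with
    | zero =>
      exact fun _ => ⟨ready_blank, fun j hj => absurd hj (Nat.not_lt_zero j),
        by simp [hpot, hs, potential_blank]⟩
    | succ i ih => exact fun hi => (hfg i (s i) hi (ih (by omega))).2.1
  refine ⟨s, fun i => g i (s i), ⟨rfl, fun i hi => (hfg i (s i) hi (hgood i hi.le)).1⟩,
    fun i hi => ⟨(hgood i hi).1, (hgood i hi).2.1⟩,
    fun i hi => (hfg i (s i) hi (hgood i hi.le)).2.2.1, ?_⟩
  have hsum : ∀ i ≤ k, ((∑ j ∈ Finset.range i, g j (s j) : ℕ) : ℤ) + 300 * pot (s i) ≤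
      i * (300 * requestCost I + 200 * (doublings I + 1)) := by
    intro i
    induction i with
    | zero => simp [hpot, hs, potential_blank]
    | succ i ih =>
      intro hi
      have h1 := ih (by omega)
      have h2 := (hfg i (s i) hi (hgood i (by omega))).2.2.2
      rw [Finset.sum_range_succ]
      push_cast at h1 ⊢
      change _ + 300 * pot (s (i + 1)) ≤ _ at h2
      linarith
  have h1 := hsum k le_rfl
  have h2 : 0 ≤ pot (s k) := (hgood k le_rfl).1.potential_nonneg
  zify
  push_cast at h1
  linarith

theorem doublings_le : doublings I ≤ 2 * I.numEdges + 1 :=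
  Nat.clog_le_of_le_pow Nat.lt_two_pow_self.le

theorem capacity_le : capacity I ≤ 2 * I.phiDen + 1 :=
  Nat.succ_le_succ (Nat.div_le_self _ _)

theorem two_le_mul_capacity (hp : 0 < I.phiNum) (hq : 0 < I.phiDen) :
    2 ≤ (I.phiNum : ℝ) / I.phiDen * capacity I := by
  have h1 : 2 * I.phiDen ≤ I.phiNum * capacity I := (Nat.lt_mul_div_succ _ hp).le
  have h2 : (0 : ℝ) < I.phiDen := by exact_mod_cast hq
  rw [div_mul_eq_mul_div, le_div_iff₀ h2]
  exact_mod_cast h1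

/-- The 1 added to 2/φ is at most 1/φ. -/
theorem capacity_le_div (hp : 0 < I.phiNum) (hq : 0 < I.phiDen)
    (h1 : (I.phiNum : ℝ) / I.phiDen ≤ 1) :
    (capacity I : ℝ) ≤ 3 / ((I.phiNum : ℝ) / I.phiDen) := by
  have hp' : (0 : ℝ) < I.phiNum := by exact_mod_cast hp
  have hq' : (0 : ℝ) < I.phiDen := by exact_mod_cast hq
  have h2 : ((2 * I.phiDen / I.phiNum : ℕ) : ℝ) ≤ (2 * I.phiDen : ℕ) / I.phiNum := Nat.cast_div_le
  rw [div_le_one hq'] at h1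
  have h3 : 1 ≤ (I.phiDen : ℝ) / I.phiNum := by rwa [one_le_div hp']
  rw [capacity, div_div_eq_mul_div, mul_div_assoc]
  push_cast at h2 ⊢
  rw [mul_div_assoc] at h2
  linarith

theorem Ready.vol_le (h : I.Represents G) (hp : 0 < I.phiNum) (hq : 0 < I.phiDen)
    (hφ : φ = (I.phiNum : ℝ) / I.phiDen) (h1 : φ ≤ 1) {H c : ℕ} {σ : Conf}
    (hσ : Ready I.adj I.numVertices I.numEdges (capacity I) H c σ) :
    (G.vol {v | v ∈ V(G) ∧ σ.pr v ≠ 0} : ℝ) ≤ 8 * c / φ := by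
  have h2 := (Nat.le_add_right _ _).trans (hσ.prVol_add_le h)
  have h3 : (3 * G.vol {v | v ∈ V(G) ∧ σ.pr v ≠ 0} : ℝ) ≤ 8 * capacity I * c := by
    exact_mod_cast h2
  have h4 := capacity_le_div hp hq (hφ ▸ h1)
  rw [← hφ] at h4
  have h5 : (8 * capacity I * c : ℝ) ≤ 8 * (3 / φ) * c := by gcongr
  have h6 : 8 * (3 / φ) * c = 3 * (8 * c / φ) := by ring
  linarith

theorem doublings_le_log (hm : 10 ≤ I.numEdges) :
    (doublings I : ℝ) ≤ 5 * Real.log I.numEdges ∧ 1 ≤ Real.log I.numEdges := by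
  have hm' : (10 : ℝ) ≤ I.numEdges := by exact_mod_cast hm
  have hlog : 1 ≤ Real.log I.numEdges := by
    rw [Real.le_log_iff_exp_le (by linarith)]
    linarith [Real.exp_one_lt_d9]
  refine ⟨?_, hlog⟩
  have h1 : 2 ^ (doublings I - 1) < 2 * I.numEdges + 1 :=
    Nat.pow_pred_clog_lt_self one_lt_two (by omega)
  -- Since 2m + 1 ≤ m² for m ≥ 10, the number of doublings is at most 1 + 2 log m / log 2, and 1 ≤
  -- log m.
  have h2 : (2 : ℝ) ^ (doublings I - 1) ≤ (I.numEdges : ℝ) ^ 2 := by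
    have : (2 : ℝ) ^ (doublings I - 1) < 2 * I.numEdges + 1 := by exact_mod_cast h1
    nlinarith
  have h3 := Real.log_le_log (by positivity) h2
  rw [Real.log_pow, Real.log_pow] at h3
  have h4 : (doublings I : ℝ) - 1 ≤ (doublings I - 1 : ℕ) := by
    rw [sub_le_iff_le_add]
    exact_mod_cast (le_tsub_add : doublings I ≤ doublings I - 1 + 1)
  have h5 := Real.log_two_gt_d9
  have h6 : (0 : ℝ) ≤ (doublings I - 1 : ℕ) := Nat.cast_nonneg _
  push_cast at h3
  nlinarith

/-- The number of words that are needed. -/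
theorem wordBound {N : ℕ} (hN : N = I.numVertices + I.numEdges + I.phiNum + I.phiDen + 2)
    (hp : 0 < I.phiNum) (hq : 0 < I.phiDen) (hk : k ≤ I.numEdges) :
    I.numVertices ≤ N ^ 10 ∧ 2 * I.numEdges ≤ N ^ 10 ∧ 2 * capacity I ≤ N ^ 10 ∧
    maxLevel I ≤ N ^ 10 ∧ I.phiNum ≤ N ^ 10 ∧ 2 * I.phiDen + 1 ≤ N ^ 10 ∧
    N ^ 10 * (8 * N ^ 10 + 1) + 8 * N ^ 10 + 10 ≤ N ^ 23 ∧
    k * (requestCost I + (doublings I + 1)) ≤ N ^ 10 := by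
  -- The powers of N left over absorb the constants, for instance 1100 ≤ 4^6 and 64 = 4^3.
  have hN4 : 4 ≤ N := by omega
  have h6 : 4 ^ 6 ≤ N ^ 6 := Nat.pow_le_pow_left hN4 6
  have h3 : 4 ^ 3 ≤ N ^ 3 := Nat.pow_le_pow_left hN4 3
  have hU : capacity I ≤ 2 * N := capacity_le.trans (by omega)
  have hL : doublings I ≤ 2 * N := doublings_le.trans (by omega)
  have hH : maxLevel I ≤ 32 * N ^ 2 := by
    calc maxLevel I ≤ 8 * (2 * N) * (2 * N) := by unfold maxLevel; gcongr
      _ = 32 * N ^ 2 := by ring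
  have hN2 : N ≤ N ^ 3 := Nat.le_self_pow (by norm_num) N
  have hD : requestCost I + (doublings I + 1) ≤ 1100 * N ^ 3 := by
    calc requestCost I + (doublings I + 1)
        ≤ 2 * (2 * N) * (8 * (32 * N ^ 2) + 16) + 2 + (2 * N + 1) := by unfold requestCost; gcongr
      _ = 1024 * N ^ 3 + 66 * N + 3 := by ring
      _ ≤ 1100 * N ^ 3 := by omega
  have hkD : k * (requestCost I + (doublings I + 1)) ≤ N ^ 10 := by
    calc k * (requestCost I + (doublings I + 1)) ≤ N * (1100 * N ^ 3) :=
          Nat.mul_le_mul (by omega) hD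
      _ = 1100 * N ^ 4 := by ring
      _ ≤ N ^ 6 * N ^ 4 := Nat.mul_le_mul_right _ (by omega)
      _ = N ^ 10 := by ring
  have hlin : 32 * N ^ 2 ≤ N ^ 10 := by
    calc 32 * N ^ 2 ≤ N ^ 8 * N ^ 2 :=
          Nat.mul_le_mul_right _ (by calc 32 ≤ 4 ^ 8 := by norm_num
                                    _ ≤ N ^ 8 := Nat.pow_le_pow_left hN4 8)
      _ = N ^ 10 := by ring
  have hsq : N ≤ N ^ 2 := Nat.le_self_pow (by norm_num) N
  refine ⟨by omega, by omega, by omega, by omega, by omega, by omega, ?_, hkD⟩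
  have hB : 1 ≤ N ^ 10 := by omega
  have hB2 : N ^ 10 ≤ N ^ 10 * N ^ 10 := Nat.le_mul_of_pos_right _ hB
  calc N ^ 10 * (8 * N ^ 10 + 1) + 8 * N ^ 10 + 10
      = 8 * (N ^ 10 * N ^ 10) + 9 * N ^ 10 + 10 := by ring
    _ ≤ 64 * (N ^ 10 * N ^ 10) := by omega
    _ ≤ N ^ 3 * (N ^ 10 * N ^ 10) := Nat.mul_le_mul_right _ h3
    _ = N ^ 23 := by ring

/-- The leading term is 128 U² times the number of doublings, with U ≤ 3/φ. All others are dominated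
by log m / φ², because φ ≤ 1 ≤ log m. -/
theorem steps_le (hp : 0 < I.phiNum) (hq : 0 < I.phiDen) (hφ : φ = (I.phiNum : ℝ) / I.phiDen)
    (h1 : φ ≤ 1) (hm : 10 ≤ I.numEdges) :
    (300 * requestCost I + 200 * (doublings I + 1) : ℝ) ≤
      2000000 * (Real.log I.numEdges / φ ^ 2) := by
  have hφ0 : 0 < φ := by rw [hφ]; positivity
  have hU := capacity_le_div hp hq (hφ ▸ h1)
  rw [← hφ] at hU
  obtain ⟨hL, hl⟩ := doublings_le_log hm
  set x := 1 / φ with hx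
  have hx1 : 1 ≤ x := by rwa [hx, one_le_div hφ0]
  have e1 : Real.log I.numEdges / φ ^ 2 = Real.log I.numEdges * x ^ 2 := by
    rw [hx]; field_simp
  have e2 : 3 / φ = 3 * x := by rw [hx]; field_simp
  rw [e2] at hU
  rw [e1]
  set l := Real.log I.numEdges
  have e3 : (requestCost I : ℝ) = 128 * (capacity I) ^ 2 * doublings I + 32 * capacity I + 2 := by
    unfold requestCost maxLevel; push_cast; ring
  have b1 : (128 : ℝ) * (capacity I) ^ 2 * doublings I ≤ 128 * (3 * x) ^ 2 * (5 * l) := by gcongr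
  have hxx : x ≤ x ^ 2 := by nlinarith
  have b2 : x ≤ l * x ^ 2 := by nlinarith
  have b3 : l ≤ l * x ^ 2 := by nlinarith
  rw [e3]
  nlinarith

end OnlineRun

end Pruning

end WordRAM

open WordRAM WordRAM.Pruning in
theorem mainTheorem2 :
    ∃ (prog : WordRAM.Program) (c : ℕ) (C : ℝ),
      ∀ (G : Graph ℕ ℕ) (I : WordRAM.Input) (φ : ℝ) (k : ℕ) (d : ℕ → WordRAM.Deletion),
        I.Represents G →
        0 < I.phiNum → 0 < I.phiDen → φ = (I.phiNum : ℝ) / (I.phiDen : ℝ) →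
        G.IsExpander φ →
        (k : ℝ) ≤ φ * (I.numEdges : ℝ) / 10 →
        WordRAM.IsDeletionSequence G k d →
        ∃ (s : ℕ → WordRAM.State) (t : ℕ → ℕ) (P : ℕ → Set ℕ),
          WordRAM.OnlineRun I
            ((I.numVertices + I.numEdges + I.phiNum + I.phiDen + 2) ^ c) prog k d s t ∧
          (∀ i, P i = (s i).markedSet G) ∧
          P 0 = ∅ ∧
          (∀ i < k, P i ⊆ P (i + 1)) ∧
          (∀ i ≤ k,
            (G.vol (P i) : ℝ) ≤ 8 * (i : ℝ) / φ ∧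
            G.numEdgesBetween (P i) (V(G) \ P i) ≤ 4 * i ∧
            ((WordRAM.graphAfter G d i).induceWithLoops (V(G) \ P i)).IsExpander (φ / 6)) ∧
          ((∑ i ∈ Finset.range k, t i : ℕ) : ℝ) ≤
            C * ((k : ℝ) * Real.log (I.numEdges : ℝ) / φ ^ 2) := by
  refine ⟨program, 23, 2000000, fun G I φ k d h hp hq hφ hG hk hd => ?_⟩
  have hp' : (0 : ℝ) < I.phiNum := by exact_mod_cast hp
  have hq' : (0 : ℝ) < I.phiDen := by exact_mod_cast hq
  have hφ0 : 0 < φ := by rw [hφ]; positivity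
  have hφ1 : φ ≤ 1 := hG.trans (conductance_le_one h)
  have hkm : 10 * k ≤ I.numEdges := by
    have : (10 * k : ℝ) ≤ I.numEdges := by
      have : (0 : ℝ) ≤ I.numEdges := Nat.cast_nonneg _
      nlinarith
    exact_mod_cast this
  obtain ⟨b1, b2, b3, b4, b5, b6, b7, b8⟩ := wordBound (k := k) rfl hp hq (by omega)
  obtain ⟨s, t, hrun, hready, hmono, ht⟩ := exists_onlineRun (isSymmAdj_of_represents h) hp
    b1 b2 b3 b4 b5 b6 b7 b8 (d := d) fun i hi => (h.mem_adj _ _ _).2 (hd.isLink i hi)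
  refine ⟨s, t, fun i => (s i).markedSet G, hrun, fun _ => rfl, ?_, ?_, ?_, ?_⟩
  · ext v
    simp [State.markedSet, hrun.start, State.blank]
  · exact fun i hi v hv => ⟨hv.1, hmono i hi v hv.2⟩
  · intro i hi
    obtain ⟨hR, hdead⟩ := hready i hi
    refine ⟨?_, ?_, ?_⟩
    · exact hR.vol_le h hp hq hφ hφ1
    · exact (hR.numEdgesBetween_le h (Nat.succ_pos _)).trans (Nat.mul_le_mul_right _ (by norm_num))
    · refine hR.isExpander h hG (hφ ▸ two_le_mul_capacity hp hq) ?_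
      rintro e ⟨j, hj, rfl⟩
      exact hdead j hj
  -- Without requests both sides vanish. Otherwise m ≥ 10k ≥ 10, as the logarithmic estimates
  -- require.
  · rcases Nat.eq_zero_or_pos k with rfl | hk0
    · simp
    · have h1 := steps_le hp hq hφ hφ1 (by omega)
      have h2 : ((∑ i ∈ Finset.range k, t i : ℕ) : ℝ) ≤
          (k * (300 * requestCost I + 200 * (doublings I + 1)) : ℕ) := Nat.cast_le.2 ht
      have h3 := mul_le_mul_of_nonneg_left h1 (Nat.cast_nonneg (α := ℝ) k)
      rw [Nat.cast_mul, Nat.cast_add, Nat.cast_mul, Nat.cast_mul, Nat.cast_add, Nat.cast_ofNat,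
        Nat.cast_ofNat, Nat.cast_one] at h2
      refine h2.trans (h3.trans_eq ?_)
      ring
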